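/- Notation. For $z\in\mathbb C$ and $w\in\mathbb D=\{|w|<1\}$ let $P_n(z,w)=n!\sum_{p=0}^{\lfloor n/2\rfloor}\left(\frac w2\right)^p\frac{z^{n-2p}}{p!\,(n-2p)!}$. For $k>0$ consider the kernel on $\mathbb C\times\mathbb D$ $$K_k\big((z,w),(z',w')\big)=(1-w\bar w')^{-2k}\exp\frac{2z\bar z'+z^2\bar w'+\bar z'^2w}{2(1-w\bar w')} .$$ The universal cover $\widetilde{SU}(1,1)$ is parametrized by $(\omega,\gamma)\in\mathbb R\times\mathbb D$, lying over the matrix $\begin{pmatrix}a&b\\ \bar b&\bar a\end{pmatrix}$ with $a=e^{i\omega}(1-|\gamma|^2)^{-1/2}$, $b=e^{i\omega}\gamma(1-|\gamma|^2)^{-1/2}$. The covering Jacobi group $\tilde G^J_1=HW\rtimes\widetilde{SU}(1,1)$ consists of the triples $h=(\tilde g,\alpha,t)$, $\alpha\in\mathbb C$, $t\in\mathbb R$, with composition $(\tilde g_1,\alpha_1,t_1)(\tilde g_2,\alpha_2,t_2)=(\tilde g_1\tilde g_2,\ g_2^{-1}\cdot\alpha_1+\alpha_2,\ t_1+t_2+\operatorname{Im}(g_2^{-1}\cdot\alpha_1\,\bar\alpha_2))$,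 where $g^{-1}\cdot\alpha=\bar a\alpha-b\bar\alpha$. Let $\mathcal F$ be the Fock space with orthonormal basis $(\varphi_n)_{n\ge0}$ and $a\varphi_n=\sqrt n\,\varphi_{n-1}$, $a^\dagger\varphi_n=\sqrt{n+1}\,\varphi_{n+1}$ (operators are written here in the same letter $a$ as the matrix entry). We consider two realizations of the Jacobi algebra. (i) $k=\frac14$: on $\mathcal F$, $K_+=\frac12(a^\dagger)^2$, $K_-=\frac12a^2$, $K_0=\frac12(a^\dagger a+\frac12)$, $e_0=\varphi_0$. (ii) $k=k'+\frac14$ with $k'>0$ real: on $\mathcal F\otimes\mathcal D_{k'}$, where $\mathcal D_{k'}$ has orthonormal basis $(\phi_{k'm})_{m\ge0}$ and $K_0'\phi_{k'm}=(k'+m)\phi_{k'm}$, $K'_+\phi_{k'm}=\sqrt{(m+1)(m+2k')}\,\phi_{k',m+1}$, $K'_-\phi_{k'm}=\sqrt{m(m+2k'-1)}\,\phi_{k',m-1}$: $K_\pm$, $K_0$ are the operators of (i) plus $K'_\pm$, $K_0'$, and $e_0=\varphi_0\otimes\phi_{k'0}$. In both cases $e_{z,w}=\exp(za^\dagger+wK_+)e_0=\sum_{n\ge0}\frac1{n!}(za^\dagger+wK_+)^ne_0$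 for $z\in\mathbb C$, $w\in\mathbb D$; a representation $\pi_k$ of $\tilde G^J_1$ is a strongly continuous unitary representation on the Hilbert space of the realization whose differential, on finite linear combinations of the canonical basis vectors, is the given one: the derivatives at $s=0$ along $(1,0,s)$, $(1,s\alpha,0)$, $(\omega=s,\gamma=0)$ and $(\omega=0,\gamma=\frac{\zeta}{|\zeta|}\tanh(s|\zeta|))$ are $i$, $\alpha a^\dagger-\bar\alpha a$, $2iK_0$ and $\zeta K_+-\bar\zeta K_-$ (the last curve is constantly the identity if $\zeta=0$). Theorem. (A) The kernel $K_{1/4}$ is positive semidefinite, and in the Hilbert space $\mathcal H_K$ of functions on $\mathbb C\times\mathbb D$ with reproducing kernel $K_{1/4}$ the polynomials $(n!)^{-1/2}P_n$, $n=0,1,2,\dots$, form an orthonormal basis (a complete orthonormal system). This space belongs to realization (i): with the inner product linear in the second argument, $\langle e_{\bar z,\bar w},e_{\bar z',\bar w'}\rangle=K_{1/4}((z,w),(z',w'))$ and $\langle e_{\bar z,\bar w},\varphi_n\rangle=(n!)^{-1/2}P_n(z,w)$. (B) In realization (i) with $k=\frac14$, and in realization (ii) with $k=k'+\frac14$ for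 every real $k'>0$: the series defining $e_{z,w}$ converges, such a representation $\pi_k$ exists, and for every such $\pi_k$, all $h=(\tilde g,\alpha,t)\in\tilde G^J_1$ with $\tilde g=(\omega,\gamma)$, all $z\in\mathbb C$ and $w\in\mathbb D$, one has $w_1\in\mathbb D$ and $$\pi_k(h)\,e_{z,w}=e^{it}\,e^{2ik\omega}(1-|\gamma|^2)^k(1+\bar\gamma w)^{-2k}\exp(-\lambda_1)\,e_{z_1,w_1},$$ where the power of $1+\bar\gamma w$ is the principal one and $$z_0=\alpha-\bar\alpha w,\quad z_1=\frac{\alpha-\bar\alpha w+z}{\bar bw+\bar a},\quad w_1=\frac{aw+b}{\bar bw+\bar a},\quad \lambda_1=\frac{\bar b(z+z_0)^2}{2(\bar a+\bar bw)}+\bar\alpha\Big(z+\frac{z_0}2\Big).$$ In particular, for $t=0$ the factor $e^{it}$ is absent. -/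

import Mathlib

open scoped ComplexConjugate InnerProductSpace

noncomputable section

namespace JacobiGroup

/-! ### The universal cover of `SU(1,1)` -/

/-- The universal covering group of `SU(1,1)` in Bargmann's global coordinates
`(ω, γ) ∈ ℝ × 𝔻`; the pair `(ω, γ)` lies over the matrix `(a, b; conj b, conj a)` with
`a = e^{iω} (1 - |γ|²)^{-1/2}` and `b = e^{iω} γ (1 - |γ|²)^{-1/2}`. -/
@[ext]
structure CoverSU where
  ω : ℝ
  γ : ℂ
  norm_γ_lt : ‖γ‖ < 1

namespace CoverSU

/-- The matrix entry `a` of the element of `SU(1,1)` below `g`. -/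
def a (g : CoverSU) : ℂ :=
  Complex.exp (Complex.I * (g.ω : ℂ)) * ((√(1 - ‖g.γ‖ ^ 2))⁻¹ : ℝ)

/-- The matrix entry `b` of the element of `SU(1,1)` below `g`. -/
def b (g : CoverSU) : ℂ :=
  Complex.exp (Complex.I * (g.ω : ℂ)) * g.γ * ((√(1 - ‖g.γ‖ ^ 2))⁻¹ : ℝ)

/-- The element of `SU(1,1)` below `g`. -/
def toMatrix (g : CoverSU) : Matrix (Fin 2) (Fin 2) ℂ :=
  !![g.a, g.b; conj g.b, conj g.a]

/-- The factor `a(g h) / (a(g) a(h)) = 1 + b(g) conj (b(h)) / (a(g) a(h))`; it lies in the open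
right half plane. -/
def cocycle (g h : CoverSU) : ℂ :=
  1 + g.γ * conj h.γ * Complex.exp (-2 * Complex.I * (h.ω : ℂ))

lemma norm_rot (x : ℝ) : ‖Complex.exp (-2 * Complex.I * (x : ℂ))‖ = 1 := by
  rw [show -2 * Complex.I * (x : ℂ) = ((-2 * x : ℝ) : ℂ) * Complex.I by push_cast; ring]
  exact Complex.norm_exp_ofReal_mul_I _

lemma norm_cocycle_sub (g h : CoverSU) : ‖cocycle g h - 1‖ < 1 := by
  have h1 := g.norm_γ_lt
  have h2 := h.norm_γ_lt
  have : cocycle g h - 1 = g.γ * conj h.γ * Complex.exp (-2 * Complex.I * (h.ω : ℂ)) := by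
    simp [cocycle]
  rw [this, norm_mul, norm_mul, norm_rot, Complex.norm_conj, mul_one]
  nlinarith [norm_nonneg g.γ, norm_nonneg h.γ]

lemma re_cocycle_pos (g h : CoverSU) : 0 < (cocycle g h).re := by
  have h1 := norm_cocycle_sub g h
  have h2 := Complex.abs_re_le_norm (cocycle g h - 1)
  have h3 := (abs_lt.1 (lt_of_le_of_lt h2 h1)).1
  simp at h3
  linarith

lemma cocycle_ne_zero (g h : CoverSU) : cocycle g h ≠ 0 := by
  intro h0
  have := re_cocycle_pos g h
  simp [h0] at this

/-- The coordinate `γ` of a product. -/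
def mulγ (g h : CoverSU) : ℂ :=
  (h.γ + g.γ * Complex.exp (-2 * Complex.I * (h.ω : ℂ))) / cocycle g h

lemma one_sub_norm_sq_pos (g : CoverSU) : 0 < 1 - ‖g.γ‖ ^ 2 := by
  nlinarith [norm_nonneg g.γ, g.norm_γ_lt]

lemma one_sub_norm_mulγ_sq (g h : CoverSU) :
    1 - ‖mulγ g h‖ ^ 2 = (1 - ‖g.γ‖ ^ 2) * (1 - ‖h.γ‖ ^ 2) / ‖cocycle g h‖ ^ 2 := by
  have hc : ‖cocycle g h‖ ^ 2 ≠ 0 := by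
    simpa using cocycle_ne_zero g h
  set u : ℂ := g.γ * Complex.exp (-2 * Complex.I * (h.ω : ℂ)) with hu
  have hnu : ‖g.γ‖ = ‖u‖ := by rw [hu, norm_mul, norm_rot, mul_one]
  have hq : cocycle g h = 1 + u * conj h.γ := by rw [cocycle, hu]; ring
  have hm : mulγ g h = (h.γ + u) / cocycle g h := rfl
  rw [hm, norm_div, div_pow, hnu, eq_div_iff hc, sub_mul, div_mul_cancel₀ _ hc, hq]
  simp only [Complex.sq_norm, Complex.normSq_apply]
  simp
  ring

/-- The group law: matrix multiplication below, with the argument of `a` lifted continuously. -/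
instance : Mul CoverSU where
  mul g h :=
    { ω := g.ω + h.ω + (cocycle g h).arg
      γ := mulγ g h
      norm_γ_lt := by
        have h1 := one_sub_norm_mulγ_sq g h
        have h2 : 0 < 1 - ‖mulγ g h‖ ^ 2 := by
          rw [h1]
          have := norm_pos_iff.2 (cocycle_ne_zero g h)
          have := one_sub_norm_sq_pos g
          have := one_sub_norm_sq_pos h
          positivity
        nlinarith [norm_nonneg (mulγ g h)] }

instance : One CoverSU where
  one := { ω := 0, γ := 0, norm_γ_lt := by simp }

instance : Inv CoverSU where
  inv g :=
    { ω := -g.ω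
      γ := -g.γ * Complex.exp (2 * Complex.I * (g.ω : ℂ))
      norm_γ_lt := by
        have := norm_rot (-g.ω)
        rw [show -2 * Complex.I * ((-g.ω : ℝ) : ℂ) = 2 * Complex.I * (g.ω : ℂ) by
          push_cast; ring] at this
        rw [norm_mul, this, norm_neg, mul_one]
        exact g.norm_γ_lt }

lemma mul_ω (g h : CoverSU) : (g * h).ω = g.ω + h.ω + (cocycle g h).arg := rfl
lemma mul_γ (g h : CoverSU) : (g * h).γ = mulγ g h := rfl
@[simp] lemma one_ω : (1 : CoverSU).ω = 0 := rfl
@[simp] lemma one_γ : (1 : CoverSU).γ = 0 := rfl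
lemma inv_ω (g : CoverSU) : g⁻¹.ω = -g.ω := rfl
lemma inv_γ (g : CoverSU) : g⁻¹.γ = -g.γ * Complex.exp (2 * Complex.I * (g.ω : ℂ)) := rfl

@[simp] lemma one_a : (1 : CoverSU).a = 1 := by simp [a]
@[simp] lemma one_b : (1 : CoverSU).b = 0 := by simp [b]

lemma b_eq (g : CoverSU) : g.b = g.a * g.γ := by simp only [a, b]; ring

lemma sqrt_pos' (g : CoverSU) : 0 < √(1 - ‖g.γ‖ ^ 2) := Real.sqrt_pos.2 g.one_sub_norm_sq_pos

lemma a_ne_zero (g : CoverSU) : g.a ≠ 0 := by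
  simp [a, Complex.exp_ne_zero, (sqrt_pos' g).ne']

lemma conj_a (g : CoverSU) :
    conj g.a = g.a * Complex.exp (-2 * Complex.I * (g.ω : ℂ)) := by
  simp only [a, map_mul, ← Complex.exp_conj, Complex.conj_I, Complex.conj_ofReal]
  rw [mul_right_comm, ← Complex.exp_add]
  congr 2
  ring

lemma mul_a (g h : CoverSU) : (g * h).a = g.a * h.a + g.b * conj h.b := by
  have h1 : g.a * h.a + g.b * conj h.b = g.a * h.a * cocycle g h := by
    rw [b_eq, b_eq, map_mul, conj_a, cocycle]; ring
  rw [h1]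
  have hp := norm_pos_iff.2 (cocycle_ne_zero g h)
  have h2 : (√(1 - ‖mulγ g h‖ ^ 2))⁻¹
      = (√(1 - ‖g.γ‖ ^ 2))⁻¹ * (√(1 - ‖h.γ‖ ^ 2))⁻¹ * ‖cocycle g h‖ := by
    rw [one_sub_norm_mulγ_sq, Real.sqrt_div' _ (by positivity), Real.sqrt_sq hp.le,
      Real.sqrt_mul g.one_sub_norm_sq_pos.le]
    have := sqrt_pos' g
    have := sqrt_pos' h
    field_simp
  have h3 : cocycle g h = ‖cocycle g h‖ * Complex.exp (Complex.I * (cocycle g h).arg) := by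
    rw [mul_comm Complex.I]; exact (Complex.norm_mul_exp_arg_mul_I _).symm
  conv_rhs => rw [h3]
  simp only [a, mul_ω, mul_γ, h2]
  push_cast
  rw [mul_add, mul_add, Complex.exp_add, Complex.exp_add]
  ring

lemma mul_b (g h : CoverSU) : (g * h).b = g.a * h.b + g.b * conj h.a := by
  have h1 : (g * h).a = g.a * h.a * cocycle g h := by
    rw [mul_a, b_eq, b_eq, map_mul, conj_a, cocycle]; ring
  rw [b_eq (g * h), h1, mul_γ, mulγ, conj_a, b_eq, b_eq]
  have := cocycle_ne_zero g h
  field_simp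

lemma γ_eq (g : CoverSU) : g.γ = g.b / g.a := by
  rw [b_eq, mul_div_cancel_left₀ _ g.a_ne_zero]

lemma exp_ω (g : CoverSU) : Complex.exp (Complex.I * (g.ω : ℂ)) = g.a * √(1 - ‖g.γ‖ ^ 2) := by
  have h0 : ((√(1 - ‖g.γ‖ ^ 2) : ℝ) : ℂ) ≠ 0 := by exact_mod_cast (sqrt_pos' g).ne'
  rw [a]
  push_cast
  field_simp

lemma ext_of {g h : CoverSU} (ha : g.a = h.a) (hb : g.b = h.b)
    (hω : |g.ω - h.ω| < 2 * Real.pi) : g = h := by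
  have hγ : g.γ = h.γ := by rw [γ_eq, γ_eq, ha, hb]
  have he : Complex.exp (Complex.I * (g.ω : ℂ)) = Complex.exp (Complex.I * (h.ω : ℂ)) := by
    rw [exp_ω, exp_ω, ha, hγ]
  obtain ⟨n, hn⟩ := Complex.exp_eq_exp_iff_exists_int.1 he
  have hn' : g.ω - h.ω = n * (2 * Real.pi) := by
    have : Complex.I * ((g.ω : ℂ) - h.ω) = Complex.I * (n * (2 * Real.pi)) := by
      rw [mul_sub, hn]; ring
    have := mul_left_cancel₀ Complex.I_ne_zero this
    exact_mod_cast this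
  have hn0 : n = 0 := by
    rw [hn', abs_mul, abs_of_pos Real.two_pi_pos] at hω
    have h1 : |(n : ℝ)| < 1 := by
      by_contra hcon
      push Not at hcon
      nlinarith [Real.two_pi_pos]
    have h2 : |n| < 1 := by exact_mod_cast h1
    exact Int.abs_lt_one_iff.1 h2
  rw [hn0] at hn'
  simp only [Int.cast_zero, zero_mul] at hn'
  exact CoverSU.ext (by linarith) hγ

lemma abs_arg_cocycle (g h : CoverSU) : |(cocycle g h).arg| < Real.pi / 2 :=
  Complex.abs_arg_lt_pi_div_two_iff.2 (Or.inl (re_cocycle_pos g h))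

lemma mul_assoc' (g h k : CoverSU) : g * h * k = g * (h * k) := by
  apply ext_of
  · simp only [mul_a, mul_b, map_add, map_mul, Complex.conj_conj]; ring
  · simp only [mul_a, mul_b, map_add, map_mul, Complex.conj_conj]; ring
  · simp only [mul_ω]
    have h1 := abs_lt.1 (abs_arg_cocycle g h)
    have h2 := abs_lt.1 (abs_arg_cocycle (g * h) k)
    have h3 := abs_lt.1 (abs_arg_cocycle h k)
    have h4 := abs_lt.1 (abs_arg_cocycle g (h * k))
    rw [abs_lt]
    constructor <;> linarith [h1.1, h1.2, h2.1, h2.2, h3.1, h3.2, h4.1, h4.2]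

lemma one_mul' (g : CoverSU) : 1 * g = g := by
  apply CoverSU.ext
  · simp [mul_ω, cocycle]
  · simp [mul_γ, mulγ, cocycle]

lemma inv_mul_cancel' (g : CoverSU) : g⁻¹ * g = 1 := by
  have he : Complex.exp (2 * Complex.I * (g.ω : ℂ)) * Complex.exp (-2 * Complex.I * (g.ω : ℂ))
      = 1 := by
    rw [← Complex.exp_add, ← Complex.exp_zero]; congr 1; ring
  have hc : cocycle g⁻¹ g = ((1 - ‖g.γ‖ ^ 2 : ℝ) : ℂ) := by
    have h1 : g.γ * conj g.γ = ((‖g.γ‖ ^ 2 : ℝ) : ℂ) := by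
      rw [Complex.mul_conj, Complex.normSq_eq_norm_sq]
    rw [cocycle, inv_γ]
    push_cast at h1 ⊢
    linear_combination (-(g.γ * conj g.γ)) * he - h1
  apply CoverSU.ext
  · rw [mul_ω, hc, Complex.arg_ofReal_of_nonneg g.one_sub_norm_sq_pos.le, inv_ω]
    simp
  · rw [mul_γ, mulγ, inv_γ]
    have : g.γ + -g.γ * Complex.exp (2 * Complex.I * (g.ω : ℂ)) *
        Complex.exp (-2 * Complex.I * (g.ω : ℂ)) = 0 := by
      linear_combination (-g.γ) * he
    rw [this]
    simp

instance : Group CoverSU := Group.ofLeftAxioms mul_assoc' one_mul' inv_mul_cancel'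

/-- The topology of `ℝ × 𝔻`. -/
instance : TopologicalSpace CoverSU :=
  TopologicalSpace.induced (fun g => (g.ω, g.γ)) inferInstance

/-- The covering map is a homomorphism. -/
lemma toMatrix_mul (g h : CoverSU) : (g * h).toMatrix = g.toMatrix * h.toMatrix := by
  ext i j
  fin_cases i <;> fin_cases j <;>
    simp [toMatrix, Matrix.mul_apply, Fin.sum_univ_two, mul_a, mul_b] <;> ring

lemma normSq_a_sub (g : CoverSU) : g.a * conj g.a - g.b * conj g.b = 1 := by
  have h0 := sqrt_pos' g
  have h1 : conj (Complex.exp (Complex.I * (g.ω : ℂ))) * Complex.exp (Complex.I * (g.ω : ℂ))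
      = 1 := by
    rw [← Complex.exp_conj, ← Complex.exp_add, ← Complex.exp_zero]; congr 1; simp
  have h2 : g.γ * conj g.γ = ((‖g.γ‖ ^ 2 : ℝ) : ℂ) := by
    rw [Complex.mul_conj, Complex.normSq_eq_norm_sq]
  have h3 : ((√(1 - ‖g.γ‖ ^ 2))⁻¹ : ℝ) * ((√(1 - ‖g.γ‖ ^ 2))⁻¹ : ℝ) * (1 - ‖g.γ‖ ^ 2) = 1 := by
    rw [← mul_inv, Real.mul_self_sqrt g.one_sub_norm_sq_pos.le,
      inv_mul_cancel₀ g.one_sub_norm_sq_pos.ne']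
  have h3' : (((√(1 - ‖g.γ‖ ^ 2))⁻¹ : ℝ) : ℂ) * (((√(1 - ‖g.γ‖ ^ 2))⁻¹ : ℝ) : ℂ)
      * (1 - ((‖g.γ‖ ^ 2 : ℝ) : ℂ)) = 1 := by exact_mod_cast h3
  simp only [a, b, map_mul, Complex.conj_ofReal]
  rw [← h2] at h3'
  linear_combination h3' + (((√(1 - ‖g.γ‖ ^ 2))⁻¹ : ℝ) : ℂ) * (((√(1 - ‖g.γ‖ ^ 2))⁻¹ : ℝ) : ℂ)
      * (1 - g.γ * conj g.γ) * h1

lemma toMatrix_det (g : CoverSU) : g.toMatrix.det = 1 := by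
  rw [toMatrix, Matrix.det_fin_two_of]; exact g.normSq_a_sub

/-- The action `g⁻¹ · α = conj a * α - b * conj α` on the plane of the Heisenberg-Weyl group. -/
def actInv (g : CoverSU) (α : ℂ) : ℂ := conj g.a * α - g.b * conj α

lemma actInv_add (g : CoverSU) (α β : ℂ) : g.actInv (α + β) = g.actInv α + g.actInv β := by
  simp only [actInv, map_add]; ring

lemma actInv_neg (g : CoverSU) (α : ℂ) : g.actInv (-α) = -g.actInv α := by
  simp only [actInv, map_neg]; ring

lemma actInv_mul (g h : CoverSU) (α : ℂ) : (g * h).actInv α = h.actInv (g.actInv α) := by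
  simp only [actInv, mul_a, mul_b, map_add, map_sub, map_mul, Complex.conj_conj]; ring

@[simp] lemma actInv_one (α : ℂ) : (1 : CoverSU).actInv α = α := by simp [actInv]

lemma im_actInv (g : CoverSU) (α β : ℂ) :
    (g.actInv α * conj (g.actInv β)).im = (α * conj β).im := by
  have h := congrArg Complex.re g.normSq_a_sub
  simp at h
  simp [actInv]
  linear_combination (α.im * β.re - α.re * β.im) * h

/-- Hyperbolic one-parameter subgroups: the element over
`exp (0, ζ; conj ζ, 0)`, with `ω = 0` and `γ = (ζ / |ζ|) tanh |ζ|`. -/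
def boost (ζ : ℂ) : CoverSU where
  ω := 0
  γ := ζ / (‖ζ‖ : ℂ) * (Real.tanh ‖ζ‖ : ℂ)
  norm_γ_lt := by
    rw [norm_mul, norm_div, Complex.norm_real, Complex.norm_real, norm_norm]
    have h1 : ‖ζ‖ / ‖ζ‖ ≤ 1 := div_self_le_one _
    have h2 : ‖Real.tanh ‖ζ‖‖ < 1 := Real.abs_tanh_lt_one _
    calc _ ≤ 1 * ‖Real.tanh ‖ζ‖‖ := by gcongr
      _ < 1 := by simpa using h2

/-- The elliptic one-parameter subgroup: the element over `diag (e^{is}, e^{-is})`. -/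
def rotation (s : ℝ) : CoverSU where
  ω := s
  γ := 0
  norm_γ_lt := by simp

end CoverSU

/-! ### The covering Jacobi group -/

/-- The covering Jacobi group, the semidirect product of the Heisenberg-Weyl group by the
universal cover of `SU(1,1)`, with the composition law
`(g₁, α₁, t₁) (g₂, α₂, t₂) = (g₁ g₂, g₂⁻¹·α₁ + α₂, t₁ + t₂ + Im (g₂⁻¹·α₁ * conj α₂))`. -/
@[ext]
structure CoverJacobi where
  g : CoverSU
  α : ℂ
  t : ℝ

namespace CoverJacobi

instance : Mul CoverJacobi where
  mul x y := ⟨x.g * y.g, y.g.actInv x.α + y.α, x.t + y.t + (y.g.actInv x.α * conj y.α).im⟩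

instance : One CoverJacobi where
  one := ⟨1, 0, 0⟩

instance : Inv CoverJacobi where
  inv x := ⟨x.g⁻¹, -(x.g⁻¹.actInv x.α), -x.t⟩

lemma mul_def (x y : CoverJacobi) :
    x * y = ⟨x.g * y.g, y.g.actInv x.α + y.α, x.t + y.t + (y.g.actInv x.α * conj y.α).im⟩ := rfl
lemma one_def : (1 : CoverJacobi) = ⟨1, 0, 0⟩ := rfl
lemma inv_def (x : CoverJacobi) : x⁻¹ = ⟨x.g⁻¹, -(x.g⁻¹.actInv x.α), -x.t⟩ := rfl

instance : Group CoverJacobi :=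
  Group.ofLeftAxioms
    (by
      intro x y z
      simp only [mul_def]
      refine CoverJacobi.ext (mul_assoc _ _ _) ?_ ?_
      · simp only [CoverSU.actInv_mul, CoverSU.actInv_add]; ring
      · have h := CoverSU.im_actInv z.g (y.g.actInv x.α) y.α
        simp only [CoverSU.actInv_mul, CoverSU.actInv_add, map_add, mul_add, add_mul,
          Complex.add_im]
        linarith)
    (by
      intro x
      simp only [mul_def, one_def]
      refine CoverJacobi.ext (one_mul _) ?_ ?_ <;> simp [CoverSU.actInv])
    (by
      intro x
      have h : x.g.actInv (-(x.g⁻¹.actInv x.α)) = -x.α := by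
        rw [CoverSU.actInv_neg, ← CoverSU.actInv_mul]; simp
      simp only [mul_def, one_def, inv_def, h]
      refine CoverJacobi.ext (inv_mul_cancel _) (by simp) ?_
      simp [mul_comm])

/-- The topology of `ℝ × 𝔻 × ℂ × ℝ`. -/
instance : TopologicalSpace CoverJacobi :=
  TopologicalSpace.induced (fun x => (x.g, x.α, x.t)) inferInstance

end CoverJacobi

/-! ### The Jacobi algebra acting on finite vectors -/

/-- The Hilbert space with a canonical orthonormal basis indexed by `ι`. -/
abbrev Hilb (ι : Type) := lp (fun _ : ι => ℂ) 2

/-- Finite linear combinations of the canonical orthonormal basis vectors. -/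
def incl (ι : Type) [DecidableEq ι] : (ι →₀ ℂ) →ₗ[ℂ] Hilb ι :=
  Finsupp.linearCombination ℂ (fun i => (lp.single 2 i (1 : ℂ) : Hilb ι))

/-- The operators of a representation of the Jacobi algebra, on the space of finite linear
combinations of an orthonormal basis indexed by `ι`, and the vector `e₀`.
Only the two concrete instances `fock` and `fockDiscrete` below are used. -/
structure JacobiOps (ι : Type) where
  /-- annihilation operator -/
  a : Module.End ℂ (ι →₀ ℂ)
  /-- creation operator -/
  adag : Module.End ℂ (ι →₀ ℂ)
  K0 : Module.End ℂ (ι →₀ ℂ)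
  Kp : Module.End ℂ (ι →₀ ℂ)
  Km : Module.End ℂ (ι →₀ ℂ)
  e0 : ι →₀ ℂ

/-- The linear map with prescribed values on the canonical basis. -/
def onBasis {ι : Type} (f : ι → (ι →₀ ℂ)) : Module.End ℂ (ι →₀ ℂ) :=
  Finsupp.linearCombination ℂ f

/-- `a φₙ = √n φₙ₋₁`. -/
def annihilation : Module.End ℂ (ℕ →₀ ℂ) :=
  onBasis fun n => Finsupp.single (n - 1) ((√(n : ℝ) : ℝ) : ℂ)

/-- `a† φₙ = √(n+1) φₙ₊₁`. -/
def creation : Module.End ℂ (ℕ →₀ ℂ) :=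
  onBasis fun n => Finsupp.single (n + 1) ((√(n + 1 : ℝ) : ℝ) : ℂ)

/-- The realization on the Fock space (with basis `φₙ`) in which `K₊ = ½ (a†)²`,
`K₋ = ½ a²`, `K₀ = ½ (a† a + ½)` and `e₀ = φ₀`. -/
def fock : JacobiOps ℕ where
  a := annihilation
  adag := creation
  K0 := (1 / 2 : ℂ) • (creation * annihilation + (1 / 2 : ℂ) • 1)
  Kp := (1 / 2 : ℂ) • creation ^ 2
  Km := (1 / 2 : ℂ) • annihilation ^ 2
  e0 := Finsupp.single 0 1

/-- `K'₀ φ_{k'm} = (k' + m) φ_{k'm}` in the positive discrete series. -/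
def discreteK0 (k' : ℝ) : Module.End ℂ (ℕ →₀ ℂ) :=
  onBasis fun m => Finsupp.single m ((k' + m : ℝ) : ℂ)

/-- `K'₊ φ_{k'm} = √((m+1)(m+2k')) φ_{k',m+1}` in the positive discrete series. -/
def discreteKp (k' : ℝ) : Module.End ℂ (ℕ →₀ ℂ) :=
  onBasis fun m => Finsupp.single (m + 1) ((√((m + 1 : ℝ) * (m + 2 * k')) : ℝ) : ℂ)

/-- `K'₋ φ_{k'm} = √(m(m+2k'-1)) φ_{k',m-1}` in the positive discrete series. -/
def discreteKm (k' : ℝ) : Module.End ℂ (ℕ →₀ ℂ) :=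
  onBasis fun m => Finsupp.single (m - 1) ((√((m : ℝ) * (m + 2 * k' - 1)) : ℝ) : ℂ)

/-- `A ⊗ B` on the space with basis `φₙ ⊗ φ_{k'm}`. -/
def tens (A B : Module.End ℂ (ℕ →₀ ℂ)) : Module.End ℂ (ℕ × ℕ →₀ ℂ) :=
  (finsuppTensorFinsupp' ℂ ℕ ℕ).conj (TensorProduct.map A B)

/-- The realization on the tensor product of the Fock space with the positive discrete series
of index `k'`: `K₊ = ½ (a†)² + K'₊`, `K₋ = ½ a² + K'₋`, `K₀ = ½ (a† a + ½) + K'₀`, and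
`e₀ = φ₀ ⊗ φ_{k'0}`. -/
def fockDiscrete (k' : ℝ) : JacobiOps (ℕ × ℕ) where
  a := tens annihilation 1
  adag := tens creation 1
  K0 := tens fock.K0 1 + tens 1 (discreteK0 k')
  Kp := tens fock.Kp 1 + tens 1 (discreteKp k')
  Km := tens fock.Km 1 + tens 1 (discreteKm k')
  e0 := Finsupp.single (0, 0) 1

/-! ### Representations of the group and coherent states -/

variable {ι : Type} [DecidableEq ι]

/-- `π` is a strongly continuous unitary representation of the covering Jacobi group whose
differential is the given representation of the Jacobi algebra: on finite vectors, the derivatives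
along the one-parameter subgroups of the centre, of the displacements `exp (s (α a† - conj α a))`,
of the elliptic elements `exp (2 i s K₀)` and of the squeezes `exp (s (ζ K₊ - conj ζ K₋))` are the
corresponding operators. -/
structure IsRepWithDifferential (M : JacobiOps ι)
    (π : CoverJacobi →* unitary (Hilb ι →L[ℂ] Hilb ι)) : Prop where
  continuous : ∀ v : Hilb ι, Continuous fun h => (π h : Hilb ι →L[ℂ] Hilb ι) v
  center : ∀ v : ι →₀ ℂ,
    HasDerivAt (fun s : ℝ => (π ⟨1, 0, s⟩ : Hilb ι →L[ℂ] Hilb ι) (incl ι v))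
      (incl ι (Complex.I • v)) 0
  displacement : ∀ (α : ℂ) (v : ι →₀ ℂ),
    HasDerivAt (fun s : ℝ => (π ⟨1, s * α, 0⟩ : Hilb ι →L[ℂ] Hilb ι) (incl ι v))
      (incl ι (α • M.adag v - conj α • M.a v)) 0
  elliptic : ∀ v : ι →₀ ℂ,
    HasDerivAt (fun s : ℝ => (π ⟨CoverSU.rotation s, 0, 0⟩ : Hilb ι →L[ℂ] Hilb ι) (incl ι v))
      (incl ι ((2 * Complex.I) • M.K0 v)) 0
  squeeze : ∀ (ζ : ℂ) (v : ι →₀ ℂ),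
    HasDerivAt (fun s : ℝ => (π ⟨CoverSU.boost (s * ζ), 0, 0⟩ : Hilb ι →L[ℂ] Hilb ι) (incl ι v))
      (incl ι (ζ • M.Kp v - conj ζ • M.Km v)) 0

/-- The `n`-th term of the exponential series of `exp (z a† + w K₊) e₀`. -/
def coherentTerm (M : JacobiOps ι) (z w : ℂ) (n : ℕ) : Hilb ι :=
  (n.factorial : ℂ)⁻¹ • incl ι (((z • M.adag + w • M.Kp) ^ n) M.e0)

/-- The coherent state `e_{z,w} = exp (z a† + w K₊) e₀`. -/
def coherent (M : JacobiOps ι) (z w : ℂ) : Hilb ι := ∑' n, coherentTerm M z w n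

/-- `z₁ = (α - conj α w + z) / (conj b w + conj a)`. -/
def z₁ (h : CoverJacobi) (z w : ℂ) : ℂ :=
  (h.α - conj h.α * w + z) / (conj h.g.b * w + conj h.g.a)

/-- `w₁ = (a w + b) / (conj b w + conj a)`. -/
def w₁ (h : CoverJacobi) (w : ℂ) : ℂ :=
  (h.g.a * w + h.g.b) / (conj h.g.b * w + conj h.g.a)

/-- `λ₁ = conj b (z + z₀)² / (2 (conj a + conj b w)) + conj α (z + z₀ / 2)`, where
`z₀ = α - conj α w`. -/
def lambda₁ (h : CoverJacobi) (z w : ℂ) : ℂ :=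
  conj h.g.b * (z + (h.α - conj h.α * w)) ^ 2 / (2 * (conj h.g.a + conj h.g.b * w))
    + conj h.α * (z + (h.α - conj h.α * w) / 2)

/-- `e^{2ikω} (1 - |γ|²)^k (1 + conj γ w)^{-2k} exp (-λ₁)`, with the principal branch. -/
def multiplier (k : ℝ) (h : CoverJacobi) (z w : ℂ) : ℂ :=
  Complex.exp (2 * Complex.I * k * h.g.ω) * (((1 - ‖h.g.γ‖ ^ 2) ^ k : ℝ) : ℂ)
    * (1 + conj h.g.γ * w) ^ (-2 * k : ℂ) * Complex.exp (-lambda₁ h z w)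

/-! ### The reproducing kernel and the polynomials -/

/-- The space `ℂ × 𝔻`. -/
abbrev Domain := ℂ × Complex.UnitDisc

/-- The reproducing kernel of index `k`, holomorphic in `x = (z, w)` and antiholomorphic in
`y = (z', w')`:
`(1 - w conj w')^{-2k} exp ((2 z conj z' + z² conj w' + (conj z')² w) / (2 (1 - w conj w')))`. -/
def bergmanKernel (k : ℝ) (x y : Domain) : ℂ :=
  (1 - (x.2 : ℂ) * conj (y.2 : ℂ)) ^ (-2 * k : ℂ) *
    Complex.exp ((2 * x.1 * conj y.1 + x.1 ^ 2 * conj (y.2 : ℂ) + (conj y.1) ^ 2 * (x.2 : ℂ))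
      / (2 * (1 - (x.2 : ℂ) * conj (y.2 : ℂ))))

/-- The kernel as a matrix of operators on `ℂ` (multiplication by its values). -/
def kernelMatrix (k : ℝ) : Matrix Domain Domain (ℂ →L[ℂ] ℂ) :=
  Matrix.of fun x y => bergmanKernel k x y • ContinuousLinearMap.id ℂ ℂ

/-- `Pₙ(z, w) = n! ∑_{p ≤ n/2} (w/2)^p z^{n-2p} / (p! (n-2p)!)`. -/
def P (n : ℕ) (z w : ℂ) : ℂ :=
  (n.factorial : ℂ) * ∑ p ∈ Finset.range (n / 2 + 1),
    (w / 2) ^ p * z ^ (n - 2 * p) / ((p.factorial : ℂ) * ((n - 2 * p).factorial : ℂ))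

end JacobiGroup

end

/-! The argument never exponentiates the Jacobi algebra. Everything is read off the coherent states:
they form a total family whose Gram matrix is an explicit kernel, and a total family determines
isometries through its Gram matrix.

Existence. The map sending `e_{z,w}` to `exp (exponent k h z w) • e_{z₁,w₁}` preserves the Gram
matrix (`gram_transform`) and is multiplicative in `h` (`exponent_mul`, `z₁_mul`, `w₁_mul`), so
`IsTotal.exists_rep` extends it to a unitary representation. Logarithms, not powers, are compared
throughout: on the universal cover the factor with exponent `2k` becomes an additive cocycle
(`CoverSU.logDen_mul`), for every real `k`. Strong continuity follows from continuity of the kernel.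
The differential on finite vectors is first found weakly, against coherent states, because the
operators act on these by first order differential operators in `z` and `w`; integration then makes
it strong (`IsCoherent.hasDerivAt_rep`).

Uniqueness. The coordinates of a coherent state decay geometrically while the operators grow
polynomially on the basis, so any representation with the given differential can be differentiated
termwise on a coherent state. Hence `π (h (-r)) (π' (h r) e)` is constant along each one-parameter
subgroup (`IsCoherent.rep_eq_along`). Centre, displacements, rotations and boosts generate the group
(`CoverJacobi.eq_prod`), so every such representation is the one constructed and obeys its formula.

What remains is to verify `IsCoherent` in the two realizations. On the Fock space the coordinates of
`e_{z,w}` are `(n!)^{-1/2} Pₙ`, which obey a three-term recurrence; it gives the operator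
identities, the geometric bound, and Mehler's formula, that is the Gram matrix, by solving a linear
differential equation. On the tensor product the coordinates are products with those of the discrete
series, whose Gram matrix is a binomial series, and the weights add to `k' + 1/4`.

For the reproducing kernel space, pairing with the coherent states at conjugated points turns the
Fock space into a function space with kernel `K_{1/4}`. Any other Hilbert space with this kernel has
kernel functions with the same Gram matrix, so it is unitarily equivalent and the basis `φₙ` is
transported to it (`exists_hilbertBasis_of_kernel`). -/

open scoped ComplexConjugate InnerProductSpace

noncomputable section

namespace JacobiGroup

/-! ### Total families and the isometries determined by Gram matrices. -/

section Gram

variable {X H₁ H₂ : Type*} [NormedAddCommGroup H₁] [InnerProductSpace ℂ H₁]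
  [NormedAddCommGroup H₂] [InnerProductSpace ℂ H₂]

/-- A family of vectors is total if only the zero vector is orthogonal to all its members. -/
def IsTotal (u : X → H₁) : Prop := ∀ v : H₁, (∀ x, ⟪u x, v⟫_ℂ = 0) → v = 0

lemma IsTotal.ext {u : X → H₁} (hu : IsTotal u) {v v' : H₁}
    (h : ∀ x, ⟪u x, v⟫_ℂ = ⟪u x, v'⟫_ℂ) : v = v' := by
  rw [← sub_eq_zero]
  exact hu _ fun x => by rw [inner_sub_right, h x, sub_self]

lemma IsTotal.topologicalClosure_span [CompleteSpace H₁] {u : X → H₁} (hu : IsTotal u) :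
    (Submodule.span ℂ (Set.range u)).topologicalClosure = ⊤ := by
  rw [Submodule.topologicalClosure_eq_top_iff, Submodule.eq_bot_iff]
  intro v hv
  refine hu v fun x => ?_
  exact (Submodule.mem_orthogonal _ _).1 hv _ (Submodule.subset_span ⟨x, rfl⟩)

lemma IsTotal.denseRange [CompleteSpace H₁] {u : X → H₁} (hu : IsTotal u) :
    DenseRange (Finsupp.linearCombination ℂ u) := by
  have h := hu.topologicalClosure_span
  rw [← Finsupp.range_linearCombination] at h
  rw [DenseRange, dense_iff_closure_eq, ← LinearMap.coe_range,
    ← Submodule.topologicalClosure_coe, h]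
  rfl

lemma IsTotal.clm_ext [CompleteSpace H₁] {u : X → H₁} (hu : IsTotal u) {S T : H₁ →L[ℂ] H₂}
    (h : ∀ x, S (u x) = T (u x)) : S = T := by
  refine ContinuousLinearMap.ext_on
    (Submodule.dense_iff_topologicalClosure_eq_top.2 hu.topologicalClosure_span) ?_
  rintro _ ⟨x, rfl⟩
  exact h x

lemma inner_linearCombination_eq {u : X → H₁} {v : X → H₂}
    (h : ∀ x y, ⟪u x, u y⟫_ℂ = ⟪v x, v y⟫_ℂ) (f : X →₀ ℂ) :
    ⟪Finsupp.linearCombination ℂ u f, Finsupp.linearCombination ℂ u f⟫_ℂ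
      = ⟪Finsupp.linearCombination ℂ v f, Finsupp.linearCombination ℂ v f⟫_ℂ := by
  simp only [Finsupp.linearCombination_apply, Finsupp.sum, sum_inner, inner_sum,
    inner_smul_left, inner_smul_right, h]

lemma norm_linearCombination_eq {u : X → H₁} {v : X → H₂}
    (h : ∀ x y, ⟪u x, u y⟫_ℂ = ⟪v x, v y⟫_ℂ) (f : X →₀ ℂ) :
    ‖Finsupp.linearCombination ℂ u f‖ = ‖Finsupp.linearCombination ℂ v f‖ := by
  rw [@norm_eq_sqrt_re_inner ℂ, inner_linearCombination_eq h, ← @norm_eq_sqrt_re_inner ℂ]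

/-- A total family is mapped isometrically to any family with the same Gram matrix. -/
lemma IsTotal.exists_isometry [CompleteSpace H₁] [CompleteSpace H₂] {u : X → H₁}
    (hu : IsTotal u) {v : X → H₂} (h : ∀ x y, ⟪u x, u y⟫_ℂ = ⟪v x, v y⟫_ℂ) :
    ∃ T : H₁ →ₗᵢ[ℂ] H₂, ∀ x, T (u x) = v x := by
  set f := Finsupp.linearCombination ℂ v
  set e := Finsupp.linearCombination ℂ u
  -- This bound makes `e x ↦ f x` well defined and continuous on the dense range of `e`, so that it
  -- extends.
  have hn : ∀ x, ‖f x‖ ≤ 1 * ‖e x‖ := fun x => by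
    rw [one_mul]; exact (norm_linearCombination_eq h x).ge
  have hT : ∀ x, f.extendOfNorm e (e x) = f x :=
    LinearMap.extendOfNorm_eq hu.denseRange ⟨1, hn⟩
  refine ⟨⟨(f.extendOfNorm e).toLinearMap, ?_⟩, fun x => ?_⟩
  · intro y
    refine hu.denseRange.induction_on (p := fun y => ‖f.extendOfNorm e y‖ = ‖y‖) y
      (isClosed_eq (by fun_prop) (by fun_prop)) fun x => ?_
    rw [hT]
    exact (norm_linearCombination_eq h x).symm
  · have := hT (Finsupp.single x 1)
    simpa [e, f] using this

/-- Isometries exist in both directions; their composition fixes the total family `v`, hence is the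
identity, which gives surjectivity. -/
lemma IsTotal.exists_isometryEquiv [CompleteSpace H₁] [CompleteSpace H₂] {u : X → H₁}
    (hu : IsTotal u) {v : X → H₂} (hv : IsTotal v) (h : ∀ x y, ⟪u x, u y⟫_ℂ = ⟪v x, v y⟫_ℂ) :
    ∃ T : H₁ ≃ₗᵢ[ℂ] H₂, ∀ x, T (u x) = v x := by
  obtain ⟨T, hT⟩ := hu.exists_isometry h
  obtain ⟨S, hS⟩ := hv.exists_isometry fun x y => (h x y).symm
  have h1 : T.toContinuousLinearMap.comp S.toContinuousLinearMap = .id ℂ H₂ :=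
    hv.clm_ext fun x => by simp [hS, hT]
  have hs : Function.Surjective T := fun y =>
    ⟨S y, congrArg (fun A : H₂ →L[ℂ] H₂ => A y) h1⟩
  exact ⟨LinearIsometryEquiv.ofSurjective T hs, hT⟩

/-- A unitary multiplier representation on a total family. -/
lemma IsTotal.exists_rep {G : Type*} [Group G] [CompleteSpace H₁] {u : X → H₁} (hu : IsTotal u)
    (act : G → X → X) (j : G → X → ℂ)
    (hg : ∀ g x y, ⟪j g x • u (act g x), j g y • u (act g y)⟫_ℂ = ⟪u x, u y⟫_ℂ)
    (h1 : ∀ x, j 1 x • u (act 1 x) = u x)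
    (hm : ∀ g h x, j (g * h) x • u (act (g * h) x)
      = (j h x * j g (act h x)) • u (act g (act h x))) :
    ∃ π : G →* unitary (H₁ →L[ℂ] H₁),
      ∀ g x, (π g : H₁ →L[ℂ] H₁) (u x) = j g x • u (act g x) := by
  choose T hT using fun g => hu.exists_isometry (v := fun x => j g x • u (act g x))
    fun x y => (hg g x y).symm
  have hTm : ∀ g h y, T (g * h) y = T g (T h y) := by
    intro g h y
    have : (T (g * h)).toContinuousLinearMap
        = (T g).toContinuousLinearMap.comp (T h).toContinuousLinearMap :=
      hu.clm_ext fun x => by simp [hT, hm, smul_smul]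
    exact congrArg (fun A : H₁ →L[ℂ] H₁ => A y) this
  have hT1 : ∀ y, T 1 y = y := by
    intro y
    have : (T 1).toContinuousLinearMap = .id ℂ H₁ := hu.clm_ext fun x => by simp [hT, h1]
    exact congrArg (fun A : H₁ →L[ℂ] H₁ => A y) this
  let S : G → (H₁ ≃ₗᵢ[ℂ] H₁) := fun g =>
    LinearIsometryEquiv.ofSurjective (T g) fun y => ⟨T g⁻¹ y, by rw [← hTm, mul_inv_cancel, hT1]⟩
  let S' : G →* (H₁ ≃ₗᵢ[ℂ] H₁) :=
    { toFun := S
      map_one' := by ext y; exact hT1 y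
      map_mul' := fun g h => by ext y; exact hTm g h y }
  refine ⟨(Unitary.linearIsometryEquiv (𝕜 := ℂ) (H := H₁)).symm.toMonoidHom.comp S', fun g x => ?_⟩
  exact hT g x

end Gram

/-! ### Choosing branches of the logarithm. -/

/-- This lifts multiplicative identities to identities of logarithms: two logarithms of one number
differ by a multiple of `2πi`, so a crude bound on the imaginary parts settles the branch. -/
lemma eq_of_exp_eq_of_abs_im_sub_lt {x y : ℂ} (h : Complex.exp x = Complex.exp y)
    (hi : |x.im - y.im| < 2 * Real.pi) : x = y := by
  obtain ⟨n, hn⟩ := Complex.exp_eq_exp_iff_exists_int.1 h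
  have h1 : x.im - y.im = n * (2 * Real.pi) := by
    rw [hn]
    simp
  rw [h1, abs_mul, abs_of_pos Real.two_pi_pos] at hi
  have h2 : |(n : ℝ)| < 1 := by
    by_contra hcon
    push Not at hcon
    nlinarith [Real.two_pi_pos]
  have h3 : n = 0 := Int.abs_lt_one_iff.1 (by exact_mod_cast h2)
  rw [hn, h3]
  simp

lemma re_one_add_pos {u : ℂ} (hu : ‖u‖ < 1) : 0 < (1 + u).re := by
  have h2 := (abs_lt.1 ((Complex.abs_re_le_norm u).trans_lt hu)).1
  simp only [Complex.add_re, Complex.one_re]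
  linarith

lemma one_add_ne_zero_of_norm_lt {u : ℂ} (hu : ‖u‖ < 1) : 1 + u ≠ 0 := by
  intro h0
  have := re_one_add_pos hu
  simp [h0] at this

lemma one_add_mem_slitPlane {u : ℂ} (hu : ‖u‖ < 1) : 1 + u ∈ Complex.slitPlane :=
  Or.inl (re_one_add_pos hu)

/-- The bound `π / 2` is what is needed later: four such terms together stay below `2π`. -/
lemma abs_im_log_one_add {u : ℂ} (hu : ‖u‖ < 1) :
    |(Complex.log (1 + u)).im| < Real.pi / 2 := by
  rw [Complex.log_im]
  exact Complex.abs_arg_lt_pi_div_two_iff.2 (Or.inl (re_one_add_pos hu))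

lemma norm_conj_mul_lt {u v : ℂ} (hu : ‖u‖ < 1) (hv : ‖v‖ < 1) : ‖conj u * v‖ < 1 := by
  rw [norm_mul, Complex.norm_conj]
  nlinarith [norm_nonneg u, norm_nonneg v]

lemma norm_neg_conj_mul_lt {u v : ℂ} (hu : ‖u‖ < 1) (hv : ‖v‖ < 1) : ‖-(conj u * v)‖ < 1 := by
  rw [norm_neg]; exact norm_conj_mul_lt hu hv

lemma one_sub_conj_mul_ne_zero {u v : ℂ} (hu : ‖u‖ < 1) (hv : ‖v‖ < 1) :
    1 - conj u * v ≠ 0 := by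
  rw [sub_eq_add_neg]; exact one_add_ne_zero_of_norm_lt (norm_neg_conj_mul_lt hu hv)

/-! ### The action on the disc and its logarithmic cocycle. -/

namespace CoverSU

/-- The denominator of the fractional linear action. -/
def den (g : CoverSU) (w : ℂ) : ℂ := conj g.b * w + conj g.a

/-- The fractional linear action on the unit disc. -/
def mob (g : CoverSU) (w : ℂ) : ℂ := (g.a * w + g.b) / g.den w

lemma den_eq (g : CoverSU) (w : ℂ) : g.den w = conj g.a * (1 + conj g.γ * w) := by
  rw [den, b_eq, map_mul]; ring

lemma den_ne_zero (g : CoverSU) {w : ℂ} (hw : ‖w‖ < 1) : g.den w ≠ 0 := by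
  rw [den_eq]
  exact mul_ne_zero ((map_ne_zero _).2 g.a_ne_zero)
    (one_add_ne_zero_of_norm_lt (norm_conj_mul_lt g.norm_γ_lt hw))

/-- The matrix preserves the hermitian form of signature `(1,1)`, by `|a|² - |b|² = 1`. The diagonal
case shows that the disc is preserved. -/
lemma one_sub_conj_mob_mul_mob (g : CoverSU) {u v : ℂ} (hu : ‖u‖ < 1) (hv : ‖v‖ < 1) :
    1 - conj (g.mob u) * g.mob v = (1 - conj u * v) / (conj (g.den u) * g.den v) := by
  have h1 := g.den_ne_zero hu
  have h2 := g.den_ne_zero hv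
  have h1' := (map_ne_zero (starRingEnd ℂ)).2 h1
  have h3 := g.normSq_a_sub
  rw [mob, mob, map_div₀, eq_div_iff (mul_ne_zero h1' h2)]
  field_simp
  simp only [den, map_add, map_mul, Complex.conj_conj]
  linear_combination (1 - conj u * v) * h3

lemma norm_mob_lt (g : CoverSU) {w : ℂ} (hw : ‖w‖ < 1) : ‖g.mob w‖ < 1 := by
  have h := g.one_sub_conj_mob_mul_mob hw hw
  have h1 := norm_pos_iff.2 (g.den_ne_zero hw)
  rw [← Complex.normSq_eq_conj_mul_self, ← Complex.normSq_eq_conj_mul_self,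
    ← Complex.normSq_eq_conj_mul_self] at h
  have h2 : 1 - Complex.normSq (g.mob w) = (1 - Complex.normSq w) / Complex.normSq (g.den w) := by
    exact_mod_cast h
  simp only [Complex.normSq_eq_norm_sq] at h2
  have h3 : 0 < 1 - ‖w‖ ^ 2 := by nlinarith [norm_nonneg w]
  have h4 : 0 < 1 - ‖g.mob w‖ ^ 2 := by rw [h2]; positivity
  nlinarith [norm_nonneg (g.mob w)]

/-- A logarithm of the inverse of the denominator, continuous on the universal cover. -/
def logDen (g : CoverSU) (w : ℂ) : ℂ :=
  Complex.I * g.ω + (Real.log (1 - ‖g.γ‖ ^ 2) / 2 : ℝ) - Complex.log (1 + conj g.γ * w)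

lemma exp_logDen (g : CoverSU) {w : ℂ} (hw : ‖w‖ < 1) :
    Complex.exp (g.logDen w) = (g.den w)⁻¹ := by
  have h0 := one_add_ne_zero_of_norm_lt (norm_conj_mul_lt g.norm_γ_lt hw)
  have hs : Real.exp (Real.log (1 - ‖g.γ‖ ^ 2) / 2) = √(1 - ‖g.γ‖ ^ 2) := by
    rw [Real.sqrt_eq_rpow, Real.rpow_def_of_pos g.one_sub_norm_sq_pos]
    congr 1; ring
  rw [logDen, Complex.exp_sub, Complex.exp_add, Complex.exp_log h0, ← Complex.ofReal_exp, hs,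
    den_eq, a, map_mul, ← Complex.exp_conj, Complex.conj_ofReal, mul_inv, mul_inv,
    ← Complex.exp_neg]
  simp
  ring

lemma logDen_im (g : CoverSU) (w : ℂ) :
    (g.logDen w).im = g.ω - (Complex.log (1 + conj g.γ * w)).im := by
  simp [logDen]

lemma den_mul (g h : CoverSU) {w : ℂ} (hw : ‖w‖ < 1) :
    (g * h).den w = g.den (h.mob w) * h.den w := by
  have h1 := h.den_ne_zero hw
  rw [den, den, mob, mul_a, mul_b]
  field_simp
  simp only [den, map_add, map_mul, Complex.conj_conj]
  ring

lemma mob_mul (g h : CoverSU) {w : ℂ} (hw : ‖w‖ < 1) :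
    (g * h).mob w = g.mob (h.mob w) := by
  have h1 := h.den_ne_zero hw
  have h2 := g.den_ne_zero (h.norm_mob_lt hw)
  rw [mob, den_mul g h hw, mob.eq_1 g (h.mob w), div_eq_div_iff (mul_ne_zero h2 h1) h2, mul_a,
    mul_b]
  have h3 : h.mob w * h.den w = h.a * w + h.b := div_mul_cancel₀ _ h1
  have h4 : h.den w = conj h.b * w + conj h.a := rfl
  linear_combination (-g.a * g.den (h.mob w)) * h3 - g.b * g.den (h.mob w) * h4

/-- The exponentials agree by `den_mul`. In the difference of imaginary parts the `ω` cancel,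
leaving the argument of `cocycle g h` and three principal logarithms, each below `π / 2`. This is
where the coordinate `ω` of the cover is needed. -/
lemma logDen_mul (g h : CoverSU) {w : ℂ} (hw : ‖w‖ < 1) :
    (g * h).logDen w = g.logDen (h.mob w) + h.logDen w := by
  apply eq_of_exp_eq_of_abs_im_sub_lt
  · rw [Complex.exp_add, exp_logDen _ hw, exp_logDen _ hw, exp_logDen _ (h.norm_mob_lt hw),
      den_mul g h hw, mul_inv]
  · have h1 := abs_lt.1 (abs_arg_cocycle g h)
    have h2 := abs_lt.1 (abs_im_log_one_add (norm_conj_mul_lt (g * h).norm_γ_lt hw))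
    have h3 := abs_lt.1 (abs_im_log_one_add (norm_conj_mul_lt h.norm_γ_lt hw))
    have h4 := abs_lt.1 (abs_im_log_one_add (norm_conj_mul_lt g.norm_γ_lt (h.norm_mob_lt hw)))
    rw [Complex.add_im, logDen_im, logDen_im, logDen_im, mul_ω, abs_lt]
    constructor <;> linarith [h1.1, h1.2, h2.1, h2.2, h3.1, h3.2, h4.1, h4.2]

/-- Conjugation cancels `ω`, so again only four principal logarithms are left and the branch is
forced. -/
lemma log_one_sub_conj_mob_mul_mob (g : CoverSU) {u v : ℂ} (hu : ‖u‖ < 1) (hv : ‖v‖ < 1) :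
    Complex.log (1 - conj (g.mob u) * g.mob v)
      = Complex.log (1 - conj u * v) + conj (g.logDen u) + g.logDen v := by
  have hu' := g.norm_mob_lt hu
  have hv' := g.norm_mob_lt hv
  apply eq_of_exp_eq_of_abs_im_sub_lt
  · rw [Complex.exp_add, Complex.exp_add, Complex.exp_log (one_sub_conj_mul_ne_zero hu' hv'),
      Complex.exp_log (one_sub_conj_mul_ne_zero hu hv), Complex.exp_conj, exp_logDen _ hu,
      exp_logDen _ hv, one_sub_conj_mob_mul_mob g hu hv, map_inv₀, div_eq_mul_inv, mul_inv,
      mul_assoc]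
  · have h1 := abs_lt.1 (abs_im_log_one_add (norm_neg_conj_mul_lt hu hv))
    have h2 := abs_lt.1 (abs_im_log_one_add (norm_neg_conj_mul_lt hu' hv'))
    have h3 := abs_lt.1 (abs_im_log_one_add (norm_conj_mul_lt g.norm_γ_lt hu))
    have h4 := abs_lt.1 (abs_im_log_one_add (norm_conj_mul_lt g.norm_γ_lt hv))
    rw [← sub_eq_add_neg] at h1 h2
    rw [Complex.add_im, Complex.add_im, Complex.conj_im, logDen_im, logDen_im, abs_lt]
    constructor <;> linarith [h1.1, h1.2, h2.1, h2.2, h3.1, h3.2, h4.1, h4.2]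

end CoverSU

/-! ### The automorphy factor -/

/-- An exponent of the automorphy factor `e^{it}` times the multiplier. -/
def exponent (k : ℝ) (h : CoverJacobi) (z w : ℂ) : ℂ :=
  Complex.I * h.t + 2 * k * h.g.logDen w - lambda₁ h z w

/-- The principal power in `multiplier` is the right one because `logDen` is built with the
principal logarithm of `1 + conj γ * w`. -/
lemma exp_exponent (k : ℝ) (h : CoverJacobi) (z : ℂ) {w : ℂ} (hw : ‖w‖ < 1) :
    Complex.exp (exponent k h z w) = Complex.exp (Complex.I * h.t) * multiplier k h z w := by
  have h0 := one_add_ne_zero_of_norm_lt (norm_conj_mul_lt h.g.norm_γ_lt hw)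
  rw [multiplier, Complex.cpow_def_of_ne_zero h0, Real.rpow_def_of_pos h.g.one_sub_norm_sq_pos,
    Complex.ofReal_exp, ← Complex.exp_add, ← Complex.exp_add, ← Complex.exp_add,
    ← Complex.exp_add, exponent, CoverSU.logDen]
  congr 1
  push_cast
  ring

lemma w₁_eq_mob (h : CoverJacobi) (w : ℂ) : w₁ h w = h.g.mob w := rfl

lemma z₁_eq (h : CoverJacobi) (z w : ℂ) : z₁ h z w = (h.α - conj h.α * w + z) / h.g.den w := rfl

lemma norm_w₁_lt (h : CoverJacobi) {w : ℂ} (hw : ‖w‖ < 1) : ‖w₁ h w‖ < 1 := h.g.norm_mob_lt hw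

lemma w₁_mul (g h : CoverJacobi) {w : ℂ} (hw : ‖w‖ < 1) : w₁ (g * h) w = w₁ g (w₁ h w) :=
  CoverSU.mob_mul g.g h.g hw

lemma z₁_mul (g h : CoverJacobi) (z : ℂ) {w : ℂ} (hw : ‖w‖ < 1) :
    z₁ (g * h) z w = z₁ g (z₁ h z w) (w₁ h w) := by
  have h1 := h.g.den_ne_zero hw
  have h2 := g.g.den_ne_zero (h.g.norm_mob_lt hw)
  simp only [z₁_eq, w₁_eq_mob, CoverJacobi.mul_def, CoverSU.den_mul _ _ hw]
  have h3 : h.g.mob w * h.g.den w = h.g.a * w + h.g.b := div_mul_cancel₀ _ h1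
  have h4 : h.g.den w = conj h.g.b * w + conj h.g.a := rfl
  rw [div_eq_div_iff (mul_ne_zero h2 h1) h2]
  have h5 : (h.α - conj h.α * w + z) / h.g.den w * h.g.den w = h.α - conj h.α * w + z :=
    div_mul_cancel₀ _ h1
  simp only [CoverSU.actInv, map_add, map_sub, map_mul, Complex.conj_conj]
  linear_combination g.g.den (h.g.mob w) * (conj g.α * h3 - h5 - g.α * h4)

lemma I_mul_im (u : ℂ) : Complex.I * (u.im : ℂ) = (u - conj u) / 2 := by
  rw [Complex.sub_conj]; push_cast; ring

/-- The failure of additivity is exactly the symplectic term in the third coordinate of a product,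
so the factor `e^{it}` absorbs it. -/
lemma lambda₁_mul (g h : CoverJacobi) (z : ℂ) {w : ℂ} (hw : ‖w‖ < 1) :
    lambda₁ (g * h) z w = lambda₁ g (z₁ h z w) (w₁ h w) + lambda₁ h z w
      + Complex.I * ((h.g.actInv g.α * conj h.α).im : ℂ) := by
  have h1 := h.g.den_ne_zero hw
  have h2 := g.g.den_ne_zero (h.g.norm_mob_lt hw)
  have hd := h.g.normSq_a_sub
  have hz := z₁_mul g h z hw
  have hq : ∀ (g : CoverJacobi) (z w : ℂ), lambda₁ g z w
      = conj g.g.b * (z + (g.α - conj g.α * w)) ^ 2 / (2 * g.g.den w)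
        + conj g.α * (z + (g.α - conj g.α * w) / 2) := by
    intro g z w
    rw [lambda₁, CoverSU.den, add_comm (conj g.g.a)]
  rw [I_mul_im, hq, hq, hq]
  simp only [z₁_eq, w₁_eq_mob, CoverJacobi.mul_def, CoverSU.den_mul _ _ hw] at hz ⊢
  set β := h.g.actInv g.α with hβ
  -- The action of `h.g` undoes `actInv`; this is used to eliminate `g.α` in favour of `β`.
  have hβc : conj h.g.b * β + conj h.g.a * conj β = conj g.α := by
    simp only [hβ, CoverSU.actInv, map_sub, map_mul, Complex.conj_conj]
    linear_combination conj g.α * hd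
  set J := h.g.den w with hJ
  set J' := g.g.den (h.g.mob w) with hJ'
  have hJe : J = conj h.g.b * w + conj h.g.a := rfl
  have h3 : h.g.mob w * J = h.g.a * w + h.g.b := div_mul_cancel₀ _ h1
  set ξ := h.α - conj h.α * w + z with hξ
  set δ := β - conj β * w with hδ
  have e1 : ξ / J + (g.α - conj g.α * h.g.mob w) = (ξ + δ) / J := by
    rw [div_add' _ _ _ h1]
    congr 1
    rw [hδ, hβ]
    simp only [CoverSU.actInv, map_sub, map_mul, Complex.conj_conj]
    linear_combination g.α * hJe - conj g.α * h3
  have e1' : g.α - conj g.α * h.g.mob w = δ / J := by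
    rw [add_div ξ] at e1
    exact add_left_cancel e1
  have e2 : conj (g.g * h.g).b = (conj g.g.b + conj h.g.b * (J' * J)) / J := by
    have h5 : J' * J = conj g.g.b * (h.g.a * w + h.g.b) + conj g.g.a * J := by
      rw [hJ', CoverSU.den, ← h3]; ring
    rw [eq_div_iff h1, h5, CoverSU.mul_b, hJe]
    simp only [map_add, map_mul, Complex.conj_conj]
    linear_combination conj g.g.b * hd
  have e3 : conj g.α = conj h.g.b * δ + conj β * J := by
    rw [← hβc, hδ, hJe]; ring
  have e4 : z = ξ - h.α + conj h.α * w := by rw [hξ]; ring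
  have e5 : z + (β + h.α - conj (β + h.α) * w) = ξ + δ := by rw [hξ, hδ, map_add]; ring
  have e6 : z + (β + h.α - conj (β + h.α) * w) / 2 = (ξ + δ + z) / 2 := by rw [← e5]; ring
  have e7 : z + (h.α - conj h.α * w) = ξ := by rw [hξ]; ring
  have e8 : z + (h.α - conj h.α * w) / 2 = (ξ + z) / 2 := by rw [← e7]; ring
  have e9 : (β * conj h.α - conj (β * conj h.α)) / 2
      = ((δ + conj β * w) * conj h.α - conj β * h.α) / 2 := by
    rw [hδ, map_mul, Complex.conj_conj]; ring
  have e10 : ξ / J + δ / J / 2 = (ξ + δ / 2) / J := by ring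
  rw [e1', e2, e5, e6, e7, e8, e9, ← add_div, e10, e3, e4, map_add]
  -- All relations among these quantities have been substituted; what is left is a rational identity
  -- in independent variables.
  clear_value ξ δ J J'
  field_simp
  ring

/-! ### The Gram matrix of the coherent states -/

/-- The kernel, with the conjugated variables of the coherent states. -/
def gram (k : ℝ) (z w z' w' : ℂ) : ℂ :=
  (1 - conj w * w') ^ (-2 * k : ℂ) *
    Complex.exp ((2 * conj z * z' + conj z ^ 2 * w' + z' ^ 2 * conj w) / (2 * (1 - conj w * w')))

lemma bergmanKernel_eq_gram (k : ℝ) (x y : Domain) :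
    bergmanKernel k x y = gram k (conj x.1) (conj (x.2 : ℂ)) (conj y.1) (conj (y.2 : ℂ)) := by
  simp [bergmanKernel, gram]

lemma gram_eq_exp (k : ℝ) (z z' : ℂ) {w w' : ℂ} (hw : ‖w‖ < 1) (hw' : ‖w'‖ < 1) :
    gram k z w z' w' = Complex.exp (-2 * k * Complex.log (1 - conj w * w') +
      (2 * conj z * z' + conj z ^ 2 * w' + z' ^ 2 * conj w) / (2 * (1 - conj w * w'))) := by
  rw [gram, Complex.cpow_def_of_ne_zero (one_sub_conj_mul_ne_zero hw hw'), ← Complex.exp_add]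
  congr 2
  ring

/-- The invariance of the kernel splits into a logarithmic part, which involves only the disc, and
this quadratic part, where `lambda₁` compensates the change of the exponent. -/
lemma gram_quadratic_transform (h : CoverJacobi) (z z' : ℂ) {w w' : ℂ} (hw : ‖w‖ < 1)
    (hw' : ‖w'‖ < 1) :
    (2 * conj (z₁ h z w) * z₁ h z' w' + conj (z₁ h z w) ^ 2 * w₁ h w'
        + z₁ h z' w' ^ 2 * conj (w₁ h w)) / (2 * (1 - conj (w₁ h w) * w₁ h w'))
      - conj (lambda₁ h z w) - lambda₁ h z' w'
    = (2 * conj z * z' + conj z ^ 2 * w' + z' ^ 2 * conj w) / (2 * (1 - conj w * w')) := by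
  have hq : ∀ (g : CoverJacobi) (z w : ℂ), lambda₁ g z w
      = conj g.g.b * (z + (g.α - conj g.α * w)) ^ 2 / (2 * g.g.den w)
        + conj g.α * (z + (g.α - conj g.α * w) / 2) := by
    intro g z w
    rw [lambda₁, CoverSU.den, add_comm (conj g.g.a)]
  have h1 := h.g.den_ne_zero hw
  have h2 := h.g.den_ne_zero hw'
  have h1c := (map_ne_zero (starRingEnd ℂ)).2 h1
  have h3 := one_sub_conj_mul_ne_zero hw hw'
  rw [w₁_eq_mob, w₁_eq_mob, CoverSU.one_sub_conj_mob_mul_mob _ hw hw', hq, hq, z₁_eq, z₁_eq,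
    CoverSU.mob, CoverSU.mob]
  have hJ : h.g.den w' = conj h.g.b * w' + conj h.g.a := rfl
  have hJc : conj (h.g.den w) = h.g.b * conj w + h.g.a := by simp [CoverSU.den]
  simp only [map_add, map_sub, map_mul, map_div₀, map_pow, Complex.conj_conj, map_ofNat]
  generalize conj (h.g.den w) = K at *
  generalize h.g.den w' = J at *
  have hD : ∀ p q r : ℂ, (2 * (p / K) * (q / J) + (p / K) ^ 2 * (r / J)
      + (q / J) ^ 2 * ((conj h.g.a * conj w + conj h.g.b) / K)) /
        (2 * ((1 - conj w * w') / (K * J)))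
      = (2 * p * q + p ^ 2 * r / K + q ^ 2 * (conj h.g.a * conj w + conj h.g.b) / J)
        / (2 * (1 - conj w * w')) := by
    intro p q r
    field_simp
  -- The transformed variable is the old one plus a multiple of `1 - conj w * w'`. That multiple
  -- cancels the denominator of the quadratic form and yields the terms of `lambda₁`.
  have hK : (h.g.a * w' + h.g.b) / K = w' + h.g.b * (1 - conj w * w') / K := by
    rw [hJc] at h1c ⊢
    field_simp
    ring
  have hJ' : (conj h.g.a * conj w + conj h.g.b) / J
      = conj w + conj h.g.b * (1 - conj w * w') / J := by
    rw [hJ] at h2 ⊢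
    field_simp
    ring
  rw [hD, mul_div_assoc, mul_div_assoc, hK, hJ']
  clear hD hK hJ' hJ hJc
  generalize conj h.g.b = B
  generalize conj w = W at *
  field_simp
  ring

lemma gram_transform (k : ℝ) (h : CoverJacobi) (z z' : ℂ) {w w' : ℂ} (hw : ‖w‖ < 1)
    (hw' : ‖w'‖ < 1) :
    conj (Complex.exp (exponent k h z w)) * Complex.exp (exponent k h z' w')
      * gram k (z₁ h z w) (w₁ h w) (z₁ h z' w') (w₁ h w') = gram k z w z' w' := by
  rw [gram_eq_exp k _ _ hw hw', gram_eq_exp k _ _ (norm_w₁_lt h hw) (norm_w₁_lt h hw'),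
    ← Complex.exp_conj, ← Complex.exp_add, ← Complex.exp_add,
    ← gram_quadratic_transform h z z' hw hw', w₁_eq_mob, w₁_eq_mob,
    CoverSU.log_one_sub_conj_mob_mul_mob _ hw hw', exponent, exponent]
  congr 1
  simp only [map_add, map_sub, map_mul, Complex.conj_I, Complex.conj_ofReal, map_ofNat]
  ring

/-- The imaginary term of `lambda₁_mul` cancels against the one in the coordinate `t` of the
product. -/
lemma exponent_mul (k : ℝ) (g h : CoverJacobi) (z : ℂ) {w : ℂ} (hw : ‖w‖ < 1) :
    exponent k (g * h) z w = exponent k g (z₁ h z w) (w₁ h w) + exponent k h z w := by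
  rw [exponent, exponent, exponent, lambda₁_mul g h z hw, w₁_eq_mob, CoverJacobi.mul_def,
    CoverSU.logDen_mul _ _ hw]
  push_cast
  ring

lemma exponent_one (k : ℝ) (z w : ℂ) : exponent k 1 z w = 0 := by
  simp [exponent, CoverJacobi.one_def, CoverSU.logDen, lambda₁]

lemma z₁_one (z w : ℂ) : z₁ 1 z w = z := by simp [z₁, CoverJacobi.one_def]

lemma w₁_one (w : ℂ) : w₁ 1 w = w := by simp [w₁, CoverJacobi.one_def]

/-! ### Continuity of the action and of the cocycle in the group element. -/

namespace CoverSU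

lemma continuous_ω : Continuous fun g : CoverSU => g.ω :=
  continuous_fst.comp (continuous_induced_dom (f := fun g : CoverSU => (g.ω, g.γ)))

lemma continuous_γ : Continuous fun g : CoverSU => g.γ :=
  continuous_snd.comp (continuous_induced_dom (f := fun g : CoverSU => (g.ω, g.γ)))

lemma continuous_a : Continuous fun g : CoverSU => g.a := by
  have h1 := continuous_ω
  have h2 := continuous_γ
  have h3 : ∀ g : CoverSU, √(1 - ‖g.γ‖ ^ 2) ≠ 0 := fun g => (sqrt_pos' g).ne'
  have h4 : Continuous fun g : CoverSU => (√(1 - ‖g.γ‖ ^ 2))⁻¹ :=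
    Continuous.inv₀ (by fun_prop) h3
  unfold a
  fun_prop

lemma continuous_b : Continuous fun g : CoverSU => g.b := by
  simp only [b_eq]
  exact continuous_a.mul continuous_γ

lemma continuous_den (w : ℂ) : Continuous fun g : CoverSU => g.den w := by
  have h1 := continuous_a
  have h2 := continuous_b
  unfold den
  fun_prop

lemma continuous_mob {w : ℂ} (hw : ‖w‖ < 1) : Continuous fun g : CoverSU => g.mob w :=
  ((continuous_a.mul continuous_const).add continuous_b).div (continuous_den w)
    fun g => g.den_ne_zero hw

lemma continuous_logDen {w : ℂ} (hw : ‖w‖ < 1) : Continuous fun g : CoverSU => g.logDen w := by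
  have h1 := continuous_ω
  have h2 := continuous_γ
  have h3 : Continuous fun g : CoverSU => Real.log (1 - ‖g.γ‖ ^ 2) :=
    Continuous.log (by fun_prop) fun g => g.one_sub_norm_sq_pos.ne'
  have h4 : Continuous fun g : CoverSU => Complex.log (1 + conj g.γ * w) :=
    Continuous.clog (by fun_prop)
      fun g => one_add_mem_slitPlane (norm_conj_mul_lt g.norm_γ_lt hw)
  unfold logDen
  fun_prop

end CoverSU

namespace CoverJacobi

lemma continuous_g : Continuous fun h : CoverJacobi => h.g :=
  continuous_fst.comp (continuous_induced_dom (f := fun h : CoverJacobi => (h.g, h.α, h.t)))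

lemma continuous_α : Continuous fun h : CoverJacobi => h.α :=
  continuous_fst.comp <| continuous_snd.comp
    (continuous_induced_dom (f := fun h : CoverJacobi => (h.g, h.α, h.t)))

lemma continuous_t : Continuous fun h : CoverJacobi => h.t :=
  continuous_snd.comp <| continuous_snd.comp
    (continuous_induced_dom (f := fun h : CoverJacobi => (h.g, h.α, h.t)))

end CoverJacobi

lemma continuous_z₁ (z : ℂ) {w : ℂ} (hw : ‖w‖ < 1) : Continuous fun h => z₁ h z w := by
  have h1 := CoverJacobi.continuous_α
  simp only [z₁_eq]
  exact Continuous.div (by fun_prop) ((CoverSU.continuous_den w).comp CoverJacobi.continuous_g)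
    fun h => h.g.den_ne_zero hw

lemma continuous_w₁ {w : ℂ} (hw : ‖w‖ < 1) : Continuous fun h => w₁ h w :=
  (CoverSU.continuous_mob hw).comp CoverJacobi.continuous_g

lemma continuous_exponent (k : ℝ) (z : ℂ) {w : ℂ} (hw : ‖w‖ < 1) :
    Continuous fun h => exponent k h z w := by
  have h1 := CoverJacobi.continuous_α
  have h2 := CoverJacobi.continuous_t
  have h3 := (CoverSU.continuous_logDen hw).comp CoverJacobi.continuous_g
  have h4 := CoverSU.continuous_b.comp CoverJacobi.continuous_g
  simp only [Function.comp_def] at h3 h4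
  have h5 : Continuous fun h => lambda₁ h z w := by
    unfold lambda₁
    refine Continuous.add (Continuous.div (by fun_prop) ?_ fun h => ?_) (by fun_prop)
    · have h6 := CoverSU.continuous_a.comp CoverJacobi.continuous_g
      simp only [Function.comp_def] at h6
      fun_prop
    · have := h.g.den_ne_zero hw
      rw [CoverSU.den, add_comm] at this
      exact mul_ne_zero two_ne_zero this
  unfold exponent
  fun_prop

/-! ### One-parameter subgroups -/

/-- A one-parameter subgroup of the covering Jacobi group. -/
structure IsOneParam (h : ℝ → CoverJacobi) : Prop where
  continuous : Continuous h
  map_add : ∀ s r, h (s + r) = h s * h r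

lemma IsOneParam.map_zero {h : ℝ → CoverJacobi} (hh : IsOneParam h) : h 0 = 1 := by
  have := hh.map_add 0 0
  rw [add_zero] at this
  exact (left_eq_mul.1 this)

lemma continuous_mk {f : ℝ → CoverSU} {α : ℝ → ℂ} {t : ℝ → ℝ} (hω : Continuous fun s => (f s).ω)
    (hγ : Continuous fun s => (f s).γ) (hα : Continuous α) (ht : Continuous t) :
    Continuous fun s => (⟨f s, α s, t s⟩ : CoverJacobi) :=
  continuous_induced_rng.2 ((continuous_induced_rng.2 (hω.prodMk hγ)).prodMk (hα.prodMk ht))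

lemma isOneParam_center : IsOneParam fun s : ℝ => ⟨1, 0, s⟩ where
  continuous := continuous_mk continuous_const continuous_const continuous_const continuous_id
  map_add s r := by
    rw [CoverJacobi.mul_def]
    refine CoverJacobi.ext (one_mul 1).symm ?_ ?_ <;> simp

lemma isOneParam_displacement (α : ℂ) : IsOneParam fun s : ℝ => ⟨1, s * α, 0⟩ where
  continuous := continuous_mk continuous_const continuous_const (by fun_prop) continuous_const
  map_add s r := by
    rw [CoverJacobi.mul_def]
    refine CoverJacobi.ext (one_mul 1).symm ?_ ?_
    · simp; ring
    · simp; ring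

lemma isOneParam_rotation : IsOneParam fun s : ℝ => ⟨CoverSU.rotation s, 0, 0⟩ where
  continuous := continuous_mk continuous_id continuous_const continuous_const continuous_const
  map_add s r := by
    rw [CoverJacobi.mul_def]
    refine CoverJacobi.ext (CoverSU.ext ?_ ?_) ?_ ?_
    · simp [CoverSU.mul_ω, CoverSU.rotation, CoverSU.cocycle]
    · simp [CoverSU.mul_γ, CoverSU.rotation, CoverSU.mulγ]
    · simp [CoverSU.actInv]
    · simp [CoverSU.actInv]

/-- `boost` sees only `|s|` and the direction of `s * ζ`; since `tanh` is odd, one formula serves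
both signs of `s`. For `ζ = 0` division by zero gives the identity. -/
lemma boost_γ (ζ : ℂ) (s : ℝ) :
    (CoverSU.boost (s * ζ)).γ = ζ / ‖ζ‖ * (Real.tanh (s * ‖ζ‖) : ℂ) := by
  simp only [CoverSU.boost, norm_mul, Complex.norm_real, Real.norm_eq_abs]
  rcases lt_trichotomy s 0 with h | h | h
  · rw [abs_of_neg h, neg_mul, Real.tanh_neg]
    have : (s : ℂ) ≠ 0 := by exact_mod_cast h.ne
    push_cast
    rcases eq_or_ne ζ 0 with rfl | hζ
    · simp
    · have : (‖ζ‖ : ℂ) ≠ 0 := by simpa using hζ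
      field_simp
  · simp [h]
  · rw [abs_of_pos h]
    have : (s : ℂ) ≠ 0 := by exact_mod_cast h.ne'
    push_cast
    rcases eq_or_ne ζ 0 with rfl | hζ
    · simp
    · have : (‖ζ‖ : ℂ) ≠ 0 := by simpa using hζ
      field_simp

lemma tanh_add (x y : ℝ) :
    Real.tanh (x + y) = (Real.tanh x + Real.tanh y) / (1 + Real.tanh x * Real.tanh y) := by
  have hx := Real.cosh_pos x
  have hy := Real.cosh_pos y
  have h1 : 1 + Real.sinh x / Real.cosh x * (Real.sinh y / Real.cosh y)
      = Real.cosh (x + y) / (Real.cosh x * Real.cosh y) := by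
    rw [Real.cosh_add]; field_simp
  simp only [Real.tanh_eq_sinh_div_cosh]
  rw [h1, Real.sinh_add]
  field_simp

lemma unit_mul_conj_of_ne_zero {ζ : ℂ} (hζ : ζ ≠ 0) : ζ / ‖ζ‖ * conj (ζ / ‖ζ‖) = 1 := by
  have : (‖ζ‖ : ℂ) ≠ 0 := by simpa using hζ
  rw [map_div₀, Complex.conj_ofReal, div_mul_div_comm, Complex.mul_conj', div_eq_one_iff_eq]
  · ring
  · exact mul_ne_zero this this

/-- Parallel boosts have a real cocycle, which is positive by the next lemma; its argument vanishes,
and so `ω` stays zero. -/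
lemma cocycle_boost (ζ : ℂ) (s r : ℝ) :
    CoverSU.cocycle (CoverSU.boost (s * ζ)) (CoverSU.boost (r * ζ))
      = ((1 + Real.tanh (s * ‖ζ‖) * Real.tanh (r * ‖ζ‖) : ℝ) : ℂ) := by
  rw [CoverSU.cocycle, boost_γ, boost_γ]
  rcases eq_or_ne ζ 0 with rfl | hζ
  · simp
  · have h := unit_mul_conj_of_ne_zero hζ
    simp only [CoverSU.boost, map_mul, Complex.conj_ofReal]
    simp only [Complex.ofReal_zero, mul_zero, Complex.exp_zero, mul_one]
    push_cast
    linear_combination (Complex.tanh (s * ‖ζ‖) * Complex.tanh (r * ‖ζ‖)) * h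

lemma one_add_tanh_mul_tanh_pos (x y : ℝ) : 0 < 1 + Real.tanh x * Real.tanh y := by
  have h1 := Real.abs_tanh_lt_one x
  have h2 := Real.abs_tanh_lt_one y
  have h3 : |Real.tanh x * Real.tanh y| < 1 := by
    rw [abs_mul]; nlinarith [abs_nonneg (Real.tanh x), abs_nonneg (Real.tanh y)]
  linarith [(abs_lt.1 h3).1]

lemma isOneParam_boost (ζ : ℂ) : IsOneParam fun s : ℝ => ⟨CoverSU.boost (s * ζ), 0, 0⟩ where
  continuous := by
    refine continuous_mk continuous_const ?_ continuous_const continuous_const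
    simp only [boost_γ, Real.tanh_eq_sinh_div_cosh]
    have : Continuous fun s : ℝ => Real.sinh (s * ‖ζ‖) / Real.cosh (s * ‖ζ‖) :=
      Continuous.div (by fun_prop) (by fun_prop) fun s => (Real.cosh_pos _).ne'
    fun_prop
  map_add s r := by
    have hp := one_add_tanh_mul_tanh_pos (s * ‖ζ‖) (r * ‖ζ‖)
    rw [CoverJacobi.mul_def]
    refine CoverJacobi.ext (CoverSU.ext ?_ ?_) ?_ ?_
    · rw [CoverSU.mul_ω, cocycle_boost, Complex.arg_ofReal_of_nonneg hp.le]
      simp [CoverSU.boost]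
    · have h0 : (CoverSU.boost (r * ζ)).ω = 0 := rfl
      rw [CoverSU.mul_γ, CoverSU.mulγ, cocycle_boost, boost_γ, boost_γ, boost_γ, h0, add_mul,
        tanh_add]
      push_cast
      simp only [mul_zero, Complex.exp_zero, mul_one]
      ring
    · simp [CoverSU.actInv]
    · simp [CoverSU.actInv]

lemma one_sub_norm_boost_γ_sq (ζ : ℂ) (s : ℝ) :
    1 - ‖(CoverSU.boost (s * ζ)).γ‖ ^ 2 = (Real.cosh (s * ‖ζ‖) ^ 2)⁻¹ := by
  have hc := Real.cosh_pos (s * ‖ζ‖)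
  rw [boost_γ]
  rcases eq_or_ne ζ 0 with rfl | hζ
  · simp
  · have h0 : ‖ζ‖ ≠ 0 := by simpa using hζ
    rw [norm_mul, norm_div, Complex.norm_real, Complex.norm_real, norm_norm, div_self h0, one_mul,
      Real.norm_eq_abs, sq_abs, Real.tanh_eq_sinh_div_cosh, div_pow, Real.sinh_sq]
    field_simp
    ring

lemma boost_a (ζ : ℂ) (s : ℝ) : (CoverSU.boost (s * ζ)).a = (Real.cosh (s * ‖ζ‖) : ℂ) := by
  have h0 : (CoverSU.boost (s * ζ)).ω = 0 := rfl
  rw [CoverSU.a, one_sub_norm_boost_γ_sq, h0, Real.sqrt_inv, Real.sqrt_sq (Real.cosh_pos _).le]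
  simp

lemma boost_b (ζ : ℂ) (s : ℝ) :
    (CoverSU.boost (s * ζ)).b = ζ / ‖ζ‖ * (Real.sinh (s * ‖ζ‖) : ℂ) := by
  have hc : (Real.cosh (s * ‖ζ‖) : ℂ) ≠ 0 := by exact_mod_cast (Real.cosh_pos (s * ‖ζ‖)).ne'
  rw [CoverSU.b_eq, boost_a, boost_γ, Real.tanh_eq_sinh_div_cosh, Complex.ofReal_div]
  field_simp

/-- The polar decomposition: a rotation on the left changes only `ω`, so it suffices to reach `γ` by
a boost. -/
lemma CoverSU.eq_rotation_mul_boost (g : CoverSU) :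
    ∃ ζ : ℂ, g = CoverSU.rotation g.ω * CoverSU.boost ζ := by
  have hγ : ∃ ζ : ℂ, (CoverSU.boost ζ).γ = g.γ := by
    rcases eq_or_ne g.γ 0 with h0 | h0
    · exact ⟨0, by simp [CoverSU.boost, h0]⟩
    · have hn := norm_pos_iff.2 h0
      refine ⟨(Real.artanh ‖g.γ‖ / ‖g.γ‖ : ℝ) * g.γ, ?_⟩
      have h1 : (‖g.γ‖ : ℂ) ≠ 0 := by exact_mod_cast hn.ne'
      rw [boost_γ, div_mul_cancel₀ _ hn.ne',
        Real.tanh_artanh ⟨by linarith, g.norm_γ_lt⟩]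
      field_simp
  obtain ⟨ζ, hζ⟩ := hγ
  refine ⟨ζ, CoverSU.ext ?_ ?_⟩
  · simp [CoverSU.mul_ω, CoverSU.rotation, CoverSU.cocycle, CoverSU.boost]
  · simp [CoverSU.mul_γ, CoverSU.rotation, CoverSU.mulγ, CoverSU.cocycle, hζ]

/-- With the displacement and the centre on the right, no action or symplectic term arises in the
product. -/
lemma CoverJacobi.eq_prod (h : CoverJacobi) :
    ∃ ζ : ℂ, h = ⟨CoverSU.rotation h.g.ω, 0, 0⟩ * ⟨CoverSU.boost ζ, 0, 0⟩ * ⟨1, h.α, 0⟩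
      * ⟨1, 0, h.t⟩ := by
  obtain ⟨ζ, hζ⟩ := h.g.eq_rotation_mul_boost
  refine ⟨ζ, ?_⟩
  simp only [CoverJacobi.mul_def, ← hζ]
  refine CoverJacobi.ext ?_ ?_ ?_ <;> simp [CoverSU.actInv]

/-! ### Infinitesimal action -/

lemma hasDerivAt_z₁_displacement (α z w : ℂ) :
    HasDerivAt (fun s : ℝ => z₁ ⟨1, s * α, 0⟩ z w) (α - conj α * w) 0 := by
  have h : HasDerivAt (fun s : ℝ => (s : ℂ)) 1 0 := Complex.ofRealCLM.hasDerivAt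
  have h2 : (fun s : ℝ => z₁ ⟨1, s * α, 0⟩ z w)
      = fun s : ℝ => (s : ℂ) * (α - conj α * w) + z := by
    funext s; simp [z₁]; ring
  rw [h2]
  simpa using (h.mul_const (α - conj α * w)).add_const z

lemma w₁_displacement (α w : ℂ) (t : ℝ) : w₁ ⟨1, α, t⟩ w = w := by simp [w₁]

lemma hasDerivAt_exp_exponent_displacement (k : ℝ) (α z w : ℂ) :
    HasDerivAt (fun s : ℝ => Complex.exp (exponent k ⟨1, s * α, 0⟩ z w)) (-(conj α * z)) 0 := by
  have h : HasDerivAt (fun s : ℝ => (s : ℂ)) 1 0 := Complex.ofRealCLM.hasDerivAt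
  have h2 : (fun s : ℝ => exponent k ⟨1, s * α, 0⟩ z w)
      = fun s : ℝ => -((s : ℂ) * (conj α * (z + s * ((α - conj α * w) / 2)))) := by
    funext s
    simp [exponent, lambda₁, CoverSU.logDen]
    ring
  have h3 : HasDerivAt (fun s : ℝ => exponent k ⟨1, s * α, 0⟩ z w) (-(conj α * z)) 0 := by
    rw [h2]
    have := (h.fun_mul
      (((h.mul_const ((α - conj α * w) / 2)).const_add z).const_mul (conj α))).fun_neg
    simpa using this
  have h4 := h3.cexp
  simpa [exponent, lambda₁, CoverSU.logDen] using h4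

lemma hasDerivAt_exp_I_mul (c : ℂ) :
    HasDerivAt (fun s : ℝ => Complex.exp (c * s)) c 0 := by
  have h : HasDerivAt (fun s : ℝ => (s : ℂ)) 1 0 := Complex.ofRealCLM.hasDerivAt
  simpa using (h.const_mul c).cexp

lemma z₁_rotation (s : ℝ) (z w : ℂ) :
    z₁ ⟨CoverSU.rotation s, 0, 0⟩ z w = Complex.exp (Complex.I * s) * z := by
  simp [z₁, CoverSU.rotation, CoverSU.a, CoverSU.b, ← Complex.exp_conj, Complex.exp_neg]
  ring

lemma w₁_rotation (s : ℝ) (w : ℂ) :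
    w₁ ⟨CoverSU.rotation s, 0, 0⟩ w = Complex.exp (2 * Complex.I * s) * w := by
  simp [w₁, CoverSU.rotation, CoverSU.a, CoverSU.b, ← Complex.exp_conj, Complex.exp_neg]
  rw [mul_right_comm, ← Complex.exp_add]
  congr 2
  ring

lemma exponent_rotation (k s : ℝ) (z w : ℂ) :
    exponent k ⟨CoverSU.rotation s, 0, 0⟩ z w = 2 * Complex.I * k * s := by
  simp [exponent, CoverSU.rotation, CoverSU.logDen, lambda₁, CoverSU.b]
  ring

lemma hasDerivAt_cosh_smul (x : ℝ) :
    HasDerivAt (fun s : ℝ => (Real.cosh (s * x) : ℂ)) 0 0 := by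
  have h := ((hasDerivAt_id (0 : ℝ)).mul_const x).cosh.ofReal_comp
  simpa using h

lemma hasDerivAt_unit_mul_sinh (ζ : ℂ) :
    HasDerivAt (fun s : ℝ => ζ / ‖ζ‖ * (Real.sinh (s * ‖ζ‖) : ℂ)) ζ 0 := by
  have h := (((hasDerivAt_id (0 : ℝ)).mul_const ‖ζ‖).sinh.ofReal_comp).const_mul (ζ / ‖ζ‖ : ℂ)
  have h0 : ζ / ‖ζ‖ * (‖ζ‖ : ℂ) = ζ := by
    rcases eq_or_ne ζ 0 with rfl | hζ
    · simp
    · exact div_mul_cancel₀ _ (by simpa using hζ)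
  simpa [h0] using h

lemma hasDerivAt_boost_a (ζ : ℂ) :
    HasDerivAt (fun s : ℝ => (CoverSU.boost (s * ζ)).a) 0 0 := by
  simpa only [boost_a] using hasDerivAt_cosh_smul ‖ζ‖

lemma hasDerivAt_boost_b (ζ : ℂ) :
    HasDerivAt (fun s : ℝ => (CoverSU.boost (s * ζ)).b) ζ 0 := by
  simpa only [boost_b] using hasDerivAt_unit_mul_sinh ζ

lemma boost_zero : CoverSU.boost 0 = 1 := by
  refine CoverSU.ext rfl ?_
  simp [CoverSU.boost]

lemma hasDerivAt_boost_den (ζ w : ℂ) :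
    HasDerivAt (fun s : ℝ => (CoverSU.boost (s * ζ)).den w) (conj ζ * w) 0 := by
  have h1 := (hasDerivAt_boost_b ζ).star.mul_const w
  have h2 := (hasDerivAt_boost_a ζ).star
  simpa [CoverSU.den] using h1.fun_add h2

lemma den_one (w : ℂ) : (1 : CoverSU).den w = 1 := by simp [CoverSU.den]

lemma hasDerivAt_z₁_boost (ζ z w : ℂ) :
    HasDerivAt (fun s : ℝ => z₁ ⟨CoverSU.boost (s * ζ), 0, 0⟩ z w) (-(conj ζ * w * z)) 0 := by
  have h := (hasDerivAt_const (0 : ℝ) z).fun_div (hasDerivAt_boost_den ζ w)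
    (by simp [boost_zero, den_one])
  simpa [boost_zero, den_one, z₁_eq, mul_comm z] using h

lemma hasDerivAt_w₁_boost (ζ w : ℂ) :
    HasDerivAt (fun s : ℝ => w₁ ⟨CoverSU.boost (s * ζ), 0, 0⟩ w) (ζ - conj ζ * w ^ 2) 0 := by
  have h := (((hasDerivAt_boost_a ζ).mul_const w).fun_add (hasDerivAt_boost_b ζ)).fun_div
    (hasDerivAt_boost_den ζ w) (by simp [boost_zero, den_one])
  have h2 : ζ - conj ζ * w ^ 2 = ζ - w * (conj ζ * w) := by ring
  rw [h2]
  simpa [boost_zero, den_one, w₁_eq_mob, CoverSU.mob] using h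

/-- To first order `logDen` contributes `-conj ζ * w` and `lambda₁` contributes `conj ζ * z² / 2`.
-/
lemma hasDerivAt_exp_exponent_boost (k : ℝ) (ζ z w : ℂ) :
    HasDerivAt (fun s : ℝ => Complex.exp (exponent k ⟨CoverSU.boost (s * ζ), 0, 0⟩ z w))
      (-(conj ζ * (2 * k * w + z ^ 2 / 2))) 0 := by
  have hγ : HasDerivAt (fun s : ℝ => (CoverSU.boost (s * ζ)).γ) ζ 0 := by
    have := (hasDerivAt_boost_b ζ).fun_div (hasDerivAt_boost_a ζ) (by simp [boost_zero])
    simp only [CoverSU.γ_eq]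
    simpa [boost_zero] using this
  -- This term equals `-log (cosh (s * ‖ζ‖))`, which is even in `s`.
  have hl : HasDerivAt (fun s : ℝ => (Real.log (1 - ‖(CoverSU.boost (s * ζ)).γ‖ ^ 2) / 2 : ℝ))
      0 0 := by
    have h1 : HasDerivAt (fun s : ℝ => Real.cosh (s * ‖ζ‖)) 0 0 := by
      simpa using ((hasDerivAt_id (0 : ℝ)).mul_const ‖ζ‖).cosh
    have h2 := (h1.log (by simp)).fun_neg
    have h3 : (fun s : ℝ => (Real.log (1 - ‖(CoverSU.boost (s * ζ)).γ‖ ^ 2) / 2 : ℝ))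
        = fun s : ℝ => -Real.log (Real.cosh (s * ‖ζ‖)) := by
      funext s
      rw [one_sub_norm_boost_γ_sq, Real.log_inv, Real.log_pow]
      push_cast
      ring
    rw [h3]
    simpa using h2
  have hL : HasDerivAt (fun s : ℝ => (CoverSU.boost (s * ζ)).logDen w) (-(conj ζ * w)) 0 := by
    have h1 := ((hγ.star.mul_const w).const_add 1).clog_real (by simp [boost_zero])
    have h2 := (hl.ofReal_comp).fun_sub h1
    have h3 : ∀ s : ℝ, (CoverSU.boost (s * ζ)).ω = 0 := fun _ => rfl
    simpa [CoverSU.logDen, h3, boost_zero] using h2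
  have hb : HasDerivAt (fun s : ℝ => lambda₁ ⟨CoverSU.boost (s * ζ), 0, 0⟩ z w)
      (conj ζ * z ^ 2 / 2) 0 := by
    have h1 := ((hasDerivAt_boost_b ζ).star.mul_const (z ^ 2)).fun_div
      ((hasDerivAt_boost_den ζ w).const_mul 2) (by simp [boost_zero, den_one])
    have h2 : (fun s : ℝ => lambda₁ ⟨CoverSU.boost (s * ζ), 0, 0⟩ z w)
        = fun s : ℝ => star (CoverSU.boost (s * ζ)).b * z ^ 2
          / (2 * (CoverSU.boost (s * ζ)).den w) := by
      funext s
      simp [lambda₁, CoverSU.den, add_comm]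
    rw [h2]
    refine h1.congr_deriv ?_
    simp [boost_zero, den_one]
    ring
  have h4 := ((hL.const_mul (2 * k : ℂ)).fun_sub hb).cexp
  have h5 : -(conj ζ * (2 * k * w + z ^ 2 / 2))
      = -(2 * k * (conj ζ * w)) - conj ζ * z ^ 2 / 2 := by ring
  rw [h5]
  simpa [exponent, boost_zero, CoverSU.logDen, lambda₁] using h4

/-! ### Strongly continuous unitary one-parameter groups -/

section OneParam

open Filter Topology

/-- A product rule in which the operators are only strongly continuous: write `A t (f t) - A 0 (f
0)` as `A t (f t - f 0)` plus `(A t - A 0) (f 0)`; the isometry property controls the first part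
uniformly in `t`. -/
lemma hasDerivAt_apply_of_isometry {H : Type*} [NormedAddCommGroup H] [InnerProductSpace ℂ H]
    {A : ℝ → H →L[ℂ] H} (hA : ∀ r v, ‖A r v‖ = ‖v‖)
    (hc : ∀ v, Continuous fun r => A r v) {f : ℝ → H} {y z : H} (hf : HasDerivAt f y 0)
    (hz : HasDerivAt (fun r => A r (f 0)) z 0) :
    HasDerivAt (fun r => A r (f r)) (A 0 y + z) 0 := by
  rw [hasDerivAt_iff_tendsto_slope_zero] at hf hz ⊢
  have h1 : Tendsto (fun t : ℝ => A t (t⁻¹ • (f (0 + t) - f 0))) (𝓝[≠] 0) (𝓝 (A 0 y)) := by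
    have h2 : Tendsto (fun t : ℝ => A t y) (𝓝[≠] 0) (𝓝 (A 0 y)) :=
      ((hc y).tendsto 0).mono_left nhdsWithin_le_nhds
    have h3 : Tendsto (fun t : ℝ => A t (t⁻¹ • (f (0 + t) - f 0) - y)) (𝓝[≠] 0) (𝓝 0) := by
      rw [tendsto_zero_iff_norm_tendsto_zero]
      simp only [hA]
      exact tendsto_iff_norm_sub_tendsto_zero.1 hf
    have h4 := h3.add h2
    rw [zero_add] at h4
    refine h4.congr fun t => ?_
    rw [← map_add, sub_add_cancel]
  refine (h1.add hz).congr fun t => ?_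
  simp only [zero_add]
  rw [(A t).map_smul_of_tower, map_sub, ← smul_add]
  congr 1
  abel

variable {H : Type*} [NormedAddCommGroup H] [InnerProductSpace ℂ H] [CompleteSpace H]
  {G : Type*} [Group G]

lemma norm_rep (π : G →* unitary (H →L[ℂ] H)) (g : G) (v : H) :
    ‖(π g : H →L[ℂ] H) v‖ = ‖v‖ :=
  (Unitary.linearIsometryEquiv (π g)).norm_map v

lemma inner_rep (π : G →* unitary (H →L[ℂ] H)) (g : G) (u v : H) :
    ⟪(π g : H →L[ℂ] H) u, (π g : H →L[ℂ] H) v⟫_ℂ = ⟪u, v⟫_ℂ :=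
  (Unitary.linearIsometryEquiv (π g)).inner_map_map u v

lemma rep_mul_apply (π : G →* unitary (H →L[ℂ] H)) (g g' : G) (v : H) :
    (π (g * g') : H →L[ℂ] H) v = (π g : H →L[ℂ] H) ((π g' : H →L[ℂ] H) v) := by
  rw [map_mul]; rfl

lemma rep_one_apply (π : G →* unitary (H →L[ℂ] H)) (v : H) : (π 1 : H →L[ℂ] H) v = v := by
  rw [map_one]; rfl

lemma inner_rep_left (π : G →* unitary (H →L[ℂ] H)) (g : G) (u v : H) :
    ⟪(π g : H →L[ℂ] H) u, v⟫_ℂ = ⟪u, (π g⁻¹ : H →L[ℂ] H) v⟫_ℂ := by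
  rw [← inner_rep π g⁻¹, ← rep_mul_apply, inv_mul_cancel, rep_one_apply]

/-- Unitarity makes the approximation of `v` by combinations of the `u x` uniform over the group. -/
lemma continuous_rep_of_isTotal [TopologicalSpace G] (π : G →* unitary (H →L[ℂ] H))
    {X : Type*} {u : X → H} (hu : IsTotal u)
    (hc : ∀ x, Continuous fun g => (π g : H →L[ℂ] H) (u x)) (v : H) :
    Continuous fun g => (π g : H →L[ℂ] H) v := by
  refine continuous_of_uniform_approx_of_continuous fun U hU => ?_
  obtain ⟨ε, hε, hεU⟩ := Metric.mem_uniformity_dist.1 hU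
  obtain ⟨f, hf⟩ := hu.denseRange.exists_dist_lt v hε
  refine ⟨fun g => (π g : H →L[ℂ] H) (Finsupp.linearCombination ℂ u f), ?_, fun g => hεU ?_⟩
  · simp only [Finsupp.linearCombination_apply, Finsupp.sum, map_sum, map_smul]
    exact continuous_finsetSum _ fun x _ => (hc x).const_smul _
  · rw [dist_eq_norm, ← map_sub, norm_rep, ← dist_eq_norm]
    exact hf

/-- The derivative at zero is carried to `s` by the bounded operator `π (h s)`. -/
lemma hasDerivAt_oneParam {h : ℝ → G} (π : G →* unitary (H →L[ℂ] H))
    (hh : ∀ s r, h (s + r) = h s * h r)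
    {v y : H} (hv : HasDerivAt (fun s => (π (h s) : H →L[ℂ] H) v) y 0) (s : ℝ) :
    HasDerivAt (fun s => (π (h s) : H →L[ℂ] H) v) ((π (h s) : H →L[ℂ] H) y) s := by
  have h1 : HasDerivAt (fun r => (π (h s) : H →L[ℂ] H) ((π (h r) : H →L[ℂ] H) v))
      ((π (h s) : H →L[ℂ] H) y) 0 :=
    ((π (h s) : H →L[ℂ] H).restrictScalars ℝ).hasFDerivAt.comp_hasDerivAt (0 : ℝ) hv
  simp only [← rep_mul_apply, ← hh] at h1
  have h2 : HasDerivAt (fun r => (π (h (s + (r - s))) : H →L[ℂ] H) v)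
      ((π (h s) : H →L[ℂ] H) y) s := by
    have h3 := HasDerivAt.scomp (h := fun r : ℝ => r - s)
      (g₁ := fun r => (π (h (s + r)) : H →L[ℂ] H) v) s (by simpa using h1)
      ((hasDerivAt_id s).sub_const s)
    simpa [Function.comp_def] using h3
  simpa using h2

end OneParam

/-! ### Coherent states and the representation they determine. -/

section Coherent

variable {ι : Type} [DecidableEq ι]

lemma incl_single (i : ι) (c : ℂ) : incl ι (Finsupp.single i c) = c • lp.single 2 i (1 : ℂ) := by
  simp [incl]

lemma inner_incl_single (i : ι) (c : ℂ) (f : Hilb ι) :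
    ⟪incl ι (Finsupp.single i c), f⟫_ℂ = conj c * f i := by
  rw [incl_single, inner_smul_left, lp.inner_single_left]
  simp

/-- The structure shared by the two realizations: the coherent states are total with the given Gram
matrix, and the operators act on them by differential operators. -/
structure IsCoherent (M : JacobiOps ι) (k : ℝ) : Prop where
  inner : ∀ z w z' w', ‖w‖ < 1 → ‖w'‖ < 1 →
    ⟪coherent M z w, coherent M z' w'⟫_ℂ = gram k z w z' w'
  total : ∀ v : Hilb ι, (∀ z w, ‖w‖ < 1 → ⟪coherent M z w, v⟫_ℂ = 0) → v = 0
  summable : ∀ X ∈ [1, M.a, M.adag, M.K0, M.Kp, M.Km], ∀ z w, ‖w‖ < 1 →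
    Summable fun i => ‖coherent M z w i‖ * ‖incl ι (X (Finsupp.single i 1))‖
  -- By `hasDerivAt` below, the pairings with `M.a` and `M.Km` of a basis vector are the derivatives
  -- of the coordinate in `z` and in `w`. The next three fields thus say that the adjoints of
  -- `adag`, `K0`, `Kp` act on the coherent states as first order differential operators.
  adag : ∀ i z w, ‖w‖ < 1 → ⟪incl ι (M.adag (Finsupp.single i 1)), coherent M z w⟫_ℂ
    = z * coherent M z w i + w * ⟪incl ι (M.a (Finsupp.single i 1)), coherent M z w⟫_ℂ
  K0 : ∀ i z w, ‖w‖ < 1 → ⟪incl ι (M.K0 (Finsupp.single i 1)), coherent M z w⟫_ℂ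
    = k * coherent M z w i + z / 2 * ⟪incl ι (M.a (Finsupp.single i 1)), coherent M z w⟫_ℂ
      + w * ⟪incl ι (M.Km (Finsupp.single i 1)), coherent M z w⟫_ℂ
  Kp : ∀ i z w, ‖w‖ < 1 → ⟪incl ι (M.Kp (Finsupp.single i 1)), coherent M z w⟫_ℂ
    = (z ^ 2 / 2 + 2 * k * w) * coherent M z w i
      + z * w * ⟪incl ι (M.a (Finsupp.single i 1)), coherent M z w⟫_ℂ
      + w ^ 2 * ⟪incl ι (M.Km (Finsupp.single i 1)), coherent M z w⟫_ℂ
  hasDerivAt : ∀ i (z w : ℝ → ℂ) (z' w' : ℂ), HasDerivAt z z' 0 → HasDerivAt w w' 0 →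
    (∀ s, ‖w s‖ < 1) → HasDerivAt (fun s => coherent M (z s) (w s) i)
      (z' * ⟪incl ι (M.a (Finsupp.single i 1)), coherent M (z 0) (w 0)⟫_ℂ
        + w' * ⟪incl ι (M.Km (Finsupp.single i 1)), coherent M (z 0) (w 0)⟫_ℂ) 0

variable {M : JacobiOps ι} {k : ℝ}

namespace IsCoherent

lemma isTotal (hM : IsCoherent M k) :
    IsTotal fun x : Domain => coherent M x.1 (x.2 : ℂ) := fun v hv =>
  hM.total v fun z w hw => hv (z, Complex.UnitDisc.mk w hw)

/-- The action of the group on `ℂ × 𝔻`. -/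
def act (h : CoverJacobi) (x : Domain) : Domain :=
  (z₁ h x.1 x.2, Complex.UnitDisc.mk (w₁ h x.2) (norm_w₁_lt h x.2.norm_lt_one))

lemma exists_rep (hM : IsCoherent M k) :
    ∃ π : CoverJacobi →* unitary (Hilb ι →L[ℂ] Hilb ι), ∀ h z w, ‖w‖ < 1 →
      (π h : Hilb ι →L[ℂ] Hilb ι) (coherent M z w)
        = Complex.exp (exponent k h z w) • coherent M (z₁ h z w) (w₁ h w) := by
  suffices H : ∃ π : CoverJacobi →* unitary (Hilb ι →L[ℂ] Hilb ι), ∀ h (x : Domain),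
      (π h : Hilb ι →L[ℂ] Hilb ι) (coherent M x.1 x.2)
        = Complex.exp (exponent k h x.1 x.2) • coherent M (act h x).1 (act h x).2 by
    obtain ⟨π, hπ⟩ := H
    exact ⟨π, fun h z w hw => hπ h (z, Complex.UnitDisc.mk w hw)⟩
  refine hM.isTotal.exists_rep act (fun h x => Complex.exp (exponent k h x.1 x.2)) ?_ ?_ ?_
  · intro h x y
    have hx := x.2.norm_lt_one
    have hy := y.2.norm_lt_one
    rw [inner_smul_left, inner_smul_right, ← mul_assoc, hM.inner _ _ _ _ hx hy, ← gram_transform k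
      h _ _ hx hy]
    exact congrArg _ (hM.inner _ _ _ _ (norm_w₁_lt h hx) (norm_w₁_lt h hy))
  · intro x
    simp [act, exponent_one, z₁_one, w₁_one]
  · intro g h x
    have hx := x.2.norm_lt_one
    simp only [act, Complex.UnitDisc.coe_mk, exponent_mul k g h _ hx, z₁_mul g h _ hx,
      w₁_mul g h hx]
    rw [add_comm, Complex.exp_add]

/-- The squared distance of two coherent states is a combination of values of the continuous kernel.
-/
lemma continuous_coherent (hM : IsCoherent M k) :
    Continuous fun x : Domain => coherent M x.1 (x.2 : ℂ) := by
  rw [continuous_iff_continuousAt]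
  intro x
  have hn : ∀ y : Domain, ‖coherent M y.1 (y.2 : ℂ) - coherent M x.1 (x.2 : ℂ)‖ ^ 2
      = (gram k y.1 y.2 y.1 y.2 - gram k y.1 y.2 x.1 x.2 - gram k x.1 x.2 y.1 y.2
        + gram k x.1 x.2 x.1 x.2).re := by
    intro y
    have hx := x.2.norm_lt_one
    have hy := y.2.norm_lt_one
    rw [← hM.inner _ _ _ _ hx hy, ← hM.inner _ _ _ _ hx hx, ← hM.inner _ _ _ _ hy hx,
      ← hM.inner _ _ _ _ hy hy, ← @inner_self_eq_norm_sq ℂ, inner_sub_left, inner_sub_right,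
      inner_sub_right]
    simp only [RCLike.re_to_complex]
    congr 1
    ring
  have hcg : ∀ f g : Domain → Domain, Continuous f → Continuous g →
      Continuous fun y => gram k (f y).1 (f y).2 (g y).1 (g y).2 := by
    intro f g hf hg
    have hf2 : Continuous fun y => ((f y).2 : ℂ) :=
      Complex.UnitDisc.continuous_coe.comp (continuous_snd.comp hf)
    have hg2 : Continuous fun y => ((g y).2 : ℂ) :=
      Complex.UnitDisc.continuous_coe.comp (continuous_snd.comp hg)
    have hf1 : Continuous fun y => (f y).1 := continuous_fst.comp hf
    have hg1 : Continuous fun y => (g y).1 := continuous_fst.comp hg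
    have hne : ∀ y, 1 - conj ((f y).2 : ℂ) * (g y).2 ≠ 0 := fun y =>
      one_sub_conj_mul_ne_zero (f y).2.norm_lt_one (g y).2.norm_lt_one
    have hl : Continuous fun y => Complex.log (1 - conj ((f y).2 : ℂ) * (g y).2) :=
      Continuous.clog (by fun_prop) fun y => by
        rw [sub_eq_add_neg]
        exact one_add_mem_slitPlane
          (norm_neg_conj_mul_lt (f y).2.norm_lt_one (g y).2.norm_lt_one)
    have he : ∀ y, gram k (f y).1 (f y).2 (g y).1 (g y).2 = _ := fun y =>
      gram_eq_exp k _ _ (f y).2.norm_lt_one (g y).2.norm_lt_one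
    simp only [he]
    refine Complex.continuous_exp.comp (Continuous.add (by fun_prop) ?_)
    exact Continuous.div (by fun_prop) (by fun_prop) fun y => mul_ne_zero two_ne_zero (hne y)
  have hc : Continuous fun y : Domain =>
      ‖coherent M y.1 (y.2 : ℂ) - coherent M x.1 (x.2 : ℂ)‖ ^ 2 := by
    simp only [hn]
    exact Complex.continuous_re.comp ((((hcg _ _ continuous_id continuous_id).sub
      (hcg _ _ continuous_id continuous_const)).sub
      (hcg _ _ continuous_const continuous_id)).add continuous_const)
  have hs := (hc.sqrt).tendsto x
  simp only [Real.sqrt_sq (norm_nonneg _), sub_self, norm_zero] at hs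
  rw [zero_pow two_ne_zero, Real.sqrt_zero] at hs
  exact tendsto_iff_norm_sub_tendsto_zero.2 hs

lemma continuous_rep (hM : IsCoherent M k) {π : CoverJacobi →* unitary (Hilb ι →L[ℂ] Hilb ι)}
    (hπ : ∀ h z w, ‖w‖ < 1 → (π h : Hilb ι →L[ℂ] Hilb ι) (coherent M z w)
      = Complex.exp (exponent k h z w) • coherent M (z₁ h z w) (w₁ h w)) (v : Hilb ι) :
    Continuous fun h => (π h : Hilb ι →L[ℂ] Hilb ι) v := by
  refine continuous_rep_of_isTotal π hM.isTotal (fun x => ?_) v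
  have hx := x.2.norm_lt_one
  have h0 : Continuous fun h => (act h x).2 :=
    Complex.UnitDisc.isEmbedding_coe.continuous_iff.2 (continuous_w₁ hx)
  have h1 : Continuous fun h => act h x := (continuous_z₁ x.1 hx).prodMk h0
  have h2 : Continuous fun h => coherent M (z₁ h x.1 x.2) (w₁ h x.2) := by
    have := hM.continuous_coherent.comp h1
    simpa only [Function.comp_def, act, Complex.UnitDisc.coe_mk] using this
  have h3 : Continuous fun h => Complex.exp (exponent k h x.1 x.2) :=
    Complex.continuous_exp.comp (continuous_exponent k _ hx)
  simp only [hπ _ _ _ hx]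
  exact h3.smul h2

/-- The operator `X` is the generator of the multiplier action along `h`, read off on the
coordinates of the coherent states. -/
def IsGenerator (M : JacobiOps ι) (k : ℝ) (h : ℝ → CoverJacobi) (X : Module.End ℂ (ι →₀ ℂ)) :
    Prop :=
  ∀ i z w, ‖w‖ < 1 → HasDerivAt
    (fun s => Complex.exp (exponent k (h s) z w) * coherent M (z₁ (h s) z w) (w₁ (h s) w) i)
    -- The sign arises because moving `π (h s)` to the other side of the inner product replaces `s`
    -- by `-s`.
    (-⟪incl ι (X (Finsupp.single i 1)), coherent M z w⟫_ℂ) 0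

/-- Differentiation is available only against coherent states. The derivative found there is a norm
continuous curve, so its integral is strongly differentiable, and totality identifies the orbit of
`v` with that integral up to a constant. -/
lemma hasDerivAt_rep (hM : IsCoherent M k) {π : CoverJacobi →* unitary (Hilb ι →L[ℂ] Hilb ι)}
    (hπ : ∀ h z w, ‖w‖ < 1 → (π h : Hilb ι →L[ℂ] Hilb ι) (coherent M z w)
      = Complex.exp (exponent k h z w) • coherent M (z₁ h z w) (w₁ h w))
    {h : ℝ → CoverJacobi} (hh : IsOneParam h) {X : Module.End ℂ (ι →₀ ℂ)}
    (hX : IsGenerator M k h X) (v : ι →₀ ℂ) :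
    HasDerivAt (fun s => (π (h s) : Hilb ι →L[ℂ] Hilb ι) (incl ι v)) (incl ι (X v)) 0 := by
  have h1 : ∀ (v : ι →₀ ℂ) (z w : ℂ), ‖w‖ < 1 → HasDerivAt
      (fun s => ⟪incl ι v, (π (h s) : Hilb ι →L[ℂ] Hilb ι) (coherent M z w)⟫_ℂ)
      (-⟪incl ι (X v), coherent M z w⟫_ℂ) 0 := by
    intro v z w hw
    induction v using Finsupp.induction_linear with
    | zero => simpa using hasDerivAt_const (0 : ℝ) (0 : ℂ)
    | add f g hf hg =>
      simp only [map_add, inner_add_left, neg_add]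
      exact hf.fun_add hg
    | single i c =>
      have h2 := (hX i z w hw).const_mul (conj c)
      have h3 : Finsupp.single i c = c • Finsupp.single i (1 : ℂ) := by simp
      refine (h2.congr_deriv ?_).congr_of_eventuallyEq (Filter.Eventually.of_forall fun s => ?_)
      · rw [h3, map_smul, map_smul, inner_smul_left, mul_neg]
      · simp only [inner_incl_single, hπ _ _ _ hw, inner_smul_right]
        ring
  have hneg : ∀ s, (h s)⁻¹ = h (-s) := fun s => by
    rw [inv_eq_iff_mul_eq_one, ← hh.map_add, add_neg_cancel, hh.map_zero]
  -- The operator `π (h (-s))` sends a coherent state to a multiple of another one, so the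
  -- derivative at zero, applied to that one, gives the derivative at `s`.
  have h2 : ∀ (z w : ℂ), ‖w‖ < 1 → ∀ s, HasDerivAt
      (fun s => ⟪(π (h s) : Hilb ι →L[ℂ] Hilb ι) (incl ι v), coherent M z w⟫_ℂ)
      ⟪(π (h s) : Hilb ι →L[ℂ] Hilb ι) (incl ι (X v)), coherent M z w⟫_ℂ s := by
    intro z w hw s
    simp only [inner_rep_left, hneg]
    have h3 := ((h1 v (z₁ (h (-s)) z w) _ (norm_w₁_lt (h (-s)) hw)).const_mul
      (Complex.exp (exponent k (h (-s)) z w)))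
    have h4 := HasDerivAt.scomp (h := fun r : ℝ => s - r) (g₁ := _) s (by simpa using h3)
      ((hasDerivAt_id s).const_sub s)
    refine (h4.congr_deriv ?_).congr_of_eventuallyEq (Filter.Eventually.of_forall fun r => ?_)
    · rw [hπ _ _ _ hw, inner_smul_right]
      simp
    · have h5 : h (-r) = h (s - r) * h (-s) := by rw [← hh.map_add]; congr 1; ring
      simp only [Function.comp_def]
      rw [h5, rep_mul_apply, hπ (h (-s)) _ _ hw, map_smul, inner_smul_right]
  have hcont : Continuous fun s => (π (h s) : Hilb ι →L[ℂ] Hilb ι) (incl ι (X v)) :=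
    (hM.continuous_rep hπ _).comp hh.continuous
  set F : ℝ → Hilb ι := fun s => ∫ r in (0 : ℝ)..s, (π (h r) : Hilb ι →L[ℂ] Hilb ι) (incl ι (X v))
    with hF
  have hF' : ∀ s, HasDerivAt F ((π (h s) : Hilb ι →L[ℂ] Hilb ι) (incl ι (X v))) s := fun s =>
    hcont.integral_hasStrictDerivAt 0 s |>.hasDerivAt
  have hFv : ∀ s, (π (h s) : Hilb ι →L[ℂ] Hilb ι) (incl ι v) = F s + incl ι v := by
    intro s
    refine hM.isTotal.ext fun x => ?_
    have hx := x.2.norm_lt_one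
    have h3 : ∀ s, HasDerivAt (fun s => ⟪(π (h s) : Hilb ι →L[ℂ] Hilb ι) (incl ι v),
        coherent M x.1 (x.2 : ℂ)⟫_ℂ - ⟪F s, coherent M x.1 (x.2 : ℂ)⟫_ℂ) 0 s := by
      intro s
      have h4 := (h2 x.1 x.2 hx s).fun_sub
        ((hF' s).inner ℂ (hasDerivAt_const s (coherent M x.1 (x.2 : ℂ))))
      simpa using h4
    have h5 := is_const_of_deriv_eq_zero (fun s => (h3 s).differentiableAt)
      (fun s => (h3 s).deriv) s 0
    have h6 : F 0 = 0 := by simp [hF]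
    rw [h6, hh.map_zero, rep_one_apply, inner_zero_left, sub_zero, sub_eq_iff_eq_add'] at h5
    rw [← inner_conj_symm, h5, ← inner_add_left, inner_conj_symm]
  have h7 := (hF' 0).add_const (incl ι v)
  rw [hh.map_zero, rep_one_apply] at h7
  exact h7.congr_of_eventuallyEq (Filter.Eventually.of_forall hFv)

end IsCoherent

end Coherent

namespace IsCoherent

variable {ι : Type} [DecidableEq ι] {M : JacobiOps ι} {k : ℝ}

/-- By the chain rule at `h 0 = 1`, the generator is found by matching the velocities of multiplier,
`z₁` and `w₁` with the fields of `IsCoherent`. -/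
lemma isGenerator_of_hasDerivAt (hM : IsCoherent M k) {h : ℝ → CoverJacobi} (hh : IsOneParam h)
    {X : Module.End ℂ (ι →₀ ℂ)} (j' z' w' : ℂ → ℂ → ℂ)
    (hj : ∀ z w, HasDerivAt (fun s => Complex.exp (exponent k (h s) z w)) (j' z w) 0)
    (hz : ∀ z w, HasDerivAt (fun s => z₁ (h s) z w) (z' z w) 0)
    (hw : ∀ z w, HasDerivAt (fun s => w₁ (h s) w) (w' z w) 0)
    (hX : ∀ i z w, ‖w‖ < 1 → j' z w * coherent M z w i
      + z' z w * ⟪incl ι (M.a (Finsupp.single i 1)), coherent M z w⟫_ℂ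
      + w' z w * ⟪incl ι (M.Km (Finsupp.single i 1)), coherent M z w⟫_ℂ
        = -⟪incl ι (X (Finsupp.single i 1)), coherent M z w⟫_ℂ) :
    IsGenerator M k h X := by
  intro i z w hw1
  have h1 := (hj z w).fun_mul
    (hM.hasDerivAt i _ _ _ _ (hz z w) (hw z w) fun s => norm_w₁_lt (h s) hw1)
  refine h1.congr_deriv ?_
  rw [hh.map_zero, exponent_one, z₁_one, w₁_one, Complex.exp_zero, one_mul, ← add_assoc]
  exact hX i z w hw1

lemma isGenerator_center : IsGenerator M k (fun s => ⟨1, 0, s⟩) (Complex.I • 1) := by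
  intro i z w _
  have h1 := (hasDerivAt_exp_I_mul Complex.I).mul_const (coherent M z w i)
  have h2 : (fun s : ℝ => Complex.exp (exponent k ⟨1, 0, s⟩ z w)
      * coherent M (z₁ ⟨1, 0, s⟩ z w) (w₁ ⟨1, 0, s⟩ w) i)
      = fun s : ℝ => Complex.exp (Complex.I * s) * coherent M z w i := by
    funext s
    simp [exponent, lambda₁, CoverSU.logDen, z₁, w₁]
  rw [h2]
  refine h1.congr_deriv ?_
  simp [inner_incl_single]

lemma isGenerator_displacement (hM : IsCoherent M k) (α : ℂ) :
    IsGenerator M k (fun s => ⟨1, s * α, 0⟩) (α • M.adag - conj α • M.a) := by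
  refine hM.isGenerator_of_hasDerivAt (isOneParam_displacement α)
    (fun z _ => -(conj α * z)) (fun _ w => α - conj α * w) (fun _ _ => 0)
    (fun z w => hasDerivAt_exp_exponent_displacement k α z w)
    (fun z w => hasDerivAt_z₁_displacement α z w)
    (fun z w => by simpa only [w₁_displacement] using hasDerivAt_const (0 : ℝ) w) ?_
  intro i z w hw
  have h1 := hM.adag i z w hw
  simp only [LinearMap.sub_apply, LinearMap.smul_apply, map_sub, map_smul, inner_sub_left,
    inner_smul_left, Complex.conj_conj, h1]
  ring

lemma isGenerator_rotation (hM : IsCoherent M k) :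
    IsGenerator M k (fun s => ⟨CoverSU.rotation s, 0, 0⟩) ((2 * Complex.I) • M.K0) := by
  refine hM.isGenerator_of_hasDerivAt isOneParam_rotation
    (fun _ _ => 2 * Complex.I * k) (fun z _ => Complex.I * z) (fun _ w => 2 * Complex.I * w)
    (fun z w => by simpa only [exponent_rotation] using hasDerivAt_exp_I_mul _)
    (fun z w => by
      simpa only [z₁_rotation] using (hasDerivAt_exp_I_mul Complex.I).mul_const z)
    (fun z w => by
      simpa only [w₁_rotation] using (hasDerivAt_exp_I_mul (2 * Complex.I)).mul_const w) ?_
  intro i z w hw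
  have h1 := hM.K0 i z w hw
  simp only [LinearMap.smul_apply, map_smul, inner_smul_left, h1, map_mul, Complex.conj_I,
    map_ofNat]
  ring

lemma isGenerator_boost (hM : IsCoherent M k) (ζ : ℂ) :
    IsGenerator M k (fun s => ⟨CoverSU.boost (s * ζ), 0, 0⟩) (ζ • M.Kp - conj ζ • M.Km) := by
  refine hM.isGenerator_of_hasDerivAt (isOneParam_boost ζ)
    (fun z w => -(conj ζ * (2 * k * w + z ^ 2 / 2))) (fun z w => -(conj ζ * w * z))
    (fun _ w => ζ - conj ζ * w ^ 2)
    (fun z w => hasDerivAt_exp_exponent_boost k ζ z w)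
    (fun z w => hasDerivAt_z₁_boost ζ z w) (fun z w => hasDerivAt_w₁_boost ζ w) ?_
  intro i z w hw
  have h1 := hM.Kp i z w hw
  simp only [LinearMap.sub_apply, LinearMap.smul_apply, map_sub, map_smul, inner_sub_left,
    inner_smul_left, Complex.conj_conj, h1]
  ring

lemma isRepWithDifferential (hM : IsCoherent M k)
    {π : CoverJacobi →* unitary (Hilb ι →L[ℂ] Hilb ι)}
    (hπ : ∀ h z w, ‖w‖ < 1 → (π h : Hilb ι →L[ℂ] Hilb ι) (coherent M z w)
      = Complex.exp (exponent k h z w) • coherent M (z₁ h z w) (w₁ h w)) :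
    IsRepWithDifferential M π where
  continuous := hM.continuous_rep hπ
  center v := hM.hasDerivAt_rep hπ isOneParam_center isGenerator_center v
  displacement α v :=
    hM.hasDerivAt_rep hπ (isOneParam_displacement α) (hM.isGenerator_displacement α) v
  elliptic v := hM.hasDerivAt_rep hπ isOneParam_rotation hM.isGenerator_rotation v
  squeeze ζ v := hM.hasDerivAt_rep hπ (isOneParam_boost ζ) (hM.isGenerator_boost ζ) v

/-! ### Uniqueness of the representation -/

/-- The coherent states are in the domain of the closure of `X`. -/
def IsTame (M : JacobiOps ι) (X : Module.End ℂ (ι →₀ ℂ)) : Prop :=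
  ∀ z w, ‖w‖ < 1 → Summable fun i => ‖coherent M z w i‖ * ‖incl ι (X (Finsupp.single i 1))‖

lemma IsTame.smul {X : Module.End ℂ (ι →₀ ℂ)} (hX : IsTame M X) (c : ℂ) : IsTame M (c • X) := by
  intro z w hw
  refine ((hX z w hw).mul_left ‖c‖).congr fun i => ?_
  rw [LinearMap.smul_apply, map_smul, norm_smul]
  ring

lemma IsTame.sub {X Y : Module.End ℂ (ι →₀ ℂ)} (hX : IsTame M X) (hY : IsTame M Y) :
    IsTame M (X - Y) := by
  intro z w hw
  refine Summable.of_nonneg_of_le (fun i => by positivity) (fun i => ?_)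
    ((hX z w hw).add (hY z w hw))
  rw [LinearMap.sub_apply, map_sub, ← mul_add]
  exact mul_le_mul_of_nonneg_left (norm_sub_le _ _) (norm_nonneg _)

/-- The basis expansion is differentiated termwise: by unitarity the derivatives are dominated, for
all `s`, by the summable sequence in `IsTame`. Only the differential on finite vectors enters, so
the value is the same for every candidate representation. -/
lemma hasDerivAt_coherent {π : CoverJacobi →* unitary (Hilb ι →L[ℂ] Hilb ι)}
    {h : ℝ → CoverJacobi} (hh : IsOneParam h) {X : Module.End ℂ (ι →₀ ℂ)} (hX : IsTame M X)
    (hπ : ∀ v, HasDerivAt (fun s => (π (h s) : Hilb ι →L[ℂ] Hilb ι) (incl ι v)) (incl ι (X v)) 0)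
    (z : ℂ) {w : ℂ} (hw : ‖w‖ < 1) :
    HasDerivAt (fun s => (π (h s) : Hilb ι →L[ℂ] Hilb ι) (coherent M z w))
      (∑' i, coherent M z w i • incl ι (X (Finsupp.single i 1))) 0 := by
  have hE : HasSum (fun i => coherent M z w i • incl ι (Finsupp.single i 1)) (coherent M z w) := by
    refine (lp.hasSum_single (by simp) (coherent M z w)).congr_fun fun i => ?_
    rw [incl_single, one_smul, ← lp.single_smul]
    simp
  have h1 := hasDerivAt_tsum (𝕜 := ℝ) (hX z w hw)
    (g := fun i s => coherent M z w i •
      (π (h s) : Hilb ι →L[ℂ] Hilb ι) (incl ι (Finsupp.single i 1)))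
    (g' := fun i s => coherent M z w i •
      (π (h s) : Hilb ι →L[ℂ] Hilb ι) (incl ι (X (Finsupp.single i 1)))) (y₀ := 0)
    (fun i s => (hasDerivAt_oneParam π hh.map_add (hπ _) s).fun_const_smul _)
    (fun i s => by rw [norm_smul, norm_rep])
    (by simpa only [hh.map_zero, rep_one_apply] using hE.summable) 0
  simp only [hh.map_zero, rep_one_apply] at h1
  refine h1.congr_of_eventuallyEq (Filter.Eventually.of_forall fun s => ?_)
  have h2 := (π (h s) : Hilb ι →L[ℂ] Hilb ι).hasSum hE
  simp only [map_smul] at h2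
  exact h2.tsum_eq.symm

/-- The curve `r ↦ π (h (-r)) (π' (h r) e)` has derivative zero for each coherent state `e`. Only
`π'` needs to be known explicitly on coherent states. -/
lemma rep_eq_along (hM : IsCoherent M k) {π π' : CoverJacobi →* unitary (Hilb ι →L[ℂ] Hilb ι)}
    (hc : ∀ v : Hilb ι, Continuous fun h => (π h : Hilb ι →L[ℂ] Hilb ι) v)
    (hπ' : ∀ h z w, ‖w‖ < 1 → (π' h : Hilb ι →L[ℂ] Hilb ι) (coherent M z w)
      = Complex.exp (exponent k h z w) • coherent M (z₁ h z w) (w₁ h w))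
    {h : ℝ → CoverJacobi} (hh : IsOneParam h) {X : Module.End ℂ (ι →₀ ℂ)} (hX : IsTame M X)
    (hd : ∀ v, HasDerivAt (fun s => (π (h s) : Hilb ι →L[ℂ] Hilb ι) (incl ι v)) (incl ι (X v)) 0)
    (hd' : ∀ v, HasDerivAt (fun s => (π' (h s) : Hilb ι →L[ℂ] Hilb ι) (incl ι v))
      (incl ι (X v)) 0) (s : ℝ) : π (h s) = π' (h s) := by
  have h1 : ∀ z w, ‖w‖ < 1 → HasDerivAt (fun r => (π (h (-r)) : Hilb ι →L[ℂ] Hilb ι)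
      ((π' (h r) : Hilb ι →L[ℂ] Hilb ι) (coherent M z w))) 0 0 := by
    intro z w hw
    have h2 := hasDerivAt_coherent hh hX hd z hw
    have h3 := hasDerivAt_coherent hh hX hd' z hw
    have h4 := HasDerivAt.scomp (h := fun r : ℝ => -r) (g₁ := _) (0 : ℝ) (by simpa using h2)
      (hasDerivAt_neg (0 : ℝ))
    have h5 := hasDerivAt_apply_of_isometry (A := fun r => (π (h (-r)) : Hilb ι →L[ℂ] Hilb ι))
      (fun r v => norm_rep π _ v) (fun v => (hc v).comp (hh.continuous.comp continuous_neg))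
      h3 (z := _) (by
        simp only [hh.map_zero, rep_one_apply]
        exact h4)
    refine h5.congr_deriv ?_
    simp [hh.map_zero]
  -- Factoring `π' (h s)` out on the right and `π (h (-s))` on the left reduces to `s = 0`, because
  -- `π' (h s)` turns the coherent state into a multiple of a coherent state.
  have hmul : ∀ z w, ‖w‖ < 1 → ∀ s, HasDerivAt (fun r => (π (h (-r)) : Hilb ι →L[ℂ] Hilb ι)
      ((π' (h r) : Hilb ι →L[ℂ] Hilb ι) (coherent M z w))) 0 s := by
    intro z w hw s
    have h2 := (h1 (z₁ (h s) z w) _ (norm_w₁_lt (h s) hw)).const_smul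
      (Complex.exp (exponent k (h s) z w))
    have h3 := ((π (h (-s)) : Hilb ι →L[ℂ] Hilb ι).restrictScalars ℝ).hasFDerivAt.comp_hasDerivAt
      (0 : ℝ) h2
    have h4 := HasDerivAt.scomp (h := fun r : ℝ => r - s) (g₁ := _) s (by simpa using h3)
      ((hasDerivAt_id s).sub_const s)
    refine (h4.congr_deriv (by simp)).congr_of_eventuallyEq
      (Filter.Eventually.of_forall fun r => ?_)
    have h5 : h r = h (r - s) * h s := by rw [← hh.map_add]; congr 1; ring
    have h6 : h (-r) = h (-s) * h (-(r - s)) := by rw [← hh.map_add]; congr 1; ring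
    simp only [Function.comp_def]
    rw [h5, h6, rep_mul_apply, rep_mul_apply, hπ' (h s) _ _ hw, map_smul]
    simp
  apply Subtype.ext
  refine hM.isTotal.clm_ext fun x => ?_
  have hx := x.2.norm_lt_one
  have h2 := is_const_of_deriv_eq_zero (fun r => (hmul x.1 _ hx r).differentiableAt)
    (fun r => (hmul x.1 _ hx r).deriv) s 0
  simp only [neg_zero, hh.map_zero, rep_one_apply] at h2
  rw [← h2, ← rep_mul_apply, ← hh.map_add, add_neg_cancel, hh.map_zero, rep_one_apply, h2]

theorem exists_rep_and_apply (hM : IsCoherent M k) :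
    (∃ π, IsRepWithDifferential M π) ∧
      ∀ π, IsRepWithDifferential M π → ∀ (h : CoverJacobi) (z w : ℂ), ‖w‖ < 1 →
        ‖w₁ h w‖ < 1 ∧
        (π h : Hilb ι →L[ℂ] Hilb ι) (coherent M z w)
          = (Complex.exp (Complex.I * h.t) * multiplier k h z w) •
            coherent M (z₁ h z w) (w₁ h w) := by
  obtain ⟨π', hπ'⟩ := hM.exists_rep
  have hr' := hM.isRepWithDifferential hπ'
  refine ⟨⟨π', hr'⟩, fun π hr h z w hw => ⟨norm_w₁_lt h hw, ?_⟩⟩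
  have ht : ∀ X ∈ [1, M.a, M.adag, M.K0, M.Kp, M.Km], IsTame M X := hM.summable
  have hc := fun t => hM.rep_eq_along hr.continuous hπ' isOneParam_center
    (X := Complex.I • 1) ((ht 1 (by simp)).smul _) hr.center hr'.center t
  have hα := fun α t => hM.rep_eq_along hr.continuous hπ' (isOneParam_displacement α)
    (X := α • M.adag - conj α • M.a) (((ht M.adag (by simp)).smul _).sub
      ((ht M.a (by simp)).smul _)) (hr.displacement α) (hr'.displacement α) t
  have he := fun t => hM.rep_eq_along hr.continuous hπ' isOneParam_rotation
    (X := (2 * Complex.I) • M.K0) ((ht M.K0 (by simp)).smul _) hr.elliptic hr'.elliptic t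
  have hs := fun ζ t => hM.rep_eq_along hr.continuous hπ' (isOneParam_boost ζ)
    (X := ζ • M.Kp - conj ζ • M.Km) (((ht M.Kp (by simp)).smul _).sub
      ((ht M.Km (by simp)).smul _)) (hr.squeeze ζ) (hr'.squeeze ζ) t
  have hα1 := fun α => hα α 1
  have hs1 := fun ζ => hs ζ 1
  simp only [Complex.ofReal_one, one_mul] at hα1 hs1
  have hππ : π h = π' h := by
    obtain ⟨ζ, hζ⟩ := h.eq_prod
    rw [hζ]
    simp only [map_mul, hc, hα1, he, hs1]
  rw [hππ, hπ' h z w hw, exp_exponent k h z hw]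

end IsCoherent

/-! ### The polynomials `Pₙ` -/

/-- The summands of `Pₙ / n!`, extended by zero. -/
def pTerm (z w : ℂ) (n p : ℕ) : ℂ :=
  if 2 * p ≤ n then
    (w / 2) ^ p * z ^ (n - 2 * p) / ((p.factorial : ℂ) * ((n - 2 * p).factorial : ℂ))
  else 0

lemma P_eq_sum_pTerm (n N : ℕ) (hN : n / 2 + 1 ≤ N) (z w : ℂ) :
    P n z w = n.factorial * ∑ p ∈ Finset.range N, pTerm z w n p := by
  rw [P]
  congr 1
  rw [← Finset.sum_subset (Finset.range_mono hN)]
  · refine Finset.sum_congr rfl fun p hp => ?_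
    rw [Finset.mem_range] at hp
    rw [pTerm, if_pos (by omega)]
  · intro p _ hp
    rw [Finset.mem_range] at hp
    rw [pTerm, if_neg (by omega)]

lemma sub_mul_pTerm (z w : ℂ) (n p : ℕ) :
    ((n : ℂ) + 1 - 2 * p) * pTerm z w (n + 1) p = z * pTerm z w n p := by
  rcases lt_trichotomy (2 * p) (n + 1) with h | h | h
  · rw [pTerm, pTerm, if_pos (by omega), if_pos (by omega)]
    obtain ⟨m, rfl⟩ : ∃ m, n = 2 * p + m := ⟨n - 2 * p, by omega⟩
    have h1 : 2 * p + m + 1 - 2 * p = m + 1 := by omega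
    have h2 : 2 * p + m - 2 * p = m := by omega
    rw [h1, h2, Nat.factorial_succ, pow_succ]
    have h3 : (p.factorial : ℂ) ≠ 0 := by exact_mod_cast p.factorial_ne_zero
    have h4 : (m.factorial : ℂ) ≠ 0 := by exact_mod_cast m.factorial_ne_zero
    have h5 : (m : ℂ) + 1 ≠ 0 := by exact_mod_cast m.succ_ne_zero
    push_cast
    field_simp
    ring
  · have h1 : (n : ℂ) + 1 - 2 * p = 0 := by
      have : ((2 * p : ℕ) : ℂ) = ((n + 1 : ℕ) : ℂ) := by rw [h]
      push_cast at this
      rw [this, sub_self]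
    rw [h1, zero_mul, pTerm, if_neg (by omega), mul_zero]
  · rw [pTerm, pTerm, if_neg (by omega), if_neg (by omega), mul_zero, mul_zero]

lemma succ_mul_pTerm (z w : ℂ) (n p : ℕ) :
    2 * ((p : ℂ) + 1) * pTerm z w (n + 2) (p + 1) = w * pTerm z w n p := by
  by_cases h : 2 * p ≤ n
  · rw [pTerm, pTerm, if_pos (by omega), if_pos h]
    have h1 : n + 2 - 2 * (p + 1) = n - 2 * p := by omega
    rw [h1, Nat.factorial_succ, pow_succ]
    have h3 : (p.factorial : ℂ) ≠ 0 := by exact_mod_cast p.factorial_ne_zero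
    have h4 : ((n - 2 * p).factorial : ℂ) ≠ 0 := by exact_mod_cast (n - 2 * p).factorial_ne_zero
    have h5 : (p : ℂ) + 1 ≠ 0 := by exact_mod_cast p.succ_ne_zero
    push_cast
    field_simp
  · rw [pTerm, pTerm, if_neg (by omega), if_neg h, mul_zero, mul_zero]

@[simp] lemma P_zero (z w : ℂ) : P 0 z w = 1 := by simp [P]

@[simp] lemma P_one (z w : ℂ) : P 1 z w = z := by simp [P]

/-- Split `n + 2` as `(n + 2 - 2p) + 2p`: the first factor cancels in the factorial belonging to the
power of `z`, the second in the one belonging to the power of `w`. -/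
lemma P_add_two (n : ℕ) (z w : ℂ) :
    P (n + 2) z w = z * P (n + 1) z w + (n + 1) * w * P n z w := by
  rw [P_eq_sum_pTerm (n + 2) (n + 2 + 1) (by omega), P_eq_sum_pTerm (n + 1) (n + 2 + 1) (by omega),
    P_eq_sum_pTerm n (n + 2) (by omega)]
  have h1 : ((n : ℂ) + 2) * ∑ p ∈ Finset.range (n + 2 + 1), pTerm z w (n + 2) p
      = z * ∑ p ∈ Finset.range (n + 2 + 1), pTerm z w (n + 1) p
        + w * ∑ p ∈ Finset.range (n + 2), pTerm z w n p := by
    have h2 : ∀ p, ((n : ℂ) + 2) * pTerm z w (n + 2) p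
        = z * pTerm z w (n + 1) p + 2 * (p : ℂ) * pTerm z w (n + 2) p := by
      intro p
      have := sub_mul_pTerm z w (n + 1) p
      push_cast at this
      linear_combination this
    rw [Finset.mul_sum, Finset.sum_congr rfl fun p _ => h2 p, Finset.sum_add_distrib,
      ← Finset.mul_sum, Finset.sum_range_succ' (fun p : ℕ => 2 * (p : ℂ) * pTerm z w (n + 2) p)]
    simp only [Nat.cast_add, Nat.cast_one, succ_mul_pTerm, Nat.cast_zero, mul_zero, zero_mul,
      add_zero, Finset.mul_sum]
  rw [Nat.factorial_succ (n + 1), Nat.factorial_succ n]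
  push_cast
  linear_combination ((n : ℂ) + 1) * n.factorial * h1

/-- The truncated index at `n = 0` is harmless, its coefficient being zero. The same convention is
used for all lowered indices below. -/
lemma P_succ (n : ℕ) (z w : ℂ) : P (n + 1) z w = z * P n z w + n * w * P (n - 1) z w := by
  cases n with
  | zero => simp
  | succ n => rw [P_add_two]; push_cast; rfl

lemma mul_P (n : ℕ) (z w : ℂ) : (n : ℂ) * P n z w
    = n * (z * P (n - 1) z w + ((n : ℂ) - 1) * w * P (n - 2) z w) := by
  cases n with
  | zero => simp
  | succ n => rw [P_succ]; push_cast; simp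

lemma P_conj (n : ℕ) (z w : ℂ) : conj (P n z w) = P n (conj z) (conj w) := by
  have h : conj (2 : ℂ) = 2 := Complex.conj_ofNat 2
  simp [P, h]

/-- The partial derivatives are `n Pₙ₋₁` and `n(n-1)/2 Pₙ₋₂`, which is how `a` and `K₋` enter after
normalization. -/
lemma hasDerivAt_P (n : ℕ) {z w : ℝ → ℂ} {z' w' : ℂ} (hz : HasDerivAt z z' 0)
    (hw : HasDerivAt w w' 0) : HasDerivAt (fun s => P n (z s) (w s))
      (z' * (n * P (n - 1) (z 0) (w 0)) + w' * (n * (n - 1) / 2 * P (n - 2) (z 0) (w 0))) 0 := by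
  induction n using Nat.twoStepInduction with
  | zero => simpa using hasDerivAt_const (0 : ℝ) (1 : ℂ)
  | one => simpa using hz
  | more n h1 h2 =>
    simp only [P_add_two]
    have h3 := (hz.fun_mul h2).fun_add ((hw.const_mul ((n : ℂ) + 1)).fun_mul h1)
    refine h3.congr_deriv ?_
    have h4 := P_succ n (z 0) (w 0)
    have h5 := mul_P n (z 0) (w 0)
    have h6 : n + 1 - 2 = n - 1 := by omega
    simp only [Nat.add_sub_cancel, h6, show n + 2 - 1 = n + 1 by omega]
    push_cast
    linear_combination (-(z' * (n + 1))) * h4 - w' * (n + 1) / 2 * h5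

lemma P_zero_right (n : ℕ) (z : ℂ) : P n z 0 = z ^ n := by
  induction n with
  | zero => simp
  | succ n ih => rw [P_succ, ih]; ring

/-- The coefficients `(n!)^{-1/2} Pₙ(z, w)` of the coherent states of the Fock space. -/
def fockCoeff (n : ℕ) (z w : ℂ) : ℂ := ((√(n.factorial : ℝ))⁻¹ : ℝ) * P n z w

@[simp] lemma fockCoeff_zero (z w : ℂ) : fockCoeff 0 z w = 1 := by simp [fockCoeff]

lemma fockCoeff_conj (n : ℕ) (z w : ℂ) :
    conj (fockCoeff n z w) = fockCoeff n (conj z) (conj w) := by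
  rw [fockCoeff, fockCoeff, map_mul, Complex.conj_ofReal, P_conj]

lemma sqrt_mul_inv_sqrt_factorial (n : ℕ) :
    √(n : ℝ) * (√((n - 1).factorial : ℝ))⁻¹ = n * (√(n.factorial : ℝ))⁻¹ := by
  cases n with
  | zero => simp
  | succ n =>
    have h1 : (0 : ℝ) < n + 1 := by positivity
    have h2 : (0 : ℝ) < n.factorial := by exact_mod_cast n.factorial_pos
    have h3 := Real.sq_sqrt h1.le
    rw [Nat.add_sub_cancel, Nat.factorial_succ]
    push_cast
    rw [Real.sqrt_mul h1.le]
    have h4 := Real.sqrt_pos.2 h1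
    have h5 := Real.sqrt_pos.2 h2
    field_simp
    linarith

lemma sqrt_mul_fockCoeff_pred (n : ℕ) (z w : ℂ) :
    ((√(n : ℝ) : ℝ) : ℂ) * fockCoeff (n - 1) z w
      = ((√(n.factorial : ℝ))⁻¹ : ℝ) * (n * P (n - 1) z w) := by
  rw [fockCoeff, ← mul_assoc, ← Complex.ofReal_mul, sqrt_mul_inv_sqrt_factorial]
  push_cast
  ring

lemma sqrt_mul_fockCoeff_succ (n : ℕ) (z w : ℂ) :
    ((√(n + 1 : ℝ) : ℝ) : ℂ) * fockCoeff (n + 1) z w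
      = ((√(n.factorial : ℝ))⁻¹ : ℝ) * P (n + 1) z w := by
  rw [fockCoeff, ← mul_assoc, ← Complex.ofReal_mul]
  congr 2
  have h1 : (0 : ℝ) < n + 1 := by positivity
  rw [Nat.factorial_succ]
  push_cast
  rw [Real.sqrt_mul h1.le]
  have h4 := Real.sqrt_pos.2 h1
  field_simp

lemma fockCoeff_succ (n : ℕ) (z w : ℂ) : ((√(n + 1 : ℝ) : ℝ) : ℂ) * fockCoeff (n + 1) z w
    = z * fockCoeff n z w + ((√(n : ℝ) : ℝ) : ℂ) * w * fockCoeff (n - 1) z w := by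
  rw [sqrt_mul_fockCoeff_succ, mul_right_comm, sqrt_mul_fockCoeff_pred, P_succ, fockCoeff]
  ring

/-! ### Geometric bounds -/

/-- The coefficient of `z` tends to zero, so over two steps the growth is asymptotically governed by
`‖w‖ < 1`. -/
lemma norm_fockCoeff_succ_le (n : ℕ) (z w : ℂ) : ‖fockCoeff (n + 1) z w‖
    ≤ (√(n + 1 : ℝ))⁻¹ * ‖z‖ * ‖fockCoeff n z w‖ + ‖w‖ * ‖fockCoeff (n - 1) z w‖ := by
  have h1 : (0 : ℝ) < √(n + 1 : ℝ) := Real.sqrt_pos.2 (by positivity)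
  have h2 := congrArg norm (fockCoeff_succ n z w)
  rw [norm_mul, Complex.norm_real, Real.norm_of_nonneg h1.le] at h2
  have h3 : √(n : ℝ) ≤ √(n + 1 : ℝ) := Real.sqrt_le_sqrt (by linarith)
  have h4 : ‖z * fockCoeff n z w + ((√(n : ℝ) : ℝ) : ℂ) * w * fockCoeff (n - 1) z w‖
      ≤ ‖z‖ * ‖fockCoeff n z w‖ + √(n + 1 : ℝ) * (‖w‖ * ‖fockCoeff (n - 1) z w‖) := by
    refine (norm_add_le _ _).trans ?_
    rw [norm_mul, norm_mul, norm_mul, Complex.norm_real, Real.norm_of_nonneg (Real.sqrt_nonneg _),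
      mul_assoc (√(n : ℝ))]
    gcongr
  rw [← h2] at h4
  rw [← mul_le_mul_iff_right₀ h1]
  refine h4.trans (le_of_eq ?_)
  field_simp

lemma norm_fockCoeff_le_pow (n : ℕ) {z w : ℂ} {R : ℝ} (hz : ‖z‖ ≤ R) (hw : ‖w‖ ≤ 1) :
    ‖fockCoeff n z w‖ ≤ (R + 1) ^ n := by
  have hR : 0 ≤ R := (norm_nonneg z).trans hz
  have key : ∀ n, ‖fockCoeff (n + 1) z w‖ ≤ R * ‖fockCoeff n z w‖ + ‖fockCoeff (n - 1) z w‖ := by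
    intro n
    refine (norm_fockCoeff_succ_le n z w).trans ?_
    have h1 : (√(n + 1 : ℝ))⁻¹ ≤ 1 := inv_le_one_of_one_le₀ (Real.one_le_sqrt.2 (by simp))
    have h2 : (√(n + 1 : ℝ))⁻¹ * ‖z‖ ≤ R := by
      calc _ ≤ 1 * ‖z‖ := by gcongr
        _ ≤ R := by linarith
    have h3 := mul_le_mul_of_nonneg_right hw (norm_nonneg (fockCoeff (n - 1) z w))
    have h4 := mul_le_mul_of_nonneg_right h2 (norm_nonneg (fockCoeff n z w))
    linarith
  induction n using Nat.twoStepInduction with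
  | zero => simp
  | one => simpa [fockCoeff] using hz.trans (by linarith)
  | more n h1 h2 =>
    have h3 := key (n + 1)
    rw [Nat.add_sub_cancel] at h3
    have h4 : (R + 1) ^ n ≤ (R + 1) ^ (n + 1) := pow_le_pow_right₀ (by linarith) (by omega)
    calc _ ≤ R * (R + 1) ^ (n + 1) + (R + 1) ^ (n + 1) := by
          refine h3.trans (add_le_add (by gcongr) (h1.trans h4))
      _ = _ := by ring

/-- Any `r` with `ρ < r² < 1` is preserved by the two-step recursion once the term in `z` is small;
the midpoint `r² = (1 + ρ) / 2` is taken. The constants are uniform in `z` and `w`, as needed for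
dominated convergence later. -/
lemma exists_norm_fockCoeff_le (R : ℝ) {ρ : ℝ} (hρ0 : 0 ≤ ρ) (hρ : ρ < 1) :
    ∃ C r : ℝ, 0 ≤ C ∧ 0 ≤ r ∧ r < 1 ∧ ∀ n z w, ‖z‖ ≤ R → ‖w‖ ≤ ρ →
      ‖fockCoeff n z w‖ ≤ C * r ^ n := by
  set r : ℝ := √((1 + ρ) / 2) with hr
  have hr2 : r ^ 2 = (1 + ρ) / 2 := Real.sq_sqrt (by linarith)
  have hr0 : 0 < r := Real.sqrt_pos.2 (by linarith)
  have hr1 : r < 1 := by nlinarith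
  have hd : 0 < r ^ 2 - ρ := by rw [hr2]; linarith
  -- Beyond `N` the factor `R * r / √(n + 2)` is at most `r² - ρ`. The terms up to `N + 1` are
  -- absorbed into the constant, using `r ^ n ≥ r ^ (N + 1)`.
  obtain ⟨N, hN⟩ := exists_nat_gt ((R * r / (r ^ 2 - ρ)) ^ 2)
  set B : ℝ := |R| + 1
  have hB : 1 ≤ B := by simp [B]
  have hrp : 0 < r ^ (N + 1) := by positivity
  refine ⟨B ^ (N + 1) / r ^ (N + 1), r, by positivity, hr0.le, hr1, fun n z w hz hw => ?_⟩
  have hR : 0 ≤ R := (norm_nonneg z).trans hz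
  have hsmall : ∀ n ≤ N + 1, ‖fockCoeff n z w‖ ≤ B ^ (N + 1) / r ^ (N + 1) * r ^ n := by
    intro n hn
    have h1 := norm_fockCoeff_le_pow n (z := z) (w := w) (R := |R|) (hz.trans (le_abs_self R))
      (by linarith)
    have h2 : B ^ n ≤ B ^ (N + 1) := pow_le_pow_right₀ hB hn
    have h3 : r ^ (N + 1) ≤ r ^ n := pow_le_pow_of_le_one hr0.le hr1.le hn
    have h4 : 1 ≤ r ^ n / r ^ (N + 1) := (one_le_div hrp).2 h3
    calc _ ≤ B ^ (N + 1) * 1 := by rw [mul_one]; exact h1.trans h2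
      _ ≤ B ^ (N + 1) * (r ^ n / r ^ (N + 1)) := by gcongr
      _ = _ := by ring
  induction n using Nat.twoStepInduction with
  | zero => exact hsmall 0 (by omega)
  | one => exact hsmall 1 (by omega)
  | more n h1 h2 =>
    by_cases hn : n + 2 ≤ N + 1
    · exact hsmall _ hn
    have h3 := norm_fockCoeff_succ_le (n + 1) z w
    rw [Nat.add_sub_cancel] at h3
    set C := B ^ (N + 1) / r ^ (N + 1)
    have hC : 0 ≤ C := by positivity
    have h4 : R * r / (r ^ 2 - ρ) ≤ √((n + 1 : ℕ) + 1 : ℝ) := by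
      apply Real.le_sqrt_of_sq_le
      refine hN.le.trans ?_
      exact_mod_cast (by omega : N ≤ n + 1 + 1)
    have hs : 0 < √((n + 1 : ℕ) + 1 : ℝ) := Real.sqrt_pos.2 (by positivity)
    have h5 : (√((n + 1 : ℕ) + 1 : ℝ))⁻¹ * R * r ≤ r ^ 2 - ρ := by
      rw [div_le_iff₀ hd] at h4
      rw [mul_assoc, inv_mul_le_iff₀ hs]
      exact h4
    calc _ ≤ (√((n + 1 : ℕ) + 1 : ℝ))⁻¹ * R * (C * r ^ (n + 1)) + ρ * (C * r ^ n) := by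
          refine h3.trans ?_
          gcongr
      _ = ((√((n + 1 : ℕ) + 1 : ℝ))⁻¹ * R * r + ρ) * (C * r ^ n) := by ring
      _ ≤ r ^ 2 * (C * r ^ n) := by
          gcongr
          linarith
      _ = _ := by ring

/-- A sequence bounded by a geometric sequence of ratio less than one. -/
def GeomBounded (q : ℕ → ℂ) : Prop := ∃ C r : ℝ, 0 ≤ C ∧ 0 ≤ r ∧ r < 1 ∧ ∀ n, ‖q n‖ ≤ C * r ^ n

lemma geomBounded_fockCoeff (z : ℂ) {w : ℂ} (hw : ‖w‖ < 1) :
    GeomBounded fun n => fockCoeff n z w := by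
  obtain ⟨C, r, hC, hr0, hr1, h⟩ := exists_norm_fockCoeff_le ‖z‖ (norm_nonneg w) hw
  exact ⟨C, r, hC, hr0, hr1, fun n => h n z w le_rfl le_rfl⟩

lemma GeomBounded.mul {q q' : ℕ → ℂ} (h : GeomBounded q) (h' : GeomBounded q') :
    GeomBounded fun n => q n * q' n := by
  obtain ⟨C, r, hC, hr0, hr1, h⟩ := h
  obtain ⟨C', r', hC', hr0', hr1', h'⟩ := h'
  refine ⟨C * C', r * r', by positivity, by positivity, by nlinarith, fun n => ?_⟩
  rw [norm_mul, mul_pow, mul_mul_mul_comm]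
  exact mul_le_mul (h n) (h' n) (norm_nonneg _) (by positivity)

lemma summable_succ_mul_geometric {r : ℝ} (hr0 : 0 ≤ r) (hr1 : r < 1) :
    Summable fun n : ℕ => ((n : ℝ) + 1) * r ^ n := by
  have h1 := summable_pow_mul_geometric_of_norm_lt_one 1 (r := r)
    (by rwa [Real.norm_of_nonneg hr0])
  have h2 := summable_geometric_of_lt_one hr0 hr1
  refine (h1.add h2).congr fun n => ?_
  ring

lemma GeomBounded.summable_succ_mul {q : ℕ → ℂ} (h : GeomBounded q) :
    Summable fun n : ℕ => ((n : ℝ) + 1) * ‖q n‖ := by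
  obtain ⟨C, r, hC, hr0, hr1, h⟩ := h
  refine Summable.of_nonneg_of_le (fun n => by positivity) (fun n => ?_)
    ((summable_succ_mul_geometric hr0 hr1).mul_left C)
  calc _ ≤ ((n : ℝ) + 1) * (C * r ^ n) := by gcongr; exact h n
    _ = _ := by ring

lemma GeomBounded.summable_norm {q : ℕ → ℂ} (h : GeomBounded q) : Summable fun n => ‖q n‖ := by
  refine Summable.of_nonneg_of_le (fun n => norm_nonneg _) (fun n => ?_) h.summable_succ_mul
  nlinarith [norm_nonneg (q n), (Nat.cast_nonneg n : (0 : ℝ) ≤ n)]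

/-! ### Generating functions from first order differential equations -/

lemma GeomBounded.summable_mul_pow {d : ℕ → ℂ} (h : GeomBounded d) {t : ℝ} (ht0 : 0 ≤ t)
    (ht : t ≤ 1) : Summable fun n => d n * (t : ℂ) ^ n := by
  refine Summable.of_norm_bounded h.summable_norm fun n => ?_
  rw [norm_mul, norm_pow, Complex.norm_real, Real.norm_of_nonneg ht0]
  exact mul_le_of_le_one_right (norm_nonneg _) (pow_le_one₀ ht0 ht)

lemma summable_mul_pow_of_le {d : ℕ → ℂ} {u : ℕ → ℝ} (hu : Summable u) (h : ∀ n, ‖d n‖ ≤ u n)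
    {t : ℝ} (ht0 : 0 ≤ t) (ht : t ≤ 1) : Summable fun n => d n * (t : ℂ) ^ n := by
  refine Summable.of_norm_bounded hu fun n => ?_
  rw [norm_mul, norm_pow, Complex.norm_real, Real.norm_of_nonneg ht0]
  exact (mul_le_of_le_one_right (norm_nonneg _) (pow_le_one₀ ht0 ht)).trans (h n)

/-- Geometric decay puts the radius of convergence above one, so the endpoint `t = 1` is included.
-/
lemma GeomBounded.hasDerivAt_tsum {d : ℕ → ℂ} (h : GeomBounded d) {t : ℝ} (ht0 : 0 ≤ t)
    (ht : t ≤ 1) : HasDerivAt (fun t : ℝ => ∑' n, d n * (t : ℂ) ^ n)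
      (∑' n : ℕ, ((n : ℂ) + 1) * d (n + 1) * (t : ℂ) ^ n) t := by
  obtain ⟨C, r, hC, hr0, hr1, h⟩ := h
  obtain ⟨ρ, hρ1, hρr⟩ : ∃ ρ : ℝ, 1 < ρ ∧ r * ρ < 1 := by
    refine ⟨2 / (1 + r), ?_, ?_⟩
    · rw [lt_div_iff₀ (by linarith)]; linarith
    · rw [mul_div_assoc', div_lt_one (by linarith)]; linarith
  have hρ0 : 0 < ρ := by linarith
  have hu : Summable fun n : ℕ => C * (((n : ℝ) + 1) * (r * ρ) ^ n) :=
    (summable_succ_mul_geometric (by positivity) hρr).mul_left C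
  have h1 := hasDerivAt_tsum_of_isPreconnected (𝕜 := ℝ) hu (isOpen_Ioo (a := -ρ) (b := ρ))
    isPreconnected_Ioo (g := fun n (t : ℝ) => d n * (t : ℂ) ^ n)
    (g' := fun n (t : ℝ) => d n * (n * (t : ℂ) ^ (n - 1))) (y₀ := 0) (y := t)
    (fun n y _ => by
      have := (Complex.ofRealCLM.hasDerivAt (x := y)).pow n
      simpa using this.const_mul (d n))
    (fun n y hy => by
      have hy' : |y| ≤ ρ := (abs_lt.2 hy).le
      rw [norm_mul, norm_mul, norm_pow, Complex.norm_real, Complex.norm_natCast, Real.norm_eq_abs]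
      have h2 : |y| ^ (n - 1) ≤ ρ ^ n :=
        (pow_le_pow_left₀ (abs_nonneg y) hy' _).trans (pow_le_pow_right₀ hρ1.le (by omega))
      calc ‖d n‖ * (n * |y| ^ (n - 1)) ≤ (C * r ^ n) * ((n + 1) * ρ ^ n) := by
            gcongr
            · exact h n
            · linarith
        _ = _ := by rw [mul_pow]; ring)
    (by constructor <;> linarith)
    (by
      refine (summable_of_ne_finset_zero (s := {0}) fun n hn => ?_)
      simp at hn
      simp [hn])
    (by constructor <;> linarith)
  refine h1.congr_deriv ?_
  have hs : Summable fun n : ℕ => d n * (n * (t : ℂ) ^ (n - 1)) := by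
    refine Summable.of_norm_bounded ((summable_succ_mul_geometric hr0 hr1).mul_left C) fun n => ?_
    rw [norm_mul, norm_mul, norm_pow, Complex.norm_real, Complex.norm_natCast,
      Real.norm_of_nonneg ht0]
    calc ‖d n‖ * (n * t ^ (n - 1)) ≤ (C * r ^ n) * ((n + 1) * 1) := by
          gcongr
          · exact h n
          · linarith
          · exact pow_le_one₀ ht0 ht
      _ = _ := by ring
  rw [hs.tsum_eq_zero_add]
  simp only [Nat.cast_zero, zero_mul, mul_zero, zero_add, Nat.add_sub_cancel]
  congr 1
  funext n
  push_cast
  ring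

/-- A power series satisfying `A' = β' A` is an exponential. -/
lemma GeomBounded.tsum_eq_exp {d : ℕ → ℂ} (h : GeomBounded d) {β β' : ℝ → ℂ}
    (hβ : ∀ t : ℝ, 0 ≤ t → t ≤ 1 → HasDerivAt β (β' t) t)
    (hd : ∀ t : ℝ, 0 ≤ t → t ≤ 1 → ∑' n : ℕ, ((n : ℂ) + 1) * d (n + 1) * (t : ℂ) ^ n
      = β' t * ∑' n, d n * (t : ℂ) ^ n) :
    ∑' n, d n = d 0 * Complex.exp (β 1 - β 0) := by
  set A : ℝ → ℂ := fun t => ∑' n, d n * (t : ℂ) ^ n with hA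
  -- `exp (-β)` is the integrating factor of `A' = β' A`.
  have h1 : ∀ t : ℝ, 0 ≤ t → t ≤ 1 → HasDerivAt (fun t => A t * Complex.exp (-β t)) 0 t := by
    intro t ht0 ht
    have h2 := (h.hasDerivAt_tsum ht0 ht).fun_mul (hβ t ht0 ht).fun_neg.cexp
    refine h2.congr_deriv ?_
    rw [hd t ht0 ht]
    ring
  have h2 := constant_of_has_deriv_right_zero (a := 0) (b := 1)
    (f := fun t => A t * Complex.exp (-β t))
    (fun t ht => (h1 t ht.1 ht.2).continuousAt.continuousWithinAt)
    (fun t ht => (h1 t ht.1 ht.2.le).hasDerivWithinAt) 1 (by simp)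
  have h3 : A 1 = ∑' n, d n := by simp [hA]
  have h4 : A 0 = d 0 := by
    simp only [hA]
    rw [tsum_eq_single 0 fun n hn => by simp [hn]]
    simp
  simp only [h3, h4, Complex.exp_neg] at h2
  rw [Complex.exp_sub]
  have := Complex.exp_ne_zero (β 1)
  have := Complex.exp_ne_zero (β 0)
  field_simp at h2 ⊢
  exact h2

lemma norm_ofReal_mul_lt {t : ℝ} (ht0 : 0 ≤ t) (ht : t ≤ 1) {τ : ℂ} (hτ : ‖τ‖ < 1) :
    ‖(t : ℂ) * τ‖ < 1 := by
  rw [norm_mul, Complex.norm_real, Real.norm_of_nonneg ht0]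
  nlinarith [norm_nonneg τ]

/-- The binomial series `∑ dₘ = (1 - τ)^{-c}` with `(m + 1) dₘ₊₁ = (m + c) τ dₘ`. -/
lemma tsum_binomial {d : ℕ → ℂ} (h : GeomBounded d) (h0 : d 0 = 1) {c τ : ℂ} (hτ : ‖τ‖ < 1)
    (hrec : ∀ m : ℕ, ((m : ℂ) + 1) * d (m + 1) = (m + c) * τ * d m) :
    ∑' n, d n = Complex.exp (-c * Complex.log (1 - τ)) := by
  have hne : ∀ t : ℝ, 0 ≤ t → t ≤ 1 → 1 - (t : ℂ) * τ ∈ Complex.slitPlane := fun t ht0 ht => by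
    rw [sub_eq_add_neg]
    exact one_add_mem_slitPlane (by rw [norm_neg]; exact norm_ofReal_mul_lt ht0 ht hτ)
  have hb : Summable fun n : ℕ => ((n : ℝ) + 1) * ‖d n‖ := h.summable_succ_mul
  have h1 := h.tsum_eq_exp (β := fun t => -c * Complex.log (1 - t * τ))
    (β' := fun t => c * τ / (1 - t * τ)) ?_ ?_
  · simpa [h0] using h1
  · intro t ht0 ht
    have h2 := ((Complex.ofRealCLM.hasDerivAt (x := t)).mul_const τ).const_sub 1
    have h3 := (h2.clog_real (hne t ht0 ht)).const_mul (-c)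
    refine h3.congr_deriv ?_
    simp
    ring
  · intro t ht0 ht
    have ht' := Complex.slitPlane_ne_zero (hne t ht0 ht)
    have hs := h.summable_mul_pow ht0 ht
    have hs' : Summable fun m : ℕ => (m : ℂ) * d m * (t : ℂ) ^ m :=
      summable_mul_pow_of_le hb (fun m => by
        rw [norm_mul, Complex.norm_natCast]
        nlinarith [norm_nonneg (d m)]) ht0 ht
    -- The sum on the left is `t A'`; the recursion then reads `(1 - t τ) A' = c τ A`.
    have h2 : ∑' m : ℕ, (m : ℂ) * d m * (t : ℂ) ^ m
        = t * ∑' m : ℕ, ((m : ℂ) + 1) * d (m + 1) * (t : ℂ) ^ m := by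
      rw [hs'.tsum_eq_zero_add, ← tsum_mul_left]
      simp only [Nat.cast_zero, zero_mul, zero_add]
      congr 1
      funext m
      push_cast
      ring
    have h3 : ∑' m : ℕ, ((m : ℂ) + 1) * d (m + 1) * (t : ℂ) ^ m
        = τ * (∑' m : ℕ, (m : ℂ) * d m * (t : ℂ) ^ m) + c * τ * ∑' m : ℕ, d m * (t : ℂ) ^ m := by
      rw [← tsum_mul_left, ← tsum_mul_left, ← (hs'.mul_left τ).tsum_add (hs.mul_left (c * τ))]
      congr 1
      funext m
      rw [hrec]
      ring
    rw [h2] at h3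
    rw [div_mul_eq_mul_div, eq_div_iff ht']
    linear_combination h3

/-- Mehler's formula. -/
lemma tsum_fockCoeff_mul_fockCoeff (z z' : ℂ) {w w' : ℂ} (hw : ‖w‖ < 1) (hw' : ‖w'‖ < 1) :
    ∑' n, fockCoeff n z w * fockCoeff n z' w'
      = Complex.exp (-(1 / 2) * Complex.log (1 - w * w')
        + (2 * z * z' + z ^ 2 * w' + z' ^ 2 * w) / (2 * (1 - w * w'))) := by
  have hg := geomBounded_fockCoeff z hw
  have hg' := geomBounded_fockCoeff z' hw'
  have h := hg.mul hg'
  set q : ℕ → ℂ := fun n => fockCoeff n z w with hq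
  set q' : ℕ → ℂ := fun n => fockCoeff n z' w' with hq'
  set σ : ℕ → ℂ := fun n => ((√(n : ℝ) : ℝ) : ℂ) with hσ
  have hσ1 : ∀ n : ℕ, ((√(n + 1 : ℝ) : ℝ) : ℂ) = σ (n + 1) := fun n => by simp [hσ]
  have hσ2 : ∀ n : ℕ, σ n * σ n = n := fun n => by
    simp only [hσ]
    rw [← Complex.ofReal_mul, Real.mul_self_sqrt (Nat.cast_nonneg n), Complex.ofReal_natCast]
  have hσ0 : σ 0 = 0 := by simp [hσ]
  have hr : ∀ n, σ (n + 1) * q (n + 1) = z * q n + σ n * w * q (n - 1) := fun n => by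
    rw [← hσ1]; exact fockCoeff_succ n z w
  have hr' : ∀ n, σ (n + 1) * q' (n + 1) = z' * q' n + σ n * w' * q' (n - 1) := fun n => by
    rw [← hσ1]; exact fockCoeff_succ n z' w'
  have hτ : ‖w * w'‖ < 1 := by
    rw [norm_mul]; nlinarith [norm_nonneg w, norm_nonneg w']
  have hτt : ∀ t : ℝ, 0 ≤ t → t ≤ 1 → ‖(t : ℂ) ^ 2 * (w * w')‖ < 1 := by
    intro t ht0 ht
    have := norm_ofReal_mul_lt (t := t ^ 2) (by positivity) (by nlinarith) hτ
    simpa using this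
  have hne : ∀ t : ℝ, 0 ≤ t → t ≤ 1 → 1 - (t : ℂ) ^ 2 * (w * w') ∈ Complex.slitPlane :=
    fun t ht0 ht => by
      rw [sub_eq_add_neg]
      exact one_add_mem_slitPlane (by rw [norm_neg]; exact hτt t ht0 ht)
  have h1 := h.tsum_eq_exp
    -- Since `Pₙ(tz, t²w) = tⁿ Pₙ(z, w)`, this is the expected exponent with `(z, w)` replaced by
    -- `(tz, t²w)`.
    (β := fun t => -(1 / 2) * Complex.log (1 - t ^ 2 * (w * w'))
      + (2 * (t * (z * z')) + t ^ 2 * (z ^ 2 * w' + z' ^ 2 * w)) / (2 * (1 - t ^ 2 * (w * w'))))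
    (β' := fun t => t * (w * w') / (1 - t ^ 2 * (w * w'))
      + (z + w * z' * t) * (z' + w' * z * t) / (1 - t ^ 2 * (w * w')) ^ 2) ?_ ?_
  · rw [h1]
    simp
    congr 1
    ring
  · intro t ht0 ht
    have ht' := Complex.slitPlane_ne_zero (hne t ht0 ht)
    have e0 := Complex.ofRealCLM.hasDerivAt (x := t)
    have e1 := e0.fun_pow 2
    have e2 := (e1.mul_const (w * w')).const_sub 1
    have e3 := (e2.clog_real (hne t ht0 ht)).const_mul (-(1 / 2))
    have e4 := ((e0.mul_const (z * z')).const_mul 2).fun_add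
      (e1.mul_const (z ^ 2 * w' + z' ^ 2 * w))
    have e5 := e3.fun_add (e4.fun_div (e2.const_mul 2) (mul_ne_zero two_ne_zero ht'))
    refine e5.congr_deriv ?_
    simp only [Complex.ofRealCLM_apply, Complex.ofReal_one]
    field_simp
    push_cast
    ring
  · intro t ht0 ht
    have ht' := Complex.slitPlane_ne_zero (hne t ht0 ht)
    have hσle : ∀ n : ℕ, ‖σ (n + 1)‖ ≤ n + 1 := fun n => by
      simp only [hσ]
      rw [Complex.norm_real, Real.norm_of_nonneg (Real.sqrt_nonneg _)]
      push_cast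
      exact Real.sqrt_le_iff.2 ⟨by positivity, by nlinarith [(Nat.cast_nonneg n : (0 : ℝ) ≤ n)]⟩
    have hsh : ∀ {q : ℕ → ℂ}, GeomBounded q → GeomBounded fun n => q (n + 1) := by
      rintro q ⟨C, r, hC, hr0, hr1, hb⟩
      refine ⟨C * r, r, by positivity, hr0, hr1, fun n => (hb (n + 1)).trans (le_of_eq ?_)⟩
      ring
    have sA : Summable fun n => q n * q' n * (t : ℂ) ^ n := h.summable_mul_pow ht0 ht
    have sC : Summable fun n => σ (n + 1) * q n * q' (n + 1) * (t : ℂ) ^ n :=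
      summable_mul_pow_of_le (hg.mul (hsh hg')).summable_succ_mul (fun n => by
        rw [mul_assoc, norm_mul]; gcongr; exact hσle n) ht0 ht
    have sB : Summable fun n => σ (n + 1) * q (n + 1) * q' n * (t : ℂ) ^ n :=
      summable_mul_pow_of_le ((hsh hg).mul hg').summable_succ_mul (fun n => by
        rw [mul_assoc, norm_mul]; gcongr; exact hσle n) ht0 ht
    have sD : Summable fun n : ℕ => ((n : ℂ) + 1) * (q (n + 1) * q' (n + 1)) * (t : ℂ) ^ n :=
      summable_mul_pow_of_le ((hsh hg).mul (hsh hg')).summable_succ_mul (fun n => by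
        rw [norm_mul]
        gcongr
        exact_mod_cast (Complex.norm_natCast (n + 1)).le) ht0 ht
    have sD0 : Summable fun n : ℕ => (n : ℂ) * (q n * q' n) * (t : ℂ) ^ n :=
      summable_mul_pow_of_le h.summable_succ_mul (fun n => by
        rw [norm_mul, Complex.norm_natCast]
        gcongr
        linarith) ht0 ht
    have shift : ∀ f : ℕ → ℂ, Summable (fun n => f (n + 1) * (t : ℂ) ^ n) → f 0 = 0 →
        HasSum (fun n => f n * (t : ℂ) ^ n) (t * ∑' n, f (n + 1) * (t : ℂ) ^ n) := by
      intro f hf h0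
      rw [← hasSum_nat_add_iff' 1]
      simp only [Finset.range_one, Finset.sum_singleton, h0, zero_mul, sub_zero, pow_succ]
      refine (hf.hasSum.mul_left (t : ℂ)).congr_fun fun n => ?_
      ring
    -- `D` is the derivative of `A`; `B` and `C` are the sums with one index raised. The two
    -- recurrences give linear equations expressing `B`, `C` and finally `D` through `A`.
    set A := ∑' n, q n * q' n * (t : ℂ) ^ n
    set B := ∑' n, σ (n + 1) * q (n + 1) * q' n * (t : ℂ) ^ n with hB
    set C := ∑' n, σ (n + 1) * q n * q' (n + 1) * (t : ℂ) ^ n with hC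
    set D := ∑' n : ℕ, ((n : ℂ) + 1) * (q (n + 1) * q' (n + 1)) * (t : ℂ) ^ n with hD
    have eB : HasSum (fun n => σ n * q n * q' (n - 1) * (t : ℂ) ^ n) (t * B) :=
      shift (fun n => σ n * q n * q' (n - 1)) sB (by simp [hσ0])
    have eC : HasSum (fun n => σ n * q (n - 1) * q' n * (t : ℂ) ^ n) (t * C) :=
      shift (fun n => σ n * q (n - 1) * q' n) sC (by simp [hσ0])
    have eB' : B = z * A + w * (t * C) := by
      refine HasSum.unique (f := fun n => σ (n + 1) * q (n + 1) * q' n * (t : ℂ) ^ n)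
        sB.hasSum (((sA.hasSum.mul_left z).add (eC.mul_left w)).congr_fun fun n => ?_)
      rw [hr]; ring
    have eC' : C = z' * A + w' * (t * B) := by
      refine HasSum.unique (f := fun n => σ (n + 1) * q n * q' (n + 1) * (t : ℂ) ^ n)
        sC.hasSum (((sA.hasSum.mul_left z').add (eB.mul_left w')).congr_fun fun n => ?_)
      linear_combination (q n * (t : ℂ) ^ n) * hr' n
    have eD0 : HasSum (fun n : ℕ => (n : ℂ) * (q n * q' n) * (t : ℂ) ^ n) (t * D) := by
      have := shift (fun n => (n : ℂ) * (q n * q' n)) (by push_cast; exact sD) (by simp)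
      push_cast at this
      exact this
    have eE : HasSum (fun n : ℕ => (n : ℂ) * (q (n - 1) * q' (n - 1)) * (t : ℂ) ^ n)
        (t * (A + t * D)) := by
      have e1 : HasSum (fun n : ℕ => ((n + 1 : ℕ) : ℂ) * (q n * q' n) * (t : ℂ) ^ n)
          (A + t * D) := by
        refine (sA.hasSum.add eD0).congr_fun fun n => ?_
        push_cast
        ring
      have := shift (fun n => (n : ℂ) * (q (n - 1) * q' (n - 1))) e1.summable (by simp)
      simp only [Nat.add_sub_cancel, e1.tsum_eq] at this
      exact this
    -- The factor `n + 1` is written as `σ (n + 1)²`, one root for each recurrence; the product of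
    -- the two lowered terms then carries `σ n² = n`.
    have eD : D = z * C + w * z' * (t * C) + w * w' * (t * (A + t * D)) := by
      refine HasSum.unique
        (f := fun n : ℕ => ((n : ℂ) + 1) * (q (n + 1) * q' (n + 1)) * (t : ℂ) ^ n)
        sD.hasSum ((((sC.hasSum.mul_left z).add (eC.mul_left (w * z'))).add
          (eE.mul_left (w * w'))).congr_fun fun n => ?_)
      have e1 := hσ2 (n + 1)
      have e2 := hσ2 n
      push_cast at e1
      linear_combination (-(q (n + 1) * q' (n + 1) * (t : ℂ) ^ n)) * e1
        + (σ (n + 1) * q' (n + 1) * (t : ℂ) ^ n) * hr n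
        + (σ n * w * q (n - 1) * (t : ℂ) ^ n) * hr' n
        + (w * w' * q (n - 1) * q' (n - 1) * (t : ℂ) ^ n) * e2
    have e6 : (1 - (t : ℂ) ^ 2 * (w * w')) * C = (z' + w' * z * t) * A := by
      linear_combination eC' + w' * t * eB'
    have e7 : D * (1 - (t : ℂ) ^ 2 * (w * w')) ^ 2
        = (t * (w * w') * (1 - (t : ℂ) ^ 2 * (w * w'))
          + (z + w * z' * t) * (z' + w' * z * t)) * A := by
      linear_combination (1 - (t : ℂ) ^ 2 * (w * w')) * eD + (z + w * z' * t) * e6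
    change D = _ * A
    rw [div_add_div _ _ ht' (pow_ne_zero 2 ht'), div_mul_eq_mul_div,
      eq_div_iff (mul_ne_zero ht' (pow_ne_zero 2 ht'))]
    linear_combination (1 - (t : ℂ) ^ 2 * (w * w')) * e7

/-! ### Double series and the exponential of a sum. -/

section Series

variable {H : Type*} [NormedAddCommGroup H]

lemma hasSum_sum_antidiagonal {f : ℕ × ℕ → H} {s : H} (hf : HasSum f s) :
    HasSum (fun n => ∑ p ∈ Finset.HasAntidiagonal.antidiagonal n, f p) s := by
  have h1 := (Finset.HasAntidiagonal.sigmaAntidiagonalEquivProd (A := ℕ)).hasSum_iff.2 hf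
  refine h1.sigma fun n => ?_
  exact Finset.hasSum (Finset.HasAntidiagonal.antidiagonal n) f

lemma summable_sum_norm_antidiagonal {f : ℕ × ℕ → H} (hf : Summable fun p => ‖f p‖) :
    Summable fun n => ∑ p ∈ Finset.HasAntidiagonal.antidiagonal n, ‖f p‖ :=
  (hasSum_sum_antidiagonal hf.hasSum).summable

end Series

lemma onBasis_single {ι : Type} (f : ι → (ι →₀ ℂ)) (i : ι) (c : ℂ) :
    onBasis f (Finsupp.single i c) = c • f i := by
  simp [onBasis]

variable {ι : Type} [DecidableEq ι]

lemma norm_incl_single (i : ι) (c : ℂ) : ‖incl ι (Finsupp.single i c)‖ = ‖c‖ := by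
  rw [incl_single, norm_smul, lp.norm_single (by simp)]
  simp

lemma incl_apply (v : ι →₀ ℂ) (i : ι) : incl ι v i = v i := by
  induction v using Finsupp.induction_linear with
  | zero => simp
  | add f g hf hg => simp [hf, hg]
  | single j c =>
    rw [incl_single, Finsupp.single_apply]
    simp only [lp.coeFn_smul, Pi.smul_apply, lp.single_apply, Pi.single_apply, smul_eq_mul,
      mul_ite, mul_one, mul_zero]
    simp only [eq_comm]

lemma hasSum_apply {X : Type*} {f : X → Hilb ι} {s : Hilb ι} (hf : HasSum f s) (i : ι) :
    HasSum (fun x => f x i) (s i) := by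
  have h1 := hf.mapL (innerSL ℂ (lp.single 2 i (1 : ℂ) : Hilb ι))
  simpa [lp.inner_single_left] using h1

/-- The binomial theorem for commuting `A` and `B`: the exponential series becomes the antidiagonal
summation of a double series, which is easier to sum absolutely. -/
lemma coherentTerm_eq_sum (M : JacobiOps ι) (z w : ℂ) {A B : Module.End ℂ (ι →₀ ℂ)}
    (hAB : z • M.adag + w • M.Kp = A + B) (hc : Commute A B) (n : ℕ) :
    coherentTerm M z w n = ∑ p ∈ Finset.HasAntidiagonal.antidiagonal n,
      ((p.1.factorial : ℂ)⁻¹ * (p.2.factorial : ℂ)⁻¹) • incl ι ((A ^ p.1) ((B ^ p.2) M.e0)) := by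
  rw [coherentTerm, hAB, hc.add_pow', LinearMap.sum_apply, map_sum, Finset.smul_sum]
  refine Finset.sum_congr rfl fun p hp => ?_
  rw [Finset.HasAntidiagonal.mem_antidiagonal] at hp
  subst hp
  rw [LinearMap.smul_apply, ← Nat.cast_smul_eq_nsmul ℂ, map_smul, smul_smul, Module.End.mul_apply,
    Nat.cast_add_choose]
  congr 1
  have h3 : ((p.1 + p.2).factorial : ℂ) ≠ 0 := by exact_mod_cast (p.1 + p.2).factorial_ne_zero
  field_simp

/-! ### The Fock space -/

lemma annihilation_single (n : ℕ) (c : ℂ) : annihilation (Finsupp.single n c)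
    = Finsupp.single (n - 1) (c * ((√(n : ℝ) : ℝ) : ℂ)) := by
  simp [annihilation, onBasis_single]

lemma creation_single (n : ℕ) (c : ℂ) : creation (Finsupp.single n c)
    = Finsupp.single (n + 1) (c * ((√(n + 1 : ℝ) : ℝ) : ℂ)) := by
  simp [creation, onBasis_single]

lemma creation_pow_single_zero (n : ℕ) : (creation ^ n) (Finsupp.single 0 1)
    = Finsupp.single n ((√(n.factorial : ℝ) : ℝ) : ℂ) := by
  induction n with
  | zero => simp
  | succ n ih =>
    rw [pow_succ', Module.End.mul_apply, ih, creation_single, ← Complex.ofReal_mul,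
      Nat.factorial_succ, mul_comm, ← Real.sqrt_mul (by positivity)]
    push_cast
    rfl

/-- The coefficients of the double series of the coherent states of the Fock space. -/
def fockTerm (z w : ℂ) (p : ℕ × ℕ) : ℂ :=
  (p.1.factorial : ℂ)⁻¹ * (p.2.factorial : ℂ)⁻¹ * (z ^ p.1 * (w / 2) ^ p.2 *
    ((√((p.1 + 2 * p.2).factorial : ℝ) : ℝ) : ℂ))

lemma coherentTerm_fock (z w : ℂ) (n : ℕ) :
    coherentTerm fock z w n = ∑ p ∈ Finset.HasAntidiagonal.antidiagonal n,
      fockTerm z w p • incl ℕ (Finsupp.single (p.1 + 2 * p.2) 1) := by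
  have hc : Commute (z • creation) ((w / 2) • creation ^ 2) :=
    ((Commute.refl creation).pow_right 2).smul_left z |>.smul_right _
  rw [coherentTerm_eq_sum fock z w (A := z • creation) (B := (w / 2) • creation ^ 2) ?_ hc]
  · refine Finset.sum_congr rfl fun p _ => ?_
    have h1 : ((z • creation) ^ p.1) ((((w / 2) • creation ^ 2) ^ p.2) fock.e0)
        = Finsupp.single (p.1 + 2 * p.2) (z ^ p.1 * (w / 2) ^ p.2 *
          ((√((p.1 + 2 * p.2).factorial : ℝ) : ℝ) : ℂ)) := by
      rw [smul_pow, smul_pow, ← pow_mul, LinearMap.smul_apply, LinearMap.smul_apply, map_smul,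
        ← Module.End.mul_apply, ← pow_add, smul_smul]
      change _ • (creation ^ _) (Finsupp.single 0 1) = _
      rw [creation_pow_single_zero, Finsupp.smul_single, smul_eq_mul]
    rw [h1, fockTerm, incl_single, incl_single, smul_smul, one_smul]
  · rw [fock, smul_smul]
    congr 2
    ring

/-- The vector `φ_l` is reached by the finitely many pairs `(l - 2p, p)`; this is how `P l` appears.
-/
lemma hasSum_fockTerm_fiber (z w : ℂ) (l : ℕ) :
    HasSum (fun p : ℕ × ℕ => if p.1 + 2 * p.2 = l then fockTerm z w p else 0)
      (fockCoeff l z w) := by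
  have hinj : Function.Injective fun p : ℕ => (l - 2 * p, p) := fun p q h => (Prod.ext_iff.1 h).2
  have h1 := hasSum_sum_of_ne_finset_zero (L := SummationFilter.unconditional _)
    (f := fun p : ℕ × ℕ => if p.1 + 2 * p.2 = l then fockTerm z w p else 0)
    (s := (Finset.range (l / 2 + 1)).image fun p : ℕ => (l - 2 * p, p)) ?_
  · convert h1 using 1
    rw [Finset.sum_image fun p _ q _ h => hinj h, fockCoeff, P, ← mul_assoc, Finset.mul_sum]
    refine Finset.sum_congr rfl fun p hp => ?_
    rw [Finset.mem_range] at hp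
    have h2 : l - 2 * p + 2 * p = l := by omega
    rw [if_pos h2, fockTerm, h2]
    have h3 : (0 : ℝ) < √(l.factorial : ℝ) := Real.sqrt_pos.2 (by exact_mod_cast l.factorial_pos)
    have h4 : ((√(l.factorial : ℝ))⁻¹ : ℝ) * (l.factorial : ℂ)
        = ((√(l.factorial : ℝ) : ℝ) : ℂ) := by
      rw [← Complex.ofReal_natCast, ← Complex.ofReal_mul]
      congr 1
      rw [inv_mul_eq_iff_eq_mul₀ h3.ne', Real.mul_self_sqrt (by positivity)]
    rw [h4]
    field_simp
  · intro p hp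
    rw [if_neg]
    rintro rfl
    exact hp (Finset.mem_image.2 ⟨p.2, Finset.mem_range.2 (by omega), Prod.ext (by simp) rfl⟩)

lemma fockTerm_norm (z w : ℂ) (p : ℕ × ℕ) :
    ((‖fockTerm z w p‖ : ℝ) : ℂ) = fockTerm (‖z‖ : ℝ) (‖w‖ : ℝ) p := by
  simp only [fockTerm, norm_mul, norm_inv, norm_pow, norm_div, Complex.norm_natCast,
    Complex.norm_real, Real.norm_of_nonneg (Real.sqrt_nonneg _)]
  simp

/-- Taking norms replaces `z`, `w` by `‖z‖`, `‖w‖`. Summing along the fibres of `p.1 + 2 * p.2`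
therefore gives coefficients of another coherent state, which decay geometrically. -/
lemma summable_norm_fockTerm (z : ℂ) {w : ℂ} (hw : ‖w‖ < 1) :
    Summable fun p => ‖fockTerm z w p‖ := by
  set f : ℕ × ℕ → ℕ := fun p => p.1 + 2 * p.2
  have h1 : ∀ l, HasSum (fun p : {p // f p = l} => ‖fockTerm z w p‖)
      (fockCoeff l (‖z‖ : ℝ) (‖w‖ : ℝ)).re := by
    intro l
    have h2 := Complex.hasSum_re (hasSum_fockTerm_fiber (‖z‖ : ℝ) (‖w‖ : ℝ) l)
    refine (hasSum_subtype_iff_indicator (f := fun p => ‖fockTerm z w p‖)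
      (s := {p | f p = l})).2 (h2.congr_fun fun p => ?_)
    by_cases hp : f p = l
    · rw [Set.indicator_of_mem (s := {p | f p = l}) hp, if_pos hp, ← fockTerm_norm,
        Complex.ofReal_re]
    · rw [Set.indicator_of_notMem (s := {p | f p = l}) hp, if_neg hp, Complex.zero_re]
  rw [← (Equiv.sigmaFiberEquiv f).summable_iff]
  refine (summable_sigma_of_nonneg fun _ => norm_nonneg _).2 ⟨fun l => (h1 l).summable, ?_⟩
  have h3 : ∀ l, ∑' p : {p // f p = l}, ‖fockTerm z w p‖
      = (fockCoeff l (‖z‖ : ℝ) (‖w‖ : ℝ)).re := fun l => (h1 l).tsum_eq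
  refine Summable.of_norm_bounded (geomBounded_fockCoeff ((‖z‖ : ℝ) : ℂ)
    (w := ((‖w‖ : ℝ) : ℂ)) (by simpa using hw)).summable_norm fun l => ?_
  have h4 := h3 l
  simp only [Equiv.sigmaFiberEquiv, Equiv.coe_fn_mk] at h4 ⊢
  rw [h4]
  exact Complex.abs_re_le_norm _

lemma hasSum_fockTerm (z : ℂ) {w : ℂ} (hw : ‖w‖ < 1) :
    HasSum (coherentTerm fock z w) (∑' p : ℕ × ℕ,
      fockTerm z w p • incl ℕ (Finsupp.single (p.1 + 2 * p.2) 1)) := by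
  have h1 : Summable fun p : ℕ × ℕ =>
      fockTerm z w p • incl ℕ (Finsupp.single (p.1 + 2 * p.2) 1) :=
    Summable.of_norm ((summable_norm_fockTerm z hw).congr fun p => by
      rw [norm_smul, norm_incl_single, norm_one, mul_one])
  have h2 := hasSum_sum_antidiagonal h1.hasSum
  simpa only [← coherentTerm_fock] using h2

lemma summable_coherentTerm_fock (z : ℂ) {w : ℂ} (hw : ‖w‖ < 1) :
    Summable (coherentTerm fock z w) := (hasSum_fockTerm z hw).summable

lemma coherent_fock_apply (z : ℂ) {w : ℂ} (hw : ‖w‖ < 1) (n : ℕ) :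
    coherent fock z w n = fockCoeff n z w := by
  have h1 : Summable fun p : ℕ × ℕ =>
      fockTerm z w p • incl ℕ (Finsupp.single (p.1 + 2 * p.2) 1) :=
    Summable.of_norm ((summable_norm_fockTerm z hw).congr fun p => by
      rw [norm_smul, norm_incl_single, norm_one, mul_one])
  rw [coherent, (hasSum_fockTerm z hw).tsum_eq]
  refine (hasSum_apply h1.hasSum n).unique ((hasSum_fockTerm_fiber z w n).congr_fun fun p => ?_)
  simp only [lp.coeFn_smul, Pi.smul_apply, incl_apply, Finsupp.single_apply, smul_eq_mul, mul_ite,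
    mul_one, mul_zero]

/-- Uniqueness of power series coefficients. -/
lemma eq_zero_of_hasSum_pow_eq_zero {u : ℕ → ℂ}
    (h : ∀ z : ℂ, ‖z‖ < 1 → HasSum (fun n => z ^ n * u n) 0) (n : ℕ) : u n = 0 := by
  have h1 : HasFPowerSeriesAt (fun _ : ℂ => (0 : ℂ)) (FormalMultilinearSeries.ofScalars ℂ u) 0 := by
    rw [hasFPowerSeriesAt_iff]
    filter_upwards [Metric.ball_mem_nhds (0 : ℂ) one_pos] with z hz
    simpa using h z (by simpa using hz)
  have h2 := congrArg (fun p => FormalMultilinearSeries.coeff p n) h1.eq_zero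
  have h3 : FormalMultilinearSeries.coeff (0 : FormalMultilinearSeries ℂ ℂ ℂ) n = 0 := rfl
  simpa [h3] using h2

lemma inner_fockCoeff (z z' : ℂ) {w w' : ℂ} (hw : ‖w‖ < 1) (hw' : ‖w'‖ < 1) :
    HasSum (fun n => conj (fockCoeff n z w) * fockCoeff n z' w') (gram (1 / 4) z w z' w') := by
  have hwc : ‖conj w‖ < 1 := by rwa [Complex.norm_conj]
  have h1 : Summable fun n => conj (fockCoeff n z w) * fockCoeff n z' w' := by
    simp only [fockCoeff_conj]
    exact ((geomBounded_fockCoeff (conj z) hwc).mul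
      (geomBounded_fockCoeff z' hw')).summable_norm.of_norm
  convert h1.hasSum using 1
  simp only [fockCoeff_conj]
  rw [tsum_fockCoeff_mul_fockCoeff _ _ hwc hw', gram_eq_exp _ _ _ hw hw']
  congr 2
  push_cast
  ring

lemma fock_Kp_single (n : ℕ) : fock.Kp (Finsupp.single n 1)
    = Finsupp.single (n + 2) ((√(n + 1 : ℝ) * √((n + 1 : ℕ) + 1 : ℝ) / 2 : ℝ) : ℂ) := by
  simp only [fock, LinearMap.smul_apply, pow_two, Module.End.mul_apply, creation_single,
    Finsupp.smul_single, smul_eq_mul]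
  congr 1
  push_cast
  ring

lemma fock_Km_single (n : ℕ) : fock.Km (Finsupp.single n 1)
    = Finsupp.single (n - 2) ((√(n : ℝ) * √((n - 1 : ℕ) : ℝ) / 2 : ℝ) : ℂ) := by
  simp only [fock, LinearMap.smul_apply, pow_two, Module.End.mul_apply, annihilation_single,
    Finsupp.smul_single, smul_eq_mul]
  rw [show n - 1 - 1 = n - 2 by omega]
  congr 1
  push_cast
  ring

lemma fock_K0_single (n : ℕ) : fock.K0 (Finsupp.single n 1)
    = Finsupp.single n (((n + 1 / 2) / 2 : ℝ) : ℂ) := by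
  have h : creation (annihilation (Finsupp.single n 1)) = Finsupp.single n (n : ℂ) := by
    rw [annihilation_single, creation_single]
    cases n with
    | zero => simp
    | succ n =>
      have h1 : √((n + 1 : ℕ) : ℝ) * √(n + 1 : ℝ) = (n + 1 : ℕ) := by
        push_cast
        exact Real.mul_self_sqrt (by positivity)
      rw [Nat.add_sub_cancel, one_mul, ← Complex.ofReal_mul, h1, Complex.ofReal_natCast]
  simp only [fock, LinearMap.smul_apply, LinearMap.add_apply, Module.End.mul_apply, h,
    Module.End.one_apply, Finsupp.smul_single, smul_eq_mul, ← Finsupp.single_add]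
  congr 1
  push_cast
  ring

lemma sqrt_le_of_le_sq {x y : ℝ} (hy : 0 ≤ y) (h : x ≤ y ^ 2) : √x ≤ y :=
  Real.sqrt_le_iff.2 ⟨hy, h⟩

lemma norm_ofReal_le {x y : ℝ} (hx : 0 ≤ x) (h : x ≤ y) : ‖(x : ℂ)‖ ≤ y := by
  rwa [Complex.norm_real, Real.norm_of_nonneg hx]

/-- Linear growth in `n`, beaten by the geometric decay of the coefficients. -/
lemma norm_incl_fock_le (X : Module.End ℂ (ℕ →₀ ℂ))
    (hX : X ∈ [1, fock.a, fock.adag, fock.K0, fock.Kp, fock.Km]) (n : ℕ) :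
    ‖incl ℕ (X (Finsupp.single n 1))‖ ≤ n + 1 := by
  have hn : (0 : ℝ) ≤ n := Nat.cast_nonneg n
  have hn1 : ((n - 1 : ℕ) : ℝ) ≤ n := by exact_mod_cast Nat.sub_le n 1
  simp only [List.mem_cons, List.not_mem_nil, or_false] at hX
  rcases hX with rfl | rfl | rfl | rfl | rfl | rfl
  · rw [Module.End.one_apply, norm_incl_single, norm_one]
    linarith
  · change ‖incl ℕ (annihilation _)‖ ≤ _
    rw [annihilation_single, norm_incl_single, one_mul]
    exact norm_ofReal_le (Real.sqrt_nonneg _) (sqrt_le_of_le_sq (by linarith) (by nlinarith))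
  · change ‖incl ℕ (creation _)‖ ≤ _
    rw [creation_single, norm_incl_single, one_mul]
    exact norm_ofReal_le (Real.sqrt_nonneg _) (sqrt_le_of_le_sq (by linarith) (by nlinarith))
  · rw [fock_K0_single, norm_incl_single]
    exact norm_ofReal_le (by positivity) (by linarith)
  · rw [fock_Kp_single, norm_incl_single]
    refine norm_ofReal_le (by positivity) ?_
    rw [← Real.sqrt_mul (by positivity), div_le_iff₀ two_pos]
    push_cast
    exact sqrt_le_of_le_sq (by linarith) (by nlinarith)
  · rw [fock_Km_single, norm_incl_single]
    refine norm_ofReal_le (by positivity) ?_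
    rw [← Real.sqrt_mul (by positivity), div_le_iff₀ two_pos]
    exact sqrt_le_of_le_sq (by linarith) (by nlinarith)

lemma fockCoeff_Kp (n : ℕ) (z w : ℂ) :
    ((√(n + 1 : ℝ) * √((n + 1 : ℕ) + 1 : ℝ) / 2 : ℝ) : ℂ) * fockCoeff (n + 2) z w
      = ((√(n.factorial : ℝ))⁻¹ : ℝ) * (P (n + 2) z w / 2) := by
  have h1 := sqrt_mul_fockCoeff_succ (n + 1) z w
  have h2 : (√(n + 1 : ℝ) * (√((n + 1).factorial : ℝ))⁻¹ : ℝ) = (√(n.factorial : ℝ))⁻¹ := by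
    have h3 : (0 : ℝ) < n + 1 := by positivity
    rw [Nat.factorial_succ]
    push_cast
    rw [Real.sqrt_mul h3.le, mul_inv, mul_inv_cancel_left₀ (Real.sqrt_pos.2 h3).ne']
  rw [← h2]
  push_cast at h1 ⊢
  linear_combination ((√(n + 1 : ℝ) : ℝ) : ℂ) / 2 * h1

lemma fockCoeff_Km (n : ℕ) (z w : ℂ) :
    ((√(n : ℝ) * √((n - 1 : ℕ) : ℝ) / 2 : ℝ) : ℂ) * fockCoeff (n - 2) z w
      = ((√(n.factorial : ℝ))⁻¹ : ℝ) * (n * (n - 1) / 2 * P (n - 2) z w) := by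
  cases n with
  | zero => simp
  | succ n =>
    have h1 := sqrt_mul_fockCoeff_pred n z w
    have h2 := sqrt_mul_inv_sqrt_factorial (n + 1)
    have h2' := congrArg (fun x : ℝ => (x : ℂ)) h2
    rw [show n + 1 - 2 = n - 1 by omega]
    simp only [Nat.add_sub_cancel] at h2' ⊢
    push_cast at h1 h2' ⊢
    linear_combination ((√(n + 1 : ℝ) : ℝ) : ℂ) / 2 * h1 + n * P (n - 1) z w / 2 * h2'

lemma fockCoeff_adag (n : ℕ) (z w : ℂ) :
    ((√(n + 1 : ℝ) : ℝ) : ℂ) * fockCoeff (n + 1) z w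
      = z * fockCoeff n z w + w * (((√(n : ℝ) : ℝ) : ℂ) * fockCoeff (n - 1) z w) := by
  rw [fockCoeff_succ]; ring

lemma fockCoeff_K0_identity (n : ℕ) (z w : ℂ) :
    ((((n + 1 / 2) / 2 : ℝ)) : ℂ) * fockCoeff n z w
      = 1 / 4 * fockCoeff n z w + z / 2 * (((√(n : ℝ) : ℝ) : ℂ) * fockCoeff (n - 1) z w)
        + w * (((√(n : ℝ) * √((n - 1 : ℕ) : ℝ) / 2 : ℝ) : ℂ) * fockCoeff (n - 2) z w) := by
  rw [fockCoeff_Km, sqrt_mul_fockCoeff_pred, fockCoeff]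
  push_cast
  linear_combination ((√(n.factorial : ℝ) : ℝ) : ℂ)⁻¹ / 2 * mul_P n z w

lemma fockCoeff_Kp_identity (n : ℕ) (z w : ℂ) :
    ((√(n + 1 : ℝ) * √((n + 1 : ℕ) + 1 : ℝ) / 2 : ℝ) : ℂ) * fockCoeff (n + 2) z w
      = (z ^ 2 / 2 + 1 / 2 * w) * fockCoeff n z w
        + z * w * (((√(n : ℝ) : ℝ) : ℂ) * fockCoeff (n - 1) z w)
        + w ^ 2 * (((√(n : ℝ) * √((n - 1 : ℕ) : ℝ) / 2 : ℝ) : ℂ) * fockCoeff (n - 2) z w) := by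
  rw [fockCoeff_Km, fockCoeff_Kp, sqrt_mul_fockCoeff_pred, fockCoeff, P_add_two, P_succ]
  push_cast
  linear_combination ((√(n.factorial : ℝ) : ℝ) : ℂ)⁻¹ * w / 2 * mul_P n z w

lemma hasDerivAt_fockCoeff (n : ℕ) {z w : ℝ → ℂ} {z' w' : ℂ} (hz : HasDerivAt z z' 0)
    (hw : HasDerivAt w w' 0) : HasDerivAt (fun s => fockCoeff n (z s) (w s))
      (z' * (((√(n : ℝ) : ℝ) : ℂ) * fockCoeff (n - 1) (z 0) (w 0))
        + w' * (((√(n : ℝ) * √((n - 1 : ℕ) : ℝ) / 2 : ℝ) : ℂ) * fockCoeff (n - 2) (z 0) (w 0)))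
      0 := by
  refine ((hasDerivAt_P n hz hw).const_mul (((√(n.factorial : ℝ))⁻¹ : ℝ) : ℂ)).congr_deriv ?_
  rw [fockCoeff_Km, sqrt_mul_fockCoeff_pred]
  ring

lemma isCoherent_fock : IsCoherent fock (1 / 4) where
  inner z w z' w' hw hw' := by
    rw [lp.inner_eq_tsum, ← (inner_fockCoeff z z' hw hw').tsum_eq]
    simp only [coherent_fock_apply _ hw, coherent_fock_apply _ hw', RCLike.inner_apply]
    congr 1
    funext n
    rw [mul_comm]
  total v hv := by
    -- The states with `w = 0` already suffice: their coordinates are `zⁿ / √n!` and a vanishing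
    -- power series has vanishing coefficients.
    have h1 : ∀ n, ((√(n.factorial : ℝ))⁻¹ : ℝ) * v n = 0 := by
      refine eq_zero_of_hasSum_pow_eq_zero fun z _ => ?_
      have h2 := lp.hasSum_inner (𝕜 := ℂ) (coherent fock (conj z) 0) v
      rw [hv (conj z) 0 (by simp)] at h2
      refine h2.congr_fun fun n => ?_
      rw [coherent_fock_apply _ (by simp), RCLike.inner_apply, fockCoeff_conj, Complex.conj_conj,
        map_zero, fockCoeff, P_zero_right]
      ring
    ext n
    have h3 : (0 : ℝ) < √(n.factorial : ℝ) := Real.sqrt_pos.2 (by exact_mod_cast n.factorial_pos)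
    have h4 := h1 n
    rw [mul_eq_zero] at h4
    refine h4.resolve_left ?_
    exact_mod_cast (inv_pos.2 h3).ne'
  summable X hX z w hw := by
    refine Summable.of_nonneg_of_le (fun n => by positivity) (fun n => ?_)
      (geomBounded_fockCoeff z hw).summable_succ_mul
    rw [coherent_fock_apply z hw, mul_comm]
    gcongr
    exact norm_incl_fock_le X hX n
  adag n z w hw := by
    change ⟪incl ℕ (creation _), _⟫_ℂ = _ + _ * ⟪incl ℕ (annihilation _), _⟫_ℂ
    simp only [creation_single, annihilation_single, inner_incl_single, one_mul,
      Complex.conj_ofReal, coherent_fock_apply z hw, fockCoeff_adag]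
  K0 n z w hw := by
    change _ = _ + _ * ⟪incl ℕ (annihilation _), _⟫_ℂ + _
    simp only [annihilation_single, fock_K0_single, fock_Km_single, inner_incl_single, one_mul,
      Complex.conj_ofReal, coherent_fock_apply z hw, fockCoeff_K0_identity]
    push_cast
    ring
  Kp n z w hw := by
    change _ = _ + _ * ⟪incl ℕ (annihilation _), _⟫_ℂ + _
    simp only [annihilation_single, fock_Kp_single, fock_Km_single, inner_incl_single, one_mul,
      Complex.conj_ofReal, coherent_fock_apply z hw, fockCoeff_Kp_identity]
    push_cast
    ring
  hasDerivAt n z w z' w' hz hw hws := by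
    change HasDerivAt _ (_ * ⟪incl ℕ (annihilation _), _⟫_ℂ + _) _
    simp only [annihilation_single, fock_Km_single, inner_incl_single, one_mul,
      Complex.conj_ofReal, coherent_fock_apply _ (hws _)]
    exact hasDerivAt_fockCoeff n hz hw

/-! ### The reproducing kernel Hilbert space -/

lemma inner_coherent_fock_conj (x y : Domain) :
    ⟪coherent fock (conj x.1) (conj (x.2 : ℂ)), coherent fock (conj y.1) (conj (y.2 : ℂ))⟫_ℂ
      = bergmanKernel (1 / 4) x y := by
  rw [bergmanKernel_eq_gram]
  exact isCoherent_fock.inner _ _ _ _ (by simpa using x.2.norm_lt_one)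
    (by simpa using y.2.norm_lt_one)

lemma inner_coherent_fock_single (n : ℕ) (x : Domain) :
    ⟪coherent fock (conj x.1) (conj (x.2 : ℂ)), incl ℕ (Finsupp.single n 1)⟫_ℂ
      = ((√(n.factorial : ℝ))⁻¹ : ℝ) * P n x.1 (x.2 : ℂ) := by
  rw [← inner_conj_symm, inner_incl_single,
    coherent_fock_apply _ (by simpa using x.2.norm_lt_one), map_one, one_mul, fockCoeff_conj,
    Complex.conj_conj, Complex.conj_conj, fockCoeff]

lemma isTotal_coherent_fock_conj :
    IsTotal fun x : Domain => coherent fock (conj x.1) (conj (x.2 : ℂ)) := by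
  intro v hv
  refine isCoherent_fock.total v fun z w hw => ?_
  have := hv (conj z, Complex.UnitDisc.mk (conj w) (by simpa using hw))
  simpa using this

/-- The Fock space as a space of functions on `ℂ × 𝔻`. -/
abbrev fockRKHS : RKHS ℂ (Hilb ℕ) Domain ℂ where
  coeCLM := ContinuousLinearMap.pi fun x : Domain =>
    innerSL ℂ (coherent fock (conj x.1) (conj (x.2 : ℂ)))
  coeCLM_injective := by
    refine (injective_iff_map_eq_zero _).2 fun v hv => ?_
    exact isTotal_coherent_fock_conj v fun x => congrFun hv x

/-- The matrix is the reproducing kernel of `fockRKHS`, whose kernel functions are the coherent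
states at conjugated points. -/
lemma posSemidef_kernelMatrix : (kernelMatrix (1 / 4)).PosSemidef := by
  let _ := fockRKHS
  have h : RKHS.kernel (Hilb ℕ) = kernelMatrix (1 / 4) := by
    have h1 : ∀ (y : Domain) (v : ℂ), RKHS.kerFun (Hilb ℕ) y v
        = v • coherent fock (conj y.1) (conj (y.2 : ℂ)) := by
      intro y v
      refine ext_inner_right ℂ fun f => ?_
      rw [RKHS.kerFun_inner, inner_smul_left, RCLike.inner_apply, mul_comm]
      rfl
    ext x y : 2
    rw [← RKHS.kerFun_apply, h1]
    change ⟪coherent fock (conj x.1) (conj (x.2 : ℂ)), _⟫_ℂ = _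
    rw [inner_smul_right, inner_coherent_fock_conj, kernelMatrix]
    simp
  rw [← h]
  exact RKHS.posSemidef_kernel _

/-- Kernel functions are total, as a function orthogonal to all of them vanishes everywhere. Their
Gram matrix is that of the coherent states, so a unitary onto the Fock space matches the two
families; it serves as the coordinate map of the basis. -/
lemma exists_hilbertBasis_of_kernel (H : Type*) [NormedAddCommGroup H] [InnerProductSpace ℂ H]
    [CompleteSpace H] [RKHS ℂ H Domain ℂ] (hK : RKHS.kernel H = kernelMatrix (1 / 4)) :
    ∃ B : HilbertBasis ℕ ℂ H, ∀ (n : ℕ) (x : Domain),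
      (B n) x = ((√(n.factorial : ℝ))⁻¹ : ℝ) * P n x.1 (x.2 : ℂ) := by
  have htot : IsTotal fun x : Domain => RKHS.kerFun H x 1 := by
    intro v hv
    refine RKHS.ext fun x => ?_
    have := hv x
    rw [RKHS.kerFun_inner, RCLike.inner_apply, map_one, mul_one] at this
    rw [this]
    simp
  obtain ⟨T, hT⟩ := htot.exists_isometryEquiv isTotal_coherent_fock_conj fun x y => by
    rw [inner_coherent_fock_conj, RKHS.kerFun_inner, RKHS.kerFun_apply, hK, kernelMatrix]
    simp
  refine ⟨HilbertBasis.ofRepr T, fun n x => ?_⟩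
  rw [← inner_coherent_fock_single, ← hT x, incl_single, one_smul]
  have h1 : (HilbertBasis.ofRepr T) n = T.symm (lp.single 2 n (1 : ℂ)) :=
    (HilbertBasis.repr_symm_single _ n).symm
  rw [← T.apply_symm_apply (lp.single 2 n (1 : ℂ)), T.inner_map_map, RKHS.kerFun_inner, h1,
    RCLike.inner_apply, map_one, mul_one]

/-! ### The positive discrete series -/

/-- The weights `((2k')ₘ / m!)^{1/2}`. -/
def discWeight (k' : ℝ) : ℕ → ℝ
  | 0 => 1
  | m + 1 => √((m + 2 * k') / (m + 1)) * discWeight k' m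

lemma discWeight_pos {k' : ℝ} (hk : 0 < k') (m : ℕ) : 0 < discWeight k' m := by
  induction m with
  | zero => simp [discWeight]
  | succ m ih =>
    rw [discWeight]
    have : 0 < √((m + 2 * k') / (m + 1) : ℝ) := Real.sqrt_pos.2 (by positivity)
    positivity

/-- The coefficients of the coherent states of the positive discrete series. -/
def discCoeff (k' : ℝ) (m : ℕ) (w : ℂ) : ℂ := discWeight k' m * w ^ m

@[simp] lemma discCoeff_zero (k' : ℝ) (w : ℂ) : discCoeff k' 0 w = 1 := by
  simp [discCoeff, discWeight]

lemma discCoeff_conj (k' : ℝ) (m : ℕ) (w : ℂ) :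
    conj (discCoeff k' m w) = discCoeff k' m (conj w) := by
  rw [discCoeff, discCoeff, map_mul, Complex.conj_ofReal, map_pow]

lemma norm_discCoeff {k' : ℝ} (hk : 0 < k') (m : ℕ) (w : ℂ) :
    ‖discCoeff k' m w‖ = discWeight k' m * ‖w‖ ^ m := by
  rw [discCoeff, norm_mul, norm_pow, Complex.norm_real,
    Real.norm_of_nonneg (discWeight_pos hk m).le]

/-- Consecutive coefficients have squared ratio `(m + 2k') / (m + 1) * ‖w‖²`, which tends to `‖w‖² <
r²`. -/
lemma geomBounded_discCoeff {k' : ℝ} (hk : 0 < k') {w : ℂ} (hw : ‖w‖ < 1) :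
    GeomBounded fun m => discCoeff k' m w := by
  set ρ := ‖w‖ with hρ
  have hρ0 : 0 ≤ ρ := norm_nonneg w
  set r : ℝ := √((1 + ρ ^ 2) / 2) with hr
  have hr2 : r ^ 2 = (1 + ρ ^ 2) / 2 := Real.sq_sqrt (by positivity)
  have hr0 : 0 < r := Real.sqrt_pos.2 (by positivity)
  have hr1 : r < 1 := by nlinarith
  have hd : 0 < r ^ 2 - ρ ^ 2 := by rw [hr2]; nlinarith
  -- For `m ≥ N` this yields `(m + 2k') ρ² ≤ m r²`, so the ratio is at most `r`; `S` bounds the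
  -- terms up to `N`.
  obtain ⟨N, hN⟩ := exists_nat_gt (2 * k' / (r ^ 2 - ρ ^ 2))
  rw [div_lt_iff₀ hd] at hN
  have hpos : ∀ m, 0 ≤ discWeight k' m * ρ ^ m := fun m =>
    mul_nonneg (discWeight_pos hk m).le (by positivity)
  have hrN : 0 < r ^ N := by positivity
  set S := ∑ i ∈ Finset.range (N + 1), discWeight k' i * ρ ^ i
  have hS : 0 ≤ S := Finset.sum_nonneg fun i _ => hpos i
  refine ⟨S / r ^ N, r, by positivity, hr0.le, hr1, fun m => ?_⟩
  rw [norm_discCoeff hk]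
  have hsmall : ∀ m ≤ N, discWeight k' m * ρ ^ m ≤ S / r ^ N * r ^ m := by
    intro m hm
    have h1 : discWeight k' m * ρ ^ m ≤ S :=
      Finset.single_le_sum (f := fun i => discWeight k' i * ρ ^ i) (fun i _ => hpos i)
        (Finset.mem_range.2 (by omega))
    have h2 : 1 ≤ r ^ m / r ^ N := (one_le_div hrN).2 (pow_le_pow_of_le_one hr0.le hr1.le hm)
    calc _ ≤ S * 1 := by rw [mul_one]; exact h1
      _ ≤ S * (r ^ m / r ^ N) := by gcongr
      _ = _ := by ring
  induction m with
  | zero => exact hsmall 0 (by omega)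
  | succ m ih =>
    by_cases hm : m + 1 ≤ N
    · exact hsmall _ hm
    have hmN : (N : ℝ) ≤ m := by exact_mod_cast (by omega : N ≤ m)
    have h1 : √((m + 2 * k') / (m + 1) : ℝ) * ρ ≤ r := by
      rw [← Real.sqrt_sq hρ0, ← Real.sqrt_mul (by positivity)]
      refine sqrt_le_of_le_sq hr0.le ?_
      rw [div_mul_eq_mul_div, div_le_iff₀ (by positivity)]
      have h2 : (N : ℝ) * (r ^ 2 - ρ ^ 2) ≤ m * (r ^ 2 - ρ ^ 2) := by gcongr
      have h3 : 2 * k' * ρ ^ 2 ≤ 2 * k' * 1 := by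
        gcongr
        nlinarith
      nlinarith [sq_nonneg r]
    rw [discWeight]
    calc _ = (√((m + 2 * k') / (m + 1) : ℝ) * ρ) * (discWeight k' m * ρ ^ m) := by ring
      _ ≤ r * (S / r ^ N * r ^ m) := mul_le_mul h1 ih (hpos m) hr0.le
      _ = _ := by ring

lemma discWeight_sq_succ {k' : ℝ} (hk : 0 < k') (m : ℕ) :
    ((m : ℝ) + 1) * discWeight k' (m + 1) ^ 2 = (m + 2 * k') * discWeight k' m ^ 2 := by
  rw [discWeight, mul_pow, Real.sq_sqrt (by positivity)]
  field_simp

lemma sqrt_mul_discWeight {k' : ℝ} (hk : 0 < k') (m : ℕ) :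
    √((m + 1 : ℝ) * (m + 2 * k')) * discWeight k' m = (m + 1) * discWeight k' (m + 1) := by
  have h1 : (0 : ℝ) < m + 1 := by positivity
  have h2 : (m + 1 : ℝ) * (m + 2 * k') = (m + 1) ^ 2 * ((m + 2 * k') / (m + 1)) := by
    field_simp
  rw [discWeight, h2, Real.sqrt_mul (by positivity), Real.sqrt_sq h1.le]
  ring

lemma inner_discCoeff {k' : ℝ} (hk : 0 < k') {w w' : ℂ} (hw : ‖w‖ < 1) (hw' : ‖w'‖ < 1) :
    HasSum (fun m => conj (discCoeff k' m w) * discCoeff k' m w')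
      (Complex.exp (-2 * k' * Complex.log (1 - conj w * w'))) := by
  have hwc : ‖conj w‖ < 1 := by rwa [Complex.norm_conj]
  simp only [discCoeff_conj]
  have h1 := (geomBounded_discCoeff hk hwc).mul (geomBounded_discCoeff hk hw')
  have h2 := tsum_binomial h1 (by simp) (c := 2 * k') (norm_conj_mul_lt hw hw') fun m => by
    have h3 := congrArg (fun x : ℝ => (x : ℂ)) (discWeight_sq_succ hk m)
    simp only [discCoeff]
    push_cast at h3
    linear_combination (conj w * w') ^ (m + 1) * h3
  have h3 := h1.summable_norm.of_norm.hasSum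
  rw [h2] at h3
  rwa [show (-2 * k' : ℂ) = -(2 * k') by ring]

lemma discCoeff_Km {k' : ℝ} (hk : 0 < k') (m : ℕ) (w : ℂ) :
    ((√((m : ℝ) * (m + 2 * k' - 1)) : ℝ) : ℂ) * discCoeff k' (m - 1) w
      = m * discWeight k' m * w ^ (m - 1) := by
  cases m with
  | zero => simp
  | succ m =>
    have h1 := congrArg (fun x : ℝ => (x : ℂ)) (sqrt_mul_discWeight hk m)
    have h2 : (((m + 1 : ℕ) : ℝ) + 2 * k' - 1) = m + 2 * k' := by push_cast; ring
    rw [h2, Nat.add_sub_cancel, discCoeff]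
    push_cast at h1 ⊢
    linear_combination w ^ m * h1

lemma mul_discCoeff_Km {k' : ℝ} (hk : 0 < k') (m : ℕ) (w : ℂ) :
    w * (((√((m : ℝ) * (m + 2 * k' - 1)) : ℝ) : ℂ) * discCoeff k' (m - 1) w)
      = m * discCoeff k' m w := by
  rw [discCoeff_Km hk, discCoeff]
  cases m with
  | zero => simp
  | succ m => rw [Nat.add_sub_cancel]; ring

lemma discCoeff_Kp_identity {k' : ℝ} (hk : 0 < k') (m : ℕ) (w : ℂ) :
    ((√((m + 1 : ℝ) * (m + 2 * k')) : ℝ) : ℂ) * discCoeff k' (m + 1) w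
      = 2 * k' * w * discCoeff k' m w
        + w ^ 2 * (((√((m : ℝ) * (m + 2 * k' - 1)) : ℝ) : ℂ) * discCoeff k' (m - 1) w) := by
  have h1 := mul_discCoeff_Km hk m w
  have h2 : √((m + 1 : ℝ) * (m + 2 * k')) * discWeight k' (m + 1)
      = (m + 2 * k') * discWeight k' m := by
    have h3 := sqrt_mul_discWeight hk m
    have h4 := Real.sq_sqrt (show 0 ≤ (m + 1 : ℝ) * (m + 2 * k') by positivity)
    have h5 : (0 : ℝ) < m + 1 := by positivity
    apply mul_left_cancel₀ h5.ne'
    linear_combination (-√((m + 1 : ℝ) * (m + 2 * k'))) * h3 + discWeight k' m * h4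
  have h2' := congrArg (fun x : ℝ => (x : ℂ)) h2
  have h6 : discCoeff k' m w = discWeight k' m * w ^ m := rfl
  rw [discCoeff]
  push_cast at h2'
  linear_combination w ^ (m + 1) * h2' - w * h1 - (m + 2 * k') * w * h6

lemma hasDerivAt_discCoeff {k' : ℝ} (hk : 0 < k') (m : ℕ) {w : ℝ → ℂ} {w' : ℂ}
    (hw : HasDerivAt w w' 0) : HasDerivAt (fun s => discCoeff k' m (w s))
      (w' * (((√((m : ℝ) * (m + 2 * k' - 1)) : ℝ) : ℂ) * discCoeff k' (m - 1) (w 0))) 0 := by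
  refine ((hw.fun_pow m).const_mul (discWeight k' m : ℂ)).congr_deriv ?_
  rw [discCoeff_Km hk]
  ring

lemma discreteKp_pow_single_zero {k' : ℝ} (hk : 0 < k') (w : ℂ) (m : ℕ) :
    ((w • discreteKp k') ^ m) (Finsupp.single 0 1)
      = Finsupp.single m ((m.factorial : ℂ) * discCoeff k' m w) := by
  induction m with
  | zero => simp
  | succ m ih =>
    have h1 := congrArg (fun x : ℝ => (x : ℂ)) (sqrt_mul_discWeight hk m)
    rw [pow_succ', Module.End.mul_apply, ih, LinearMap.smul_apply, discreteKp, onBasis_single,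
      Finsupp.smul_single, Finsupp.smul_single]
    congr 1
    simp only [smul_eq_mul, discCoeff, Nat.factorial_succ]
    push_cast at h1 ⊢
    linear_combination w ^ (m + 1) * m.factorial * h1

/-! ### Tensor products -/

/-- The pure tensor of two finite vectors. -/
def pureTensor (u v : ℕ →₀ ℂ) : ℕ × ℕ →₀ ℂ := finsuppTensorFinsupp' ℂ ℕ ℕ (u ⊗ₜ v)

lemma pureTensor_apply (u v : ℕ →₀ ℂ) (p : ℕ × ℕ) : pureTensor u v p = u p.1 * v p.2 :=
  finsuppTensorFinsupp'_apply_apply ℂ ℕ ℕ u v p.1 p.2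

lemma pureTensor_single (n m : ℕ) (c d : ℂ) :
    pureTensor (Finsupp.single n c) (Finsupp.single m d) = Finsupp.single (n, m) (c * d) :=
  finsuppTensorFinsupp'_single_tmul_single ℂ ℕ ℕ n m c d

lemma pureTensor_add_left (u u' v : ℕ →₀ ℂ) :
    pureTensor (u + u') v = pureTensor u v + pureTensor u' v := by
  simp [pureTensor, TensorProduct.add_tmul]

lemma tens_pureTensor (A B : Module.End ℂ (ℕ →₀ ℂ)) (u v : ℕ →₀ ℂ) :
    tens A B (pureTensor u v) = pureTensor (A u) (B v) := by
  simp [tens, pureTensor, LinearEquiv.conj_apply]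

lemma tens_mul (A B A' B' : Module.End ℂ (ℕ →₀ ℂ)) :
    tens A B * tens A' B' = tens (A * A') (B * B') := by
  refine Finsupp.lhom_ext fun p c => ?_
  rw [← mul_one c, ← pureTensor_single, Module.End.mul_apply, tens_pureTensor,
    tens_pureTensor, tens_pureTensor]
  rfl

lemma tens_pow_left_pureTensor (A : Module.End ℂ (ℕ →₀ ℂ)) (n : ℕ) (u v : ℕ →₀ ℂ) :
    (tens A 1 ^ n) (pureTensor u v) = pureTensor ((A ^ n) u) v := by
  induction n with
  | zero => simp
  | succ n ih => rw [pow_succ', Module.End.mul_apply, ih, tens_pureTensor, pow_succ']; rfl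

lemma tens_pow_right_pureTensor (B : Module.End ℂ (ℕ →₀ ℂ)) (n : ℕ) (u v : ℕ →₀ ℂ) :
    (tens 1 B ^ n) (pureTensor u v) = pureTensor u ((B ^ n) v) := by
  induction n with
  | zero => simp
  | succ n ih => rw [pow_succ', Module.End.mul_apply, ih, tens_pureTensor, pow_succ']; rfl

lemma isTotal_single (ι : Type) [DecidableEq ι] :
    IsTotal fun i : ι => (lp.single 2 i (1 : ℂ) : Hilb ι) := by
  intro v hv
  ext i
  simpa [lp.inner_single_left] using hv i

/-- The embedding `φₙ ↦ φₙ ⊗ φ_{k'm}` sends an orthonormal basis to an orthonormal family, hence is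
isometric. -/
lemma norm_incl_pureTensor_single (u : ℕ →₀ ℂ) (m : ℕ) (c : ℂ) :
    ‖incl (ℕ × ℕ) (pureTensor u (Finsupp.single m c))‖ = ‖c‖ * ‖incl ℕ u‖ := by
  obtain ⟨J, hJ⟩ := (isTotal_single ℕ).exists_isometry
    (v := fun n => (lp.single 2 (n, m) (1 : ℂ) : Hilb (ℕ × ℕ))) fun x y => by
      simp [lp.inner_single_left, lp.single_apply, Pi.single_apply]
  have h1 : incl (ℕ × ℕ) (pureTensor u (Finsupp.single m c)) = c • J (incl ℕ u) := by
    induction u using Finsupp.induction_linear with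
    | zero => simp [pureTensor]
    | add f g hf hg => rw [pureTensor_add_left, map_add, map_add, map_add, hf, hg, smul_add]
    | single n d =>
      rw [pureTensor_single, incl_single, incl_single, map_smul, hJ, smul_smul, mul_comm]
  rw [h1, norm_smul, J.norm_map]

lemma tens_add_left (A A' B : Module.End ℂ (ℕ →₀ ℂ)) : tens (A + A') B = tens A B + tens A' B := by
  simp [tens, TensorProduct.map_add_left]

lemma tens_smul_left (c : ℂ) (A B : Module.End ℂ (ℕ →₀ ℂ)) : tens (c • A) B = c • tens A B := by
  simp [tens, TensorProduct.map_smul_left]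

lemma tens_smul_right (c : ℂ) (A B : Module.End ℂ (ℕ →₀ ℂ)) : tens A (c • B) = c • tens A B := by
  simp [tens, TensorProduct.map_smul_right]

/-- The summands of the double series of the coherent states of the tensor product. -/
def tensorTerm (k' : ℝ) (z w : ℂ) (p : ℕ × ℕ) : Hilb (ℕ × ℕ) :=
  (p.1.factorial : ℂ)⁻¹ • incl (ℕ × ℕ) (pureTensor (((z • fock.adag + w • fock.Kp) ^ p.1) fock.e0)
    (Finsupp.single p.2 (discCoeff k' p.2 w)))

/-- The double series of the coherent states of the tensor product. -/
lemma coherentTerm_fockDiscrete {k' : ℝ} (hk : 0 < k') (z w : ℂ) (n : ℕ) :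
    coherentTerm (fockDiscrete k') z w n
      = ∑ p ∈ Finset.HasAntidiagonal.antidiagonal n, tensorTerm k' z w p := by
  simp only [tensorTerm]
  set A := z • fock.adag + w • fock.Kp with hA
  -- The two parts act on different tensor factors, so the exponential factorizes.
  have hc : Commute (tens A 1) (tens 1 (w • discreteKp k')) := by
    rw [commute_iff_eq, tens_mul, tens_mul, mul_one, one_mul, mul_one, one_mul]
  rw [coherentTerm_eq_sum (fockDiscrete k') z w (A := tens A 1)
    (B := tens 1 (w • discreteKp k')) ?_ hc]
  · refine Finset.sum_congr rfl fun p _ => ?_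
    have h0 : (fockDiscrete k').e0 = pureTensor (Finsupp.single 0 1) (Finsupp.single 0 1) := by
      rw [pureTensor_single, mul_one]; rfl
    have h1 : (p.2.factorial : ℂ) ≠ 0 := by exact_mod_cast p.2.factorial_ne_zero
    have h2 : ∀ u, pureTensor u (Finsupp.single p.2 ((p.2.factorial : ℂ) * discCoeff k' p.2 w))
        = (p.2.factorial : ℂ) • pureTensor u (Finsupp.single p.2 (discCoeff k' p.2 w)) := by
      intro u
      rw [← smul_eq_mul, ← Finsupp.smul_single, pureTensor, TensorProduct.tmul_smul, map_smul]
      rfl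
    rw [h0, tens_pow_right_pureTensor, tens_pow_left_pureTensor,
      discreteKp_pow_single_zero hk, h2, map_smul, smul_smul, mul_assoc,
      inv_mul_cancel₀ h1, mul_one]
    rfl
  · rw [hA, tens_add_left, tens_smul_left, tens_smul_left, tens_smul_right]
    simp only [fockDiscrete, smul_add, add_assoc]
    rfl

lemma summable_coherentTerm_norm_fock (z : ℂ) {w : ℂ} (hw : ‖w‖ < 1) :
    Summable fun n => ‖coherentTerm fock z w n‖ := by
  have h1 := summable_sum_norm_antidiagonal (summable_norm_fockTerm z hw)
  refine Summable.of_nonneg_of_le (fun n => norm_nonneg _) (fun n => ?_) h1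
  rw [coherentTerm_fock]
  refine (norm_sum_le _ _).trans (Finset.sum_le_sum fun p _ => ?_)
  rw [norm_smul, norm_incl_single, norm_one, mul_one]

lemma summable_tensorTerm {k' : ℝ} (hk : 0 < k') (z : ℂ) {w : ℂ} (hw : ‖w‖ < 1) :
    Summable (tensorTerm k' z w) := by
  refine Summable.of_norm (((summable_coherentTerm_norm_fock z hw).mul_of_nonneg
    (geomBounded_discCoeff hk hw).summable_norm (fun _ => norm_nonneg _)
    fun _ => norm_nonneg _).congr fun p => ?_)
  rw [tensorTerm, norm_smul, norm_incl_pureTensor_single, coherentTerm, norm_smul]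
  ring

lemma hasSum_coherentTerm_fockDiscrete {k' : ℝ} (hk : 0 < k') (z : ℂ) {w : ℂ} (hw : ‖w‖ < 1) :
    HasSum (coherentTerm (fockDiscrete k') z w) (∑' p, tensorTerm k' z w p) := by
  have h1 := hasSum_sum_antidiagonal (summable_tensorTerm hk z hw).hasSum
  simpa only [← coherentTerm_fockDiscrete hk] using h1

lemma tensorTerm_apply (k' : ℝ) (z w : ℂ) (x p : ℕ × ℕ) : tensorTerm k' z w x p
    = coherentTerm fock z w x.1 p.1 * Finsupp.single x.2 (discCoeff k' x.2 w) p.2 := by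
  rw [tensorTerm, coherentTerm, lp.coeFn_smul, lp.coeFn_smul, Pi.smul_apply, Pi.smul_apply,
    incl_apply, incl_apply, pureTensor_apply, smul_eq_mul, smul_eq_mul, mul_assoc]

lemma hasSum_single_apply (f : ℕ → ℂ) (n : ℕ) :
    HasSum (fun m => Finsupp.single m (f m) n) (f n) := by
  have h := hasSum_single (f := fun m => Finsupp.single m (f m) n) n
    (fun m hm => Finsupp.single_eq_of_ne hm.symm)
  simpa using h

lemma tsum_tensorTerm_apply {k' : ℝ} (hk : 0 < k') (z : ℂ) {w : ℂ} (hw : ‖w‖ < 1) (p : ℕ × ℕ) :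
    (∑' x, tensorTerm k' z w x : Hilb (ℕ × ℕ)) p = fockCoeff p.1 z w * discCoeff k' p.2 w := by
  have h1 := hasSum_apply (summable_tensorTerm hk z hw).hasSum p
  have h2 : HasSum (fun a => coherentTerm fock z w a p.1) (fockCoeff p.1 z w) := by
    rw [← coherent_fock_apply z hw]
    exact hasSum_apply (summable_coherentTerm_fock z hw).hasSum p.1
  have h3 := hasSum_single_apply (fun m => discCoeff k' m w) p.2
  simp only [tensorTerm_apply] at h1
  have h4 := h2.mul h3 h1.summable
  exact h1.unique h4

lemma coherent_fockDiscrete {k' : ℝ} (hk : 0 < k') (z : ℂ) {w : ℂ} (hw : ‖w‖ < 1) :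
    coherent (fockDiscrete k') z w = ∑' p, tensorTerm k' z w p :=
  (hasSum_coherentTerm_fockDiscrete hk z hw).tsum_eq

lemma coherent_fockDiscrete_apply {k' : ℝ} (hk : 0 < k') (z : ℂ) {w : ℂ} (hw : ‖w‖ < 1)
    (p : ℕ × ℕ) :
    coherent (fockDiscrete k') z w p = fockCoeff p.1 z w * discCoeff k' p.2 w := by
  have := tsum_tensorTerm_apply hk z hw p
  rw [coherent_fockDiscrete hk z hw, this]

/-! ### Totality of the coherent states of the tensor product. -/

section Total

open Filter Topology

lemma continuous_fockCoeff_right (n : ℕ) (z : ℂ) : Continuous fun w => fockCoeff n z w := by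
  unfold fockCoeff P
  fun_prop

/-- The double series of the coherent states, divided by `w ^ M` and without the terms of degree
less than `M`. -/
def discTail (k' : ℝ) (v : ℕ × ℕ → ℂ) (M : ℕ) (z w : ℂ) (p : ℕ × ℕ) : ℂ :=
  if p.2 < M then 0 else fockCoeff p.1 z w * (discWeight k' p.2 * w ^ (p.2 - M)) * v p

lemma summable_mul_of_summable {f g : ℕ → ℝ} (hf : Summable f) (hg : Summable g)
    (hf0 : ∀ n, 0 ≤ f n) (hg0 : ∀ n, 0 ≤ g n) : Summable fun p : ℕ × ℕ => f p.1 * g p.2 :=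
  hf.mul_of_nonneg hg hf0 hg0

lemma summable_geometric_mul_discCoeff {k' : ℝ} (hk : 0 < k') {C r B : ℝ} (hC : 0 ≤ C)
    (hB : 0 ≤ B) (hr0 : 0 ≤ r) (hr1 : r < 1) : Summable fun p : ℕ × ℕ =>
      (C * r ^ p.1) * (‖discCoeff k' p.2 (1 / 2)‖ * B) := by
  have h2 : ‖(1 / 2 : ℂ)‖ < 1 := by norm_num
  have h3 := (summable_geometric_of_lt_one hr0 hr1).mul_left C
  have h4 := ((geomBounded_discCoeff hk h2).summable_norm).mul_right B
  exact summable_mul_of_summable h3 h4 (fun _ => by positivity) (fun _ => by positivity)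

/-- A majorant independent of `w`, for passing to the limit `w → 0`. The factor `2 ^ M` pays for the
division by `w ^ M`. -/
lemma exists_norm_discTail_le {k' : ℝ} (hk : 0 < k') {v : ℕ × ℕ → ℂ} {B : ℝ}
    (hB : ∀ p, ‖v p‖ ≤ B) (M : ℕ) (z : ℂ) : ∃ bound : ℕ × ℕ → ℝ, Summable bound ∧
      ∀ w : ℂ, ‖w‖ ≤ 1 / 2 → ∀ p, ‖discTail k' v M z w p‖ ≤ bound p := by
  have hB0 : 0 ≤ B := (norm_nonneg _).trans (hB 0)
  have h2 : ‖(1 / 2 : ℂ)‖ = 1 / 2 := by norm_num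
  obtain ⟨C, r, hC, hr0, hr1, hCr⟩ := exists_norm_fockCoeff_le ‖z‖ (ρ := 1 / 2) (by norm_num)
    (by norm_num)
  refine ⟨fun p => (C * r ^ p.1) * (‖discCoeff k' p.2 (1 / 2)‖ * (2 ^ M * B)),
    summable_geometric_mul_discCoeff hk hC (by positivity) hr0 hr1, fun w hw p => ?_⟩
  by_cases hp : p.2 < M
  · rw [discTail, if_pos hp, norm_zero]
    positivity
  have hd := discWeight_pos hk p.2
  have h1 : ‖w‖ ^ (p.2 - M) ≤ (1 / 2) ^ p.2 * 2 ^ M := by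
    calc ‖w‖ ^ (p.2 - M) ≤ (1 / 2) ^ (p.2 - M) := by gcongr
      _ = (1 / 2) ^ (p.2 - M) * ((1 / 2) ^ M * 2 ^ M) := by rw [← mul_pow]; norm_num
      _ = _ := by rw [← mul_assoc, ← pow_add, Nat.sub_add_cancel (not_lt.1 hp)]
  beta_reduce
  rw [discTail, if_neg hp, norm_mul, norm_mul, norm_mul, norm_pow, Complex.norm_real,
    Real.norm_of_nonneg hd.le, norm_discCoeff hk, h2]
  calc _ ≤ (C * r ^ p.1) * (discWeight k' p.2 * ((1 / 2) ^ p.2 * 2 ^ M)) * B := by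
        gcongr
        · exact hCr _ _ _ le_rfl hw
        · exact hB p
    _ = _ := by ring

lemma continuous_discTail (k' : ℝ) (v : ℕ × ℕ → ℂ) (M : ℕ) (z : ℂ) (p : ℕ × ℕ) :
    Continuous fun w => discTail k' v M z w p := by
  have := continuous_fockCoeff_right p.1 z
  unfold discTail
  split_ifs <;> fun_prop

lemma pow_mul_discTail {k' : ℝ} {v : ℕ × ℕ → ℂ} {M : ℕ} (hM : ∀ m < M, ∀ n, v (n, m) = 0)
    (z w : ℂ) (p : ℕ × ℕ) :
    w ^ M * discTail k' v M z w p = fockCoeff p.1 z w * discCoeff k' p.2 w * v p := by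
  by_cases hp : p.2 < M
  · rw [show v p = 0 from hM p.2 hp p.1, discTail, if_pos hp, mul_zero, mul_zero]
  · have h1 : w ^ p.2 = w ^ (p.2 - M) * w ^ M := by
      rw [← pow_add, Nat.sub_add_cancel (not_lt.1 hp)]
    rw [discTail, if_neg hp, discCoeff, h1]
    ring

/-- For `w ≠ 0` the factor `w ^ M` can be divided out of the vanishing sum; dominated convergence
extends the result to `w = 0`. -/
lemma tsum_discTail_zero {k' : ℝ} (hk : 0 < k') {v : ℕ × ℕ → ℂ} {B : ℝ}
    (hB : ∀ p, ‖v p‖ ≤ B) (z : ℂ) (hv : ∀ w : ℂ, ‖w‖ < 1 →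
      HasSum (fun p : ℕ × ℕ => fockCoeff p.1 z w * discCoeff k' p.2 w * v p) 0)
    {M : ℕ} (hM : ∀ m < M, ∀ n, v (n, m) = 0) : ∑' p, discTail k' v M z 0 p = 0 := by
  obtain ⟨bound, hbs, hle⟩ := exists_norm_discTail_le hk hB M z
  have hlim : Tendsto (fun w => ∑' p, discTail k' v M z w p) (𝓝[≠] 0)
      (𝓝 (∑' p, discTail k' v M z 0 p)) := by
    refine tendsto_tsum_of_dominated_convergence hbs (fun p =>
      ((continuous_discTail k' v M z p).tendsto 0).mono_left nhdsWithin_le_nhds) ?_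
    filter_upwards [nhdsWithin_le_nhds (Metric.ball_mem_nhds (0 : ℂ) (by norm_num :
      (0 : ℝ) < 1 / 2))] with w hw
    exact hle w (mem_ball_zero_iff.1 hw).le
  have hzero : ∀ᶠ w in 𝓝[≠] (0 : ℂ), ∑' p, discTail k' v M z w p = 0 := by
    filter_upwards [nhdsWithin_le_nhds (Metric.ball_mem_nhds (0 : ℂ) one_pos),
      self_mem_nhdsWithin] with w hw hw0
    have h1 := (hv w (mem_ball_zero_iff.1 hw)).tsum_eq
    simp only [← pow_mul_discTail hM] at h1
    rw [tsum_mul_left, mul_eq_zero] at h1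
    exact h1.resolve_left (pow_ne_zero _ hw0)
  exact tendsto_nhds_unique hlim (tendsto_const_nhds.congr' (hzero.mono fun w hw => hw.symm))

lemma hasSum_discTail_zero {k' : ℝ} (hk : 0 < k') {v : ℕ × ℕ → ℂ} {B : ℝ}
    (hB : ∀ p, ‖v p‖ ≤ B) (z : ℂ) (hv : ∀ w : ℂ, ‖w‖ < 1 →
      HasSum (fun p : ℕ × ℕ => fockCoeff p.1 z w * discCoeff k' p.2 w * v p) 0)
    {M : ℕ} (hM : ∀ m < M, ∀ n, v (n, m) = 0) : HasSum (discTail k' v M z 0) 0 := by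
  obtain ⟨bound, hbs, hle⟩ := exists_norm_discTail_le hk hB M z
  have hs : Summable (discTail k' v M z 0) := Summable.of_norm_bounded hbs (hle 0 (by norm_num))
  have h := hs.hasSum
  rwa [tsum_discTail_zero hk hB z hv hM] at h

/-- At `w = 0` only the row `p.2 = M` survives, and `Pₙ` reduces to `zⁿ`, leaving a power series in
`z`. -/
lemma hasSum_of_discTail_zero {k' : ℝ} {v : ℕ × ℕ → ℂ} {M : ℕ} {z : ℂ}
    (h : HasSum (discTail k' v M z 0) 0) : HasSum (fun n => z ^ n *
      ((((√(n.factorial : ℝ))⁻¹ : ℝ) : ℂ) * (discWeight k' M * v (n, M)))) 0 := by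
  have hinj : Function.Injective fun n : ℕ => (n, M) := fun a b h => congrArg Prod.fst h
  rw [← hinj.hasSum_iff] at h
  · refine h.congr_fun fun n => ?_
    rw [Function.comp, discTail, if_neg (lt_irrefl M), fockCoeff, P_zero_right, Nat.sub_self,
      pow_zero]
    ring
  · intro p hp
    by_cases hpM : p.2 < M
    · rw [discTail, if_pos hpM]
    have hne : p.2 - M ≠ 0 := fun h => hp ⟨p.1, Prod.ext rfl (by simp only; omega)⟩
    rw [discTail, if_neg hpM, zero_pow hne, mul_zero, mul_zero, zero_mul]

/-- Totality of the products of the coefficients of the coherent states. -/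
lemma eq_zero_of_hasSum_fockCoeff_mul_discCoeff {k' : ℝ} (hk : 0 < k') {v : ℕ × ℕ → ℂ} {B : ℝ}
    (hB : ∀ p, ‖v p‖ ≤ B) (hv : ∀ z w : ℂ, ‖w‖ < 1 →
      HasSum (fun p : ℕ × ℕ => fockCoeff p.1 z w * discCoeff k' p.2 w * v p) 0) (p : ℕ × ℕ) :
    v p = 0 := by
  suffices H : ∀ M n, v (n, M) = 0 from H p.2 p.1
  intro M
  -- The rows of `v` vanish one after another, in the order of their degree in the discrete
  -- variable.
  induction M using Nat.strong_induction_on with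
  | _ M ih =>
  intro n
  have h1 := eq_zero_of_hasSum_pow_eq_zero
    (fun z _ => hasSum_of_discTail_zero (hasSum_discTail_zero hk hB z (hv z) ih)) n
  have h2 : (0 : ℝ) < √(n.factorial : ℝ) := Real.sqrt_pos.2 (by exact_mod_cast n.factorial_pos)
  have h3 : (((√(n.factorial : ℝ))⁻¹ : ℝ) : ℂ) ≠ 0 := by exact_mod_cast (inv_pos.2 h2).ne'
  have h4 : (discWeight k' M : ℂ) ≠ 0 := by exact_mod_cast (discWeight_pos hk M).ne'
  rw [mul_eq_zero, mul_eq_zero] at h1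
  exact (h1.resolve_left h3).resolve_left h4

end Total

/-! ### Operators of the tensor product paired with coherent states. -/

lemma inner_incl_pureTensor_single (u : ℕ →₀ ℂ) (m : ℕ) (c : ℂ) (f : Hilb (ℕ × ℕ)) (g : Hilb ℕ)
    (d : ℂ) (h : ∀ n, f (n, m) = g n * d) :
    ⟪incl (ℕ × ℕ) (pureTensor u (Finsupp.single m c)), f⟫_ℂ = conj c * d * ⟪incl ℕ u, g⟫_ℂ := by
  induction u using Finsupp.induction_linear with
  | zero => simp [pureTensor]
  | add u u' hu hu' =>
    rw [pureTensor_add_left, map_add, map_add, inner_add_left, inner_add_left, hu, hu', mul_add]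
  | single n e =>
    rw [pureTensor_single, inner_incl_single, inner_incl_single, h, map_mul]
    ring

lemma tens_one_right_single (A : Module.End ℂ (ℕ →₀ ℂ)) (p : ℕ × ℕ) :
    tens A 1 (Finsupp.single p 1)
      = pureTensor (A (Finsupp.single p.1 1)) (Finsupp.single p.2 1) := by
  rw [← mul_one (1 : ℂ), ← pureTensor_single, tens_pureTensor, mul_one]
  rfl

lemma inner_tens_left {k' : ℝ} (hk : 0 < k') (A : Module.End ℂ (ℕ →₀ ℂ)) (p : ℕ × ℕ) (z : ℂ)
    {w : ℂ} (hw : ‖w‖ < 1) :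
    ⟪incl (ℕ × ℕ) (tens A 1 (Finsupp.single p 1)), coherent (fockDiscrete k') z w⟫_ℂ
      = ⟪incl ℕ (A (Finsupp.single p.1 1)), coherent fock z w⟫_ℂ * discCoeff k' p.2 w := by
  rw [tens_one_right_single, inner_incl_pureTensor_single _ _ _ _ (coherent fock z w)
    (discCoeff k' p.2 w) fun n => ?_, map_one, one_mul, mul_comm]
  rw [coherent_fockDiscrete_apply hk z hw, coherent_fock_apply z hw]

lemma tens_one_left_single {B : Module.End ℂ (ℕ →₀ ℂ)} {p : ℕ × ℕ} {m : ℕ} {c : ℂ}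
    (hB : B (Finsupp.single p.2 1) = Finsupp.single m c) :
    tens 1 B (Finsupp.single p 1) = Finsupp.single (p.1, m) c := by
  rw [← mul_one (1 : ℂ), ← pureTensor_single, tens_pureTensor, hB, Module.End.one_apply,
    pureTensor_single, one_mul]

lemma inner_tens_right {k' : ℝ} (hk : 0 < k') {B : Module.End ℂ (ℕ →₀ ℂ)} {p : ℕ × ℕ} {m : ℕ}
    {c : ℝ} (hB : B (Finsupp.single p.2 1) = Finsupp.single m (c : ℂ)) (z : ℂ) {w : ℂ}
    (hw : ‖w‖ < 1) :
    ⟪incl (ℕ × ℕ) (tens 1 B (Finsupp.single p 1)), coherent (fockDiscrete k') z w⟫_ℂ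
      = fockCoeff p.1 z w * (c * discCoeff k' m w) := by
  rw [tens_one_left_single hB, inner_incl_single, coherent_fockDiscrete_apply hk z hw,
    Complex.conj_ofReal]
  ring

lemma discreteK0_single (k' : ℝ) (m : ℕ) :
    discreteK0 k' (Finsupp.single m 1) = Finsupp.single m ((k' + m : ℝ) : ℂ) := by
  rw [discreteK0, onBasis_single, one_smul]

lemma discreteKp_single (k' : ℝ) (m : ℕ) : discreteKp k' (Finsupp.single m 1)
    = Finsupp.single (m + 1) ((√((m + 1 : ℝ) * (m + 2 * k')) : ℝ) : ℂ) := by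
  rw [discreteKp, onBasis_single, one_smul]

lemma discreteKm_single (k' : ℝ) (m : ℕ) : discreteKm k' (Finsupp.single m 1)
    = Finsupp.single (m - 1) ((√((m : ℝ) * (m + 2 * k' - 1)) : ℝ) : ℂ) := by
  rw [discreteKm, onBasis_single, one_smul]

lemma norm_incl_tens_left_le (X : Module.End ℂ (ℕ →₀ ℂ))
    (hX : X ∈ [1, fock.a, fock.adag, fock.K0, fock.Kp, fock.Km]) (p : ℕ × ℕ) :
    ‖incl (ℕ × ℕ) (tens X 1 (Finsupp.single p 1))‖ ≤ p.1 + 1 := by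
  rw [tens_one_right_single, norm_incl_pureTensor_single, norm_one, one_mul]
  exact norm_incl_fock_le X hX p.1

lemma norm_incl_tens_right_le {k' : ℝ} (hk : 0 < k') (Y : Module.End ℂ (ℕ →₀ ℂ))
    (hY : Y ∈ [discreteK0 k', discreteKp k', discreteKm k']) (p : ℕ × ℕ) :
    ‖incl (ℕ × ℕ) (tens 1 Y (Finsupp.single p 1))‖ ≤ (1 + 2 * k') * (p.2 + 1) := by
  have hm : (0 : ℝ) ≤ p.2 := Nat.cast_nonneg _
  have hkm : 0 ≤ k' * p.2 := by positivity
  simp only [List.mem_cons, List.not_mem_nil, or_false] at hY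
  rcases hY with rfl | rfl | rfl
  · rw [tens_one_left_single (discreteK0_single k' p.2), norm_incl_single]
    exact norm_ofReal_le (by positivity) (by nlinarith)
  · rw [tens_one_left_single (discreteKp_single k' p.2), norm_incl_single]
    exact norm_ofReal_le (Real.sqrt_nonneg _) (sqrt_le_of_le_sq (by positivity) (by
      nlinarith [mul_nonneg hkm hm, mul_nonneg hkm hk.le, mul_nonneg hkm hkm]))
  · rw [tens_one_left_single (discreteKm_single k' p.2), norm_incl_single]
    exact norm_ofReal_le (Real.sqrt_nonneg _) (sqrt_le_of_le_sq (by positivity) (by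
      nlinarith [mul_nonneg hkm hm, mul_nonneg hkm hk.le, mul_nonneg hkm hkm]))

lemma norm_incl_fockDiscrete_le {k' : ℝ} (hk : 0 < k') (X : Module.End ℂ (ℕ × ℕ →₀ ℂ))
    (hX : X ∈ [1, (fockDiscrete k').a, (fockDiscrete k').adag, (fockDiscrete k').K0,
      (fockDiscrete k').Kp, (fockDiscrete k').Km]) (p : ℕ × ℕ) :
    ‖incl (ℕ × ℕ) (X (Finsupp.single p 1))‖ ≤ (2 + 2 * k') * ((p.1 + 1) * (p.2 + 1)) := by
  have hn : (0 : ℝ) ≤ p.1 := Nat.cast_nonneg _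
  have hm : (0 : ℝ) ≤ p.2 := Nat.cast_nonneg _
  have hnm := mul_nonneg hn hm
  have hleft : ∀ X ∈ [1, fock.a, fock.adag, fock.K0, fock.Kp, fock.Km],
      ‖incl (ℕ × ℕ) (tens X 1 (Finsupp.single p 1))‖ ≤ (2 + 2 * k') * ((p.1 + 1) * (p.2 + 1)) :=
    fun X hX => (norm_incl_tens_left_le X hX p).trans (by
      nlinarith [mul_nonneg hk.le hnm, mul_nonneg hk.le hn, mul_nonneg hk.le hm])
  have hadd : ∀ X ∈ [1, fock.a, fock.adag, fock.K0, fock.Kp, fock.Km],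
      ∀ Y ∈ [discreteK0 k', discreteKp k', discreteKm k'],
      ‖incl (ℕ × ℕ) ((tens X 1 + tens 1 Y) (Finsupp.single p 1))‖
        ≤ (2 + 2 * k') * ((p.1 + 1) * (p.2 + 1)) := by
    intro X hX Y hY
    rw [LinearMap.add_apply, map_add]
    refine (norm_add_le _ _).trans ((add_le_add (norm_incl_tens_left_le X hX p)
      (norm_incl_tens_right_le hk Y hY p)).trans ?_)
    nlinarith [mul_nonneg hk.le hnm, mul_nonneg hk.le hn, mul_nonneg hk.le hm]
  simp only [List.mem_cons, List.not_mem_nil, or_false] at hX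
  rcases hX with rfl | rfl | rfl | rfl | rfl | rfl
  · rw [Module.End.one_apply, norm_incl_single, norm_one]
    nlinarith [mul_nonneg hk.le hnm, mul_nonneg hk.le hn, mul_nonneg hk.le hm]
  · exact hleft fock.a (by simp)
  · exact hleft fock.adag (by simp)
  · exact hadd fock.K0 (by simp) (discreteK0 k') (by simp)
  · exact hadd fock.Kp (by simp) (discreteKp k') (by simp)
  · exact hadd fock.Km (by simp) (discreteKm k') (by simp)

/-- The pairings of the basis vectors with a coherent state, for the operators of the tensor
product. -/
lemma inner_fockDiscrete_add {k' : ℝ} (hk : 0 < k') {A B : Module.End ℂ (ℕ →₀ ℂ)} {p : ℕ × ℕ}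
    {m : ℕ} {c : ℝ} (hB : B (Finsupp.single p.2 1) = Finsupp.single m (c : ℂ)) (z : ℂ) {w : ℂ}
    (hw : ‖w‖ < 1) :
    ⟪incl (ℕ × ℕ) ((tens A 1 + tens 1 B) (Finsupp.single p 1)), coherent (fockDiscrete k') z w⟫_ℂ
      = ⟪incl ℕ (A (Finsupp.single p.1 1)), coherent fock z w⟫_ℂ * discCoeff k' p.2 w
        + fockCoeff p.1 z w * (c * discCoeff k' m w) := by
  rw [LinearMap.add_apply, map_add, inner_add_left, inner_tens_left hk A p z hw,
    inner_tens_right hk hB z hw]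

lemma inner_fockDiscrete_a {k' : ℝ} (hk : 0 < k') (p : ℕ × ℕ) (z : ℂ) {w : ℂ} (hw : ‖w‖ < 1) :
    ⟪incl (ℕ × ℕ) ((fockDiscrete k').a (Finsupp.single p 1)), coherent (fockDiscrete k') z w⟫_ℂ
      = ⟪incl ℕ (fock.a (Finsupp.single p.1 1)), coherent fock z w⟫_ℂ * discCoeff k' p.2 w :=
  inner_tens_left hk fock.a p z hw

lemma inner_fockDiscrete_adag {k' : ℝ} (hk : 0 < k') (p : ℕ × ℕ) (z : ℂ) {w : ℂ} (hw : ‖w‖ < 1) :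
    ⟪incl (ℕ × ℕ) ((fockDiscrete k').adag (Finsupp.single p 1)),
        coherent (fockDiscrete k') z w⟫_ℂ
      = ⟪incl ℕ (fock.adag (Finsupp.single p.1 1)), coherent fock z w⟫_ℂ * discCoeff k' p.2 w :=
  inner_tens_left hk fock.adag p z hw

lemma inner_fockDiscrete_K0 {k' : ℝ} (hk : 0 < k') (p : ℕ × ℕ) (z : ℂ) {w : ℂ} (hw : ‖w‖ < 1) :
    ⟪incl (ℕ × ℕ) ((fockDiscrete k').K0 (Finsupp.single p 1)), coherent (fockDiscrete k') z w⟫_ℂ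
      = ⟪incl ℕ (fock.K0 (Finsupp.single p.1 1)), coherent fock z w⟫_ℂ * discCoeff k' p.2 w
        + fockCoeff p.1 z w * ((k' + p.2 : ℝ) * discCoeff k' p.2 w) :=
  inner_fockDiscrete_add hk (discreteK0_single k' p.2) z hw

lemma inner_fockDiscrete_Kp {k' : ℝ} (hk : 0 < k') (p : ℕ × ℕ) (z : ℂ) {w : ℂ} (hw : ‖w‖ < 1) :
    ⟪incl (ℕ × ℕ) ((fockDiscrete k').Kp (Finsupp.single p 1)), coherent (fockDiscrete k') z w⟫_ℂ
      = ⟪incl ℕ (fock.Kp (Finsupp.single p.1 1)), coherent fock z w⟫_ℂ * discCoeff k' p.2 w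
        + fockCoeff p.1 z w
          * ((√((p.2 + 1 : ℝ) * (p.2 + 2 * k')) : ℝ) * discCoeff k' (p.2 + 1) w) :=
  inner_fockDiscrete_add hk (discreteKp_single k' p.2) z hw

lemma inner_fockDiscrete_Km {k' : ℝ} (hk : 0 < k') (p : ℕ × ℕ) (z : ℂ) {w : ℂ} (hw : ‖w‖ < 1) :
    ⟪incl (ℕ × ℕ) ((fockDiscrete k').Km (Finsupp.single p 1)), coherent (fockDiscrete k') z w⟫_ℂ
      = ⟪incl ℕ (fock.Km (Finsupp.single p.1 1)), coherent fock z w⟫_ℂ * discCoeff k' p.2 w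
        + fockCoeff p.1 z w
          * ((√((p.2 : ℝ) * (p.2 + 2 * k' - 1)) : ℝ) * discCoeff k' (p.2 - 1) w) :=
  inner_fockDiscrete_add hk (discreteKm_single k' p.2) z hw

/-- The Gram matrix is the product of Mehler's kernel and the binomial series; their powers `-1/2`
and `-2k'` of `1 - conj w * w'` add to `-2(k' + 1/4)`. -/
lemma inner_coherent_fockDiscrete {k' : ℝ} (hk : 0 < k') (z z' : ℂ) {w w' : ℂ} (hw : ‖w‖ < 1)
    (hw' : ‖w'‖ < 1) :
    ⟪coherent (fockDiscrete k') z w, coherent (fockDiscrete k') z' w'⟫_ℂ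
      = gram (k' + 1 / 4 : ℝ) z w z' w' := by
  have hs := lp.hasSum_inner (𝕜 := ℂ) (coherent (fockDiscrete k') z w)
    (coherent (fockDiscrete k') z' w')
  have h1 : HasSum (fun p : ℕ × ℕ => (conj (fockCoeff p.1 z w) * fockCoeff p.1 z' w')
      * (conj (discCoeff k' p.2 w) * discCoeff k' p.2 w'))
      ⟪coherent (fockDiscrete k') z w, coherent (fockDiscrete k') z' w'⟫_ℂ := by
    refine hs.congr_fun fun p => ?_
    rw [RCLike.inner_apply, coherent_fockDiscrete_apply hk z hw,
      coherent_fockDiscrete_apply hk z' hw', map_mul]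
    ring
  have h2 := (inner_fockCoeff z z' hw hw').mul (inner_discCoeff hk hw hw') h1.summable
  rw [h1.unique h2, gram_eq_exp _ _ _ hw hw', gram_eq_exp _ _ _ hw hw', ← Complex.exp_add]
  congr 1
  push_cast
  ring

lemma eq_zero_of_inner_coherent_fockDiscrete {k' : ℝ} (hk : 0 < k') (v : Hilb (ℕ × ℕ))
    (hv : ∀ z w, ‖w‖ < 1 → ⟪coherent (fockDiscrete k') z w, v⟫_ℂ = 0) : v = 0 := by
  ext p
  refine eq_zero_of_hasSum_fockCoeff_mul_discCoeff hk (v := v) (B := ‖v‖)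
    (fun p => lp.norm_apply_le_norm two_ne_zero v p) (fun z w hw => ?_) p
  have hwc : ‖conj w‖ < 1 := by rwa [Complex.norm_conj]
  have h1 := lp.hasSum_inner (𝕜 := ℂ) (coherent (fockDiscrete k') (conj z) (conj w)) v
  rw [hv _ _ hwc] at h1
  refine h1.congr_fun fun p => ?_
  rw [RCLike.inner_apply, coherent_fockDiscrete_apply hk _ hwc, map_mul, fockCoeff_conj,
    discCoeff_conj, Complex.conj_conj, Complex.conj_conj]
  ring

/-- Each operator identity is the Leibniz combination of the Fock identity and the one for
`discCoeff`; `a` and `a†` touch only the Fock factor. -/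
lemma isCoherent_fockDiscrete {k' : ℝ} (hk : 0 < k') :
    IsCoherent (fockDiscrete k') (k' + 1 / 4) where
  inner z w z' w' hw hw' := inner_coherent_fockDiscrete hk z z' hw hw'
  total v hv := eq_zero_of_inner_coherent_fockDiscrete hk v hv
  summable X hX z w hw := by
    have h1 := (((geomBounded_fockCoeff z hw).summable_succ_mul.mul_of_nonneg
      (geomBounded_discCoeff hk hw).summable_succ_mul (fun n => by
        simp only [Pi.zero_apply]; positivity) fun n => by
        simp only [Pi.zero_apply]; positivity)).mul_left (2 + 2 * k')
    refine Summable.of_nonneg_of_le (fun n => by positivity) (fun p => ?_) h1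
    rw [coherent_fockDiscrete_apply hk z hw, norm_mul]
    calc _ ≤ ‖fockCoeff p.1 z w‖ * ‖discCoeff k' p.2 w‖
          * ((2 + 2 * k') * ((p.1 + 1) * (p.2 + 1))) := by
          gcongr
          exact norm_incl_fockDiscrete_le hk X hX p
      _ = _ := by ring
  adag p z w hw := by
    rw [inner_fockDiscrete_adag hk p z hw, inner_fockDiscrete_a hk p z hw,
      isCoherent_fock.adag p.1 z w hw, coherent_fockDiscrete_apply hk z hw,
      coherent_fock_apply z hw]
    ring
  K0 p z w hw := by
    rw [inner_fockDiscrete_K0 hk p z hw, inner_fockDiscrete_a hk p z hw,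
      inner_fockDiscrete_Km hk p z hw, isCoherent_fock.K0 p.1 z w hw,
      coherent_fockDiscrete_apply hk z hw, coherent_fock_apply z hw]
    have h1 := mul_discCoeff_Km hk p.2 w
    push_cast
    linear_combination (-fockCoeff p.1 z w) * h1
  Kp p z w hw := by
    rw [inner_fockDiscrete_Kp hk p z hw, inner_fockDiscrete_a hk p z hw,
      inner_fockDiscrete_Km hk p z hw, isCoherent_fock.Kp p.1 z w hw,
      coherent_fockDiscrete_apply hk z hw, coherent_fock_apply z hw]
    have h1 := discCoeff_Kp_identity hk p.2 w
    push_cast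
    linear_combination fockCoeff p.1 z w * h1
  hasDerivAt p z w z' w' hz hw hws := by
    rw [inner_fockDiscrete_a hk p _ (hws 0), inner_fockDiscrete_Km hk p _ (hws 0)]
    have h1 := isCoherent_fock.hasDerivAt p.1 z w z' w' hz hw hws
    simp only [coherent_fock_apply _ (hws _)] at h1
    simp only [coherent_fockDiscrete_apply hk _ (hws _)]
    refine (h1.fun_mul (hasDerivAt_discCoeff hk p.2 hw)).congr_deriv ?_
    ring

end JacobiGroup

end

theorem mainTheorem4 :
    -- The space `H_K` with `k = 1/4`: the kernel is positive semidefinite, and the functions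
    -- `(n!)^{-1/2} Pₙ` are an orthonormal basis of the Hilbert space of functions it reproduces.
    ((JacobiGroup.kernelMatrix (1 / 4)).PosSemidef ∧
      ∀ (H : Type*) [NormedAddCommGroup H] [InnerProductSpace ℂ H] [CompleteSpace H]
        [RKHS ℂ H JacobiGroup.Domain ℂ],
        RKHS.kernel H = JacobiGroup.kernelMatrix (1 / 4) →
        ∃ B : HilbertBasis ℕ ℂ H, ∀ (n : ℕ) (x : JacobiGroup.Domain),
          (B n) x = ((√(n.factorial : ℝ))⁻¹ : ℝ) * JacobiGroup.P n x.1 (x.2 : ℂ)) ∧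
    -- The realization `K₊ = ½ (a†)²` on the Fock space (`k = 1/4`).
    ((∀ z w : ℂ, ‖w‖ < 1 → Summable (JacobiGroup.coherentTerm JacobiGroup.fock z w)) ∧
      -- this kernel and these functions come from this realization
      (∀ x y : JacobiGroup.Domain,
        ⟪JacobiGroup.coherent JacobiGroup.fock (conj x.1) (conj (x.2 : ℂ)),
          JacobiGroup.coherent JacobiGroup.fock (conj y.1) (conj (y.2 : ℂ))⟫_ℂ
            = JacobiGroup.bergmanKernel (1 / 4) x y) ∧
      (∀ (n : ℕ) (x : JacobiGroup.Domain),
        ⟪JacobiGroup.coherent JacobiGroup.fock (conj x.1) (conj (x.2 : ℂ)),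
          JacobiGroup.incl ℕ (Finsupp.single n 1)⟫_ℂ
            = ((√(n.factorial : ℝ))⁻¹ : ℝ) * JacobiGroup.P n x.1 (x.2 : ℂ)) ∧
      (∃ π, JacobiGroup.IsRepWithDifferential JacobiGroup.fock π) ∧
      ∀ π, JacobiGroup.IsRepWithDifferential JacobiGroup.fock π →
        ∀ (h : JacobiGroup.CoverJacobi) (z w : ℂ), ‖w‖ < 1 →
          ‖JacobiGroup.w₁ h w‖ < 1 ∧
          (π h : JacobiGroup.Hilb ℕ →L[ℂ] JacobiGroup.Hilb ℕ)
              (JacobiGroup.coherent JacobiGroup.fock z w)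
            = (Complex.exp (Complex.I * h.t) * JacobiGroup.multiplier (1 / 4) h z w) •
              JacobiGroup.coherent JacobiGroup.fock (JacobiGroup.z₁ h z w) (JacobiGroup.w₁ h w)) ∧
    -- The general case `k = k' + 1/4`, `k' > 0`.
    (∀ k' : ℝ, 0 < k' →
      (∀ z w : ℂ, ‖w‖ < 1 →
        Summable (JacobiGroup.coherentTerm (JacobiGroup.fockDiscrete k') z w)) ∧
      (∃ π, JacobiGroup.IsRepWithDifferential (JacobiGroup.fockDiscrete k') π) ∧
      ∀ π, JacobiGroup.IsRepWithDifferential (JacobiGroup.fockDiscrete k') π →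
        ∀ (h : JacobiGroup.CoverJacobi) (z w : ℂ), ‖w‖ < 1 →
          ‖JacobiGroup.w₁ h w‖ < 1 ∧
          (π h : JacobiGroup.Hilb (ℕ × ℕ) →L[ℂ] JacobiGroup.Hilb (ℕ × ℕ))
              (JacobiGroup.coherent (JacobiGroup.fockDiscrete k') z w)
            = (Complex.exp (Complex.I * h.t) * JacobiGroup.multiplier (k' + 1 / 4) h z w) •
              JacobiGroup.coherent (JacobiGroup.fockDiscrete k')
                (JacobiGroup.z₁ h z w) (JacobiGroup.w₁ h w)) := by
  refine ⟨⟨JacobiGroup.posSemidef_kernelMatrix, fun H _ _ _ _ hK =>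
    JacobiGroup.exists_hilbertBasis_of_kernel H hK⟩,
    ⟨fun z w hw => JacobiGroup.summable_coherentTerm_fock z hw,
      JacobiGroup.inner_coherent_fock_conj, JacobiGroup.inner_coherent_fock_single,
      JacobiGroup.isCoherent_fock.exists_rep_and_apply⟩, fun k' hk =>
    ⟨fun z w hw => (JacobiGroup.hasSum_coherentTerm_fockDiscrete hk z hw).summable,
      (JacobiGroup.isCoherent_fockDiscrete hk).exists_rep_and_apply⟩⟩
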